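/- **Setting.** Let $E\subseteq\mathbb R^d$ be open, and let $A$ be a separable metric space that is a Borel space, with Borel $\sigma$-algebras $\mathcal E$, $\mathcal A$. Let $\delta>0$ and assume: * $h:E\times A\to\mathbb R^d$ is bounded, and $|h(x,a)-h(x',a')|\le L_h(|x-x'|+d_A(a,a'))$ for some constant $L_h$; for all $(x,a)\in E\times A$ the equation $\dot y=h(y,a)$, $y(0)=x$ has a (necessarily unique) solution $\phi(t,x,a)$ that stays in $E$ for all $t\ge0$; * $\lambda:E\times A\to[0,\infty)$ and $f:E\times A\to[0,\infty)$ are bounded and uniformly continuous; * $Q$ is a Feller probability kernel from $E\times A$ to $E$, i.e. $(x,a)\mapsto\int_E v(y)\,Q(x,a,dy)$ is continuous for every bounded continuous $v:E\to\mathbb R$; * $\lambda_0$ is a finite measure on $(A,\mathcal A)$ with full topological support. Let $\Omega$ be the set of all $\omega=(e_0,a_0,(t_n,e_n,a_n)_{n\ge1})$ with $(e_0,a_0)\in E\times A$, $(t_n,e_n,a_n)\in((0,\infty)\times E\times A)\cup\{(\infty,\Delta,\Delta')\}$, $t_n\le t_{n+1}$, and $t_n<t_{n+1}$ if $t_n<\infty$.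 Put $T_0=0$, $T_n(\omega)=t_n$, $E_n(\omega)=e_n$, $A_n(\omega)=a_n$, and $$(X_t,I_t)=(\phi(t-T_n,E_n,A_n),A_n)\quad\text{if }T_n\le t<T_{n+1},\qquad (X_t,I_t)=(\Delta,\Delta')\quad\text{if }t\ge\lim_nT_n,$$ with $f(\Delta,\Delta')=0$. Let $p(ds\,dy\,db)=\sum_{n\ge1}1_{\{T_n<\infty\}}\delta_{(T_n,E_n,A_n)}(ds\,dy\,db)$, let $\mathcal F_t$ be generated by $(E_0,A_0)$ and the variables $p((0,s]\times B)$, $s\le t$, $B\in\mathcal E\otimes\mathcal A$, let $\mathcal F_\infty=\bigvee_t\mathcal F_t$, and let $\mathcal P$ be the predictable $\sigma$-algebra of $(\mathcal F_t)_{t\ge0}$. Let $\mathcal V$ be the set of bounded $\mathcal P\otimes\mathcal A$-measurable maps $\nu:\Omega\times[0,\infty)\times A\to(0,\infty)$. For $(x,a)\in E\times A$ and $\nu\in\mathcal V$ let $\mathbb P^{x,a}_\nu$ be the probability on $(\Omega,\mathcal F_\infty)$ under which $(E_0,A_0)=(x,a)$ a.s. and the compensator of $p$ (its dual predictable projection)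 is $$\tilde p^\nu(ds\,dy\,db)=\big[\nu_s(b)\,\lambda_0(db)\,\delta_{X_{s-}}(dy)+\lambda(X_{s-},I_{s-})\,Q(X_{s-},I_{s-},dy)\,\delta_{I_{s-}}(db)\big]\,ds .$$ Define $$J(x,a,\nu)=\mathbb E^{x,a}_\nu\Big[\int_0^\infty e^{-\delta t}f(X_t,I_t)\,dt\Big],\qquad V^*(x,a)=\inf_{\nu\in\mathcal V}J(x,a,\nu).$$ **Proposition.** Fix $x\in E$. 1. For all $a\in A$ and $\nu\in\mathcal V$ the probability $\mathbb P^{x,a}_\nu$ exists and is unique, so that $J(x,a,\nu)$ is well defined. 2. For all $a,a'\in A$ and $\nu\in\mathcal V$ there are controls $\nu^\varepsilon\in\mathcal V$, $\varepsilon>0$, such that $$\lim_{\varepsilon\to0^+}J(x,a',\nu^\varepsilon)=J(x,a,\nu).$$ They can be chosen so that, for some radii $r(\varepsilon)>0$ with $r(\varepsilon)\to0$ as $\varepsilon\to0^+$, the following holds for all $\varepsilon>0$, $\omega\in\Omega$, and $t\le T_1(\omega)$, where $\bar B(a,r)$ is the closed ball: $\nu^\varepsilon_t(b)=\dfrac{1}{\varepsilon\,\lambda_0(\bar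 B(a,r(\varepsilon)))}$ for $b\in\bar B(a,r(\varepsilon))$, and $\nu^\varepsilon_t(b)\le\varepsilon$ for $b\notin\bar B(a,r(\varepsilon))$. 3. Consequently $V^*(x,a)=V^*(x,a')$ for all $a,a'\in A$. -/

import Mathlib

open MeasureTheory ProbabilityTheory Filter Topology
open scoped NNReal ENNReal BoundedContinuousFunction

/-! ### The canonical space of marked point processes with marks in `E × A` -/

/-- The time coordinate of a point; `none` stands for the cemetery point `(∞, Δ, Δ')`. -/
def pointTime {E A : Type*} : Option (ℝ≥0 × E × A) → ℝ≥0∞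
  | none => ∞
  | some z => (z.1 : ℝ≥0∞)

/-- The sample space `Ω`: an initial condition `(e, a) ∈ E × A` and a sequence of points
`(t_n, e_n, a_n)_{n ≥ 1}` of `((0,∞) × E × A) ∪ {(∞, Δ, Δ')}` with `t_n ≤ t_{n+1}`, and
`t_n < t_{n+1}` if `t_n < ∞`. The point with index `n + 1` is `point n`. -/
structure JumpPath (E A : Type*) where
  init : E × A
  point : ℕ → Option (ℝ≥0 × E × A)
  pos : ∀ n, 0 < pointTime (point n)
  mono : ∀ n, pointTime (point n) ≤ pointTime (point (n + 1))
  strict : ∀ n, pointTime (point n) < ∞ → pointTime (point n) < pointTime (point (n + 1))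

namespace JumpPath

/-- The jump times `T_0 = 0, T_1, T_2, …`. -/
def T {E A : Type*} (ω : JumpPath E A) : ℕ → ℝ≥0∞
  | 0 => 0
  | n + 1 => pointTime (ω.point n)

/-- The marks `(E_0, A_0), (E_1, A_1), …`; `none` stands for `(Δ, Δ')`. -/
def mark {E A : Type*} (ω : JumpPath E A) : ℕ → Option (E × A)
  | 0 => some ω.init
  | n + 1 => (ω.point n).map Prod.snd

open Classical in
/-- The process `(X_t, I_t)`: it is `(φ(t - T_n, E_n, A_n), A_n)` for `T_n ≤ t < T_{n+1}`, and
`(Δ, Δ')`, written `none`, for `t ≥ lim T_n`. -/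
noncomputable def state {E A : Type*} (φ : ℝ → E → A → E) (ω : JumpPath E A) (t : ℝ≥0) :
    Option (E × A) :=
  if H : ∃ n, ω.T n ≤ t ∧ (t : ℝ≥0∞) < ω.T (n + 1) then
    (ω.mark H.choose).map fun z => (φ (t - (ω.T H.choose).toReal) z.1 z.2, z.2)
  else none

open Classical in
/-- The left limit `(X_{t-}, I_{t-})`: it is `(φ(t - T_n, E_n, A_n), A_n)` for
`T_n < t ≤ T_{n+1}` (the flow `φ` being continuous in time). -/
noncomputable def stateLeft {E A : Type*} (φ : ℝ → E → A → E) (ω : JumpPath E A) (t : ℝ≥0) :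
    Option (E × A) :=
  if H : ∃ n, ω.T n < t ∧ (t : ℝ≥0∞) ≤ ω.T (n + 1) then
    (ω.mark H.choose).map fun z => (φ (t - (ω.T H.choose).toReal) z.1 z.2, z.2)
  else none

variable {E A : Type*} [MeasurableSpace E] [MeasurableSpace A]

/-- The random measure `p(ω, ds dy db)`: a unit mass at each point `(T_n, E_n, A_n)`, `n ≥ 1`,
with `T_n < ∞`. -/
noncomputable def jumpMeasure (ω : JumpPath E A) : Measure (ℝ≥0 × E × A) :=
  Measure.sum fun n => (ω.point n).elim 0 Measure.dirac

/-- The σ-algebra `ℱ_t` generated by the initial condition and by the counting processes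
`N(s, B) = p((0,s] × B)`, `s ≤ t`, `B` measurable. -/
noncomputable abbrev sigmaAlg (E A : Type*) [MeasurableSpace E] [MeasurableSpace A] (t : ℝ≥0) :
    MeasurableSpace (JumpPath E A) :=
  MeasurableSpace.comap (fun ω : JumpPath E A => ω.init) inferInstance ⊔
    ⨆ (s : ℝ≥0) (_ : s ≤ t) (B : Set (E × A)) (_ : MeasurableSet B),
      MeasurableSpace.comap (fun ω : JumpPath E A => ω.jumpMeasure (Set.Ioc 0 s ×ˢ B))
        inferInstance

/-- `Ω` carries the σ-algebra `ℱ_∞` generated by all the `ℱ_t`. -/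
noncomputable instance instMeasurableSpace : MeasurableSpace (JumpPath E A) :=
  ⨆ t : ℝ≥0, sigmaAlg E A t

/-- The natural filtration `𝔽 = (ℱ_t)_{t ≥ 0}`. -/
noncomputable def natFiltration (E A : Type*) [MeasurableSpace E] [MeasurableSpace A] :
    Filtration ℝ≥0 (instMeasurableSpace : MeasurableSpace (JumpPath E A)) where
  seq := sigmaAlg E A
  mono' _ _ hst := sup_le_sup le_rfl <| iSup_mono fun _ =>
    iSup_mono' fun h => ⟨h.trans hst, le_rfl⟩
  le' t := le_iSup (sigmaAlg E A) t

/-- The predictable σ-algebra `𝒫` on `[0,∞) × Ω`. -/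
noncomputable abbrev predictableSigma (E A : Type*) [MeasurableSpace E] [MeasurableSpace A] :
    MeasurableSpace (ℝ≥0 × JumpPath E A) :=
  (natFiltration E A).predictable

/-- The class `𝒱` of controls: the bounded `𝒫 ⊗ 𝒜`-measurable maps
`ν : Ω × [0,∞) × A → (0,∞)`. -/
def controls (E A : Type*) [MeasurableSpace E] [MeasurableSpace A] :
    Set (JumpPath E A → ℝ≥0 → A → ℝ) :=
  {ν | (∀ ω t b, 0 < ν ω t b) ∧ (∃ C, ∀ ω t b, ν ω t b ≤ C) ∧
    Measurable[(predictableSigma E A).prod inferInstance]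
      fun q : (ℝ≥0 × JumpPath E A) × A => ν q.1.2 q.1.1 q.2}

end JumpPath

/-! ### The data of the control problem -/

/-- Drift `h`, jump rate `λ`, transition kernel `Q`, running cost `f`, the measure `λ₀` on the
space of actions and the discount factor `δ`; the state space `E` is a subset of `ℝ^d`. -/
structure PDMPData {d : ℕ} (E : Set (EuclideanSpace ℝ (Fin d))) (A : Type*)
    [MeasurableSpace A] where
  h : E × A → EuclideanSpace ℝ (Fin d)
  rate : E × A → ℝ
  Q : Kernel (E × A) E
  f : E × A → ℝ
  lam0 : Measure A
  δ : ℝ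

namespace PDMPData

variable {d : ℕ} {E : Set (EuclideanSpace ℝ (Fin d))} {A : Type*} [MeasurableSpace A]

/-- `γ : [0,∞) → E` solves `γ' = h(γ, a)`, `γ(0) = x` (the values of `γ` at negative times play
no role). -/
def IsTrajectory (D : PDMPData E A) (x : E) (a : A) (γ : ℝ → E) : Prop :=
  γ 0 = x ∧ ∀ t, 0 ≤ t →
    HasDerivWithinAt (fun s => (γ s : EuclideanSpace ℝ (Fin d))) (D.h (γ t, a)) (Set.Ici 0) t

open Classical in
/-- The flow `φ(t, x, a)`, `t ≥ 0`: the solution of `γ' = h(γ, a)`, `γ(0) = x`. -/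
noncomputable def flow (D : PDMPData E A) (t : ℝ) (x : E) (a : A) : E :=
  if H : ∃ γ, D.IsTrajectory x a γ then H.choose t else x

/-- The assumptions on `h`, `λ`, `Q`. The state space has no boundary that the flow could reach:
the trajectories stay in `E` for all times. -/
structure DynamicsHyp [MetricSpace A] (D : PDMPData E A) : Prop where
  lipschitz : ∃ L : ℝ, ∀ (x x' : E) (a a' : A),
    ‖D.h (x, a) - D.h (x', a')‖ ≤ L * (dist x x' + dist a a')
  bounded : ∃ M : ℝ, ∀ z, ‖D.h z‖ ≤ M
  flow_exists : ∀ (x : E) (a : A), ∃ γ, D.IsTrajectory x a γ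
  rate_nonneg : ∀ z, 0 ≤ D.rate z
  rate_bounded : ∃ M : ℝ, ∀ z, D.rate z ≤ M
  rate_unifCont : UniformContinuous D.rate
  markov : IsMarkovKernel D.Q
  feller : ∀ v : E →ᵇ ℝ, Continuous fun z => ∫ y, v y ∂(D.Q z)

/-- The assumption on `λ₀`: a finite measure with full topological support. -/
structure ActionMeasureHyp [MetricSpace A] (D : PDMPData E A) : Prop where
  finite : IsFiniteMeasure D.lam0
  fullSupport : D.lam0.IsOpenPosMeasure

/-- The assumption on `f`. -/
structure CostHyp [MetricSpace A] (D : PDMPData E A) : Prop where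
  nonneg : ∀ z, 0 ≤ D.f z
  bounded : ∃ M : ℝ, ∀ z, D.f z ≤ M
  unifCont : UniformContinuous D.f

/-! ### The dual control problem -/

/-- The measure on `E × A`
`ν_s(b) λ₀(db) δ_{X_{s-}}(dy) + λ(X_{s-}, I_{s-}) Q(X_{s-}, I_{s-}, dy) δ_{I_{s-}}(db)`,
so that `p̃^ν(ds dy db)` is this measure times `ds`. -/
noncomputable def intensity (D : PDMPData E A) (ν : JumpPath E A → ℝ≥0 → A → ℝ)
    (ω : JumpPath E A) (s : ℝ≥0) : Measure (E × A) :=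
  (ω.stateLeft D.flow s).elim 0 fun z =>
    (D.lam0.withDensity fun b => ENNReal.ofReal (ν ω s b)).map (fun b => (z.1, b)) +
      ENNReal.ofReal (D.rate z) • (D.Q z).map (fun y => (y, z.2))

/-- `p̃^ν` is the compensator (dual predictable projection) of `p` under `P`: for every
`𝒫 ⊗ ℰ ⊗ 𝒜`-measurable `H ≥ 0`, the integrals of `H` against `p` and `p̃^ν` have the same
expectation. -/
def IsCompensated (D : PDMPData E A) (ν : JumpPath E A → ℝ≥0 → A → ℝ)
    (P : Measure (JumpPath E A)) : Prop :=
  ∀ H : (ℝ≥0 × JumpPath E A) × (E × A) → ℝ≥0∞,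
    Measurable[(JumpPath.predictableSigma E A).prod inferInstance] H →
    ∫⁻ ω, (∫⁻ q, H ((q.1, ω), q.2) ∂ω.jumpMeasure) ∂P =
      ∫⁻ ω, (∫⁻ s in Set.Ioi (0 : ℝ),
        (∫⁻ z, H ((s.toNNReal, ω), z) ∂(D.intensity ν ω s.toNNReal))) ∂P

/-- `P` is a probability on `(Ω, ℱ_∞)` with initial law `δ_{(x,a)}`, under which `p̃^ν` is the
compensator of `p`. -/
structure IsDualLaw (D : PDMPData E A) (x : E) (a : A) (ν : JumpPath E A → ℝ≥0 → A → ℝ)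
    (P : Measure (JumpPath E A)) : Prop where
  prob : IsProbabilityMeasure P
  initial : P.map (fun ω => ω.init) = Measure.dirac (x, a)
  compensated : D.IsCompensated ν P

open Classical in
/-- The probability `ℙ^{x,a}_ν`. -/
noncomputable def dualLaw (D : PDMPData E A) (x : E) (a : A)
    (ν : JumpPath E A → ℝ≥0 → A → ℝ) : Measure (JumpPath E A) :=
  if H : ∃ P, D.IsDualLaw x a ν P then H.choose else 0

/-- The dual cost `J(x, a, ν) = 𝔼^{x,a}_ν ∫₀^∞ e^{-δt} f(X_t, I_t) dt` (with `f(Δ, Δ') = 0`). -/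
noncomputable def J (D : PDMPData E A) (x : E) (a : A) (ν : JumpPath E A → ℝ≥0 → A → ℝ) : ℝ :=
  ∫ ω, (∫ t in Set.Ioi (0 : ℝ),
    Real.exp (-D.δ * t) * (ω.state D.flow t.toNNReal).elim 0 D.f) ∂(D.dualLaw x a ν)

/-- The dual value function `V*(x, a) = inf_{ν ∈ 𝒱} J(x, a, ν)`. -/
noncomputable def Vstar (D : PDMPData E A) (x : E) (a : A) : ℝ :=
  ⨅ ν : JumpPath.controls E A, D.J x a ν

end PDMPData

/-! ### Measurability on `Option` -/

/-! Steering. Let `C` bound the control `ν`. The aim is to replace `ν`, which may depend on the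
whole past, by a feedback control with the same cost at `(x, a)`. For `θ ∈ [0,1]` let `V_θ` be the
bounded continuous mild solution of `δV = f + h·∇V + λ(QV - V) + ∫ ψ_θ(V(x,b) - V(x,a)) λ₀(db)` with
`ψ_θ(u) = C(1-θ) min(u,0) + Cθ max(u,0)` (`tilt`). Adding `K V` on both sides, with `K ≥ C λ₀(A) +
λ`, makes the nonlocal part monotone and `K`-Lipschitz (`nonlocal_le`), so `V_θ` is the fixed point
of a contraction of ratio `K/(δ+K)` and depends continuously on `θ` (`exists_fixedPoint`).

Since `ψ_0(u)` and `ψ_1(u)` are the extreme values of `c u` over `c ∈ [0, C]`, one has `V_0 ≤ J(·,ν)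
≤ V_1` (`le_J`, `J_le`), and the intermediate value theorem yields `θ` with `V_θ(x,a) = J(x,a,ν)`.
The feedback rate `C(1-θ)` towards lower values of `V_θ` and `Cθ` towards the others has cost `V_θ`.
Started from `a'`, the process first needs an action near `a`: up to `T_1` the control puts mass
`1/ε` on the ball of radius `ε` about `a`. The first jump then comes after a time of mean at most
`ε`, and mostly lands near `(x, a)`, where `V_θ` is continuous (`Concentrated.abs_J_sub_le`,
`tendsto_J_steered`). The equality of the values follows by exchanging `a` and `a'`.

Verification. No differentiability in space is used. The mild equation writes `V` as a resolvent of
the flow, so `e^{-δt} V(X_t)` is differentiable in `t` between jumps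
(`DynamicsHyp.hasDerivAt_discounted`). Integrating over `(T_n, T_{n+1}]` (`discounted_pathwise`),
compensating the jump terms and summing over `n` compares `V` with the cost. Negative terms are
moved to the other side, so integrals in `[0,∞]` suffice. The remainder tends to zero by
`tendsto_markMean`, with no separate proof that the jump times do not accumulate.

Laws. On `(T_n, T_{n+1}]` a predictable process is a function of time and of the path up to `T_n`
(`predictable_trunc`), so the compensator condition is equivalent to one identity for each point
(`Compensates.step`, `compensates_of_step`). For uniqueness, `t ↦ E[g; T_{n+1} ≥ t]`, with `g` a
function of the path up to `T_n`, satisfies a Volterra identity whose iteration has error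
`(Kt)^k/k!`. For existence, the points are drawn successively from their hazard rates, by the
Ionescu-Tulcea theorem. -/

instance Option.instMeasurableSpace {α : Type*} [MeasurableSpace α] : MeasurableSpace (Option α) :=
  MeasurableSpace.map some inferInstance

section OptionMeasurability

variable {α β γ : Type*} [MeasurableSpace α] [MeasurableSpace β] [MeasurableSpace γ]

theorem measurable_some : Measurable (some : α → Option α) := fun _ h => h

theorem measurableSet_image_some {s : Set α} (hs : MeasurableSet s) :
    MeasurableSet (some '' s) := by
  change MeasurableSet (some ⁻¹' (some '' s))
  rwa [Set.preimage_image_eq _ (Option.some_injective α)]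

theorem measurableSet_singleton_none : MeasurableSet ({none} : Set (Option α)) := by
  change MeasurableSet (some ⁻¹' ({none} : Set (Option α)))
  convert MeasurableSet.empty
  ext; simp

theorem measurableEmbedding_some : MeasurableEmbedding (some : α → Option α) :=
  ⟨Option.some_injective α, measurable_some, fun _ => measurableSet_image_some⟩

/-- The σ-algebra on `Option α` is pushed forward along `some`, so it imposes no condition at
`none`. -/
theorem measurable_of_comp_some {f : Option α → β} (h : Measurable (f ∘ some)) : Measurable f :=
  fun _ hs => h hs

theorem Option.set_eq_image_union {α : Type*} (s : Set (Option α)) :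
    s = some '' (some ⁻¹' s) ∪ (s ∩ {none}) := by
  ext y
  cases y <;> simp

/-- The event that `f` equals `none` is the complement of the preimage of `some '' univ`, so it
needs no test of its own. -/
theorem measurable_option_of_image {f : β → Option α}
    (h : ∀ s : Set α, MeasurableSet s → MeasurableSet (f ⁻¹' (some '' s))) : Measurable f := by
  have hnone : MeasurableSet (f ⁻¹' {none}) := by
    have : f ⁻¹' {none} = (f ⁻¹' (some '' Set.univ))ᶜ := by
      ext y
      simp only [Set.mem_preimage, Set.mem_singleton_iff, Set.mem_compl_iff]
      cases f y <;> simp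
    rw [this]
    exact (h _ .univ).compl
  intro s hs
  rw [Option.set_eq_image_union s, Set.preimage_union]
  refine (h _ hs).union ?_
  by_cases hn : none ∈ s
  · rwa [Set.inter_eq_right.2 (by simpa using hn)]
  · rw [Set.inter_singleton_eq_empty.2 hn]
    simp

/-- The product splits into a copy of `γ × α`, measurably embedded, and the slice `γ × {none}`. -/
theorem measurable_prod_option {f : γ × Option α → β} (hn : Measurable fun c => f (c, none))
    (hs : Measurable fun p : γ × α => f (p.1, some p.2)) : Measurable f := by
  intro s hs'
  have : f ⁻¹' s = Prod.map id some '' ((fun p : γ × α => f (p.1, some p.2)) ⁻¹' s) ∪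
      ((fun c => f (c, none)) ⁻¹' s) ×ˢ {none} := by
    ext ⟨c, y⟩
    cases y <;> simp
  rw [this]
  exact ((MeasurableEmbedding.id.prodMap measurableEmbedding_some).measurableSet_image.2
    (hs hs')).union ((hn hs').prod measurableSet_singleton_none)

/-- The sets `s` with measurable `f ⁻¹' (some '' s)` form a σ-algebra on `α × β` that contains the
cylinders over both factors. -/
theorem measurable_option_prod {f : γ → Option (α × β)}
    (h1 : Measurable fun c => (f c).map Prod.fst)
    (h2 : Measurable fun c => (f c).map Prod.snd) : Measurable f := by
  have huniv : MeasurableSet (f ⁻¹' (some '' Set.univ)) := by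
    convert h1 (measurableSet_image_some (.univ : MeasurableSet (Set.univ : Set α))) using 1
    ext c
    simp only [Set.mem_preimage]
    cases f c <;> simp
  suffices ∃ m : MeasurableSpace (α × β), (∀ s, MeasurableSet[m] s → MeasurableSet (f ⁻¹' (some '' s)))
      ∧ (Prod.instMeasurableSpace : MeasurableSpace (α × β)) ≤ m by
    exact measurable_option_of_image fun s hs => this.choose_spec.1 s (this.choose_spec.2 s hs)
  refine ⟨{ MeasurableSet' := fun s => MeasurableSet (f ⁻¹' (some '' s))
            measurableSet_empty := by simp
            measurableSet_compl := fun s hs => by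
              -- The complement is taken inside the event that `f` is not `none`.
              convert huniv.diff hs using 1
              ext c
              simp only [Set.mem_preimage, Set.mem_sdiff]
              cases f c <;> simp
            measurableSet_iUnion := fun g hg => by
              rw [Set.image_iUnion, Set.preimage_iUnion]
              exact MeasurableSet.iUnion hg }, fun _ h => h, sup_le ?_ ?_⟩
  · rintro _ ⟨u, hu, rfl⟩
    change MeasurableSet (f ⁻¹' (some '' (Prod.fst ⁻¹' u)))
    convert h1 (measurableSet_image_some hu) using 1
    ext c
    simp only [Set.mem_preimage]
    cases f c <;> simp
  · rintro _ ⟨u, hu, rfl⟩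
    change MeasurableSet (f ⁻¹' (some '' (Prod.snd ⁻¹' u)))
    convert h2 (measurableSet_image_some hu) using 1
    ext c
    simp only [Set.mem_preimage]
    cases f c <;> simp

theorem Measurable.option_map {f : α → β} (hf : Measurable f) : Measurable (Option.map f) :=
  measurable_of_comp_some (measurable_some.comp hf)

end OptionMeasurability

/-! ### Times of points and a dense set of times -/

@[simp] theorem pointTime_none {E A : Type*} :
    pointTime (none : Option (ℝ≥0 × E × A)) = ∞ := rfl

@[simp] theorem pointTime_some {E A : Type*} (z : ℝ≥0 × E × A) :
    pointTime (some z) = (z.1 : ℝ≥0∞) := rfl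

/-- A countable dense set of times. -/
def ratTimes : Set ℝ≥0 := (TopologicalSpace.exists_countable_dense ℝ≥0).choose

theorem countable_ratTimes : ratTimes.Countable :=
  (TopologicalSpace.exists_countable_dense ℝ≥0).choose_spec.1

theorem dense_ratTimes : Dense ratTimes :=
  (TopologicalSpace.exists_countable_dense ℝ≥0).choose_spec.2

theorem measurable_pointTime {E A : Type*} [MeasurableSpace E] [MeasurableSpace A] :
    Measurable (pointTime : Option (ℝ≥0 × E × A) → ℝ≥0∞) :=
  measurable_of_comp_some (measurable_fst.coe_nnreal_ennreal)

theorem pointTime_eq_top_iff {E A : Type*} {y : Option (ℝ≥0 × E × A)} :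
    pointTime y = ∞ ↔ y = none := by
  cases y <;> simp

namespace JumpPath

/-! ### Jump times, marks and the left limits of the state -/

section Basic

variable {E A : Type*}

theorem ext' {ω ω' : JumpPath E A} (h1 : ω.init = ω'.init) (h2 : ω.point = ω'.point) : ω = ω' := by
  cases ω; cases ω'; simp_all

theorem T_mono (ω : JumpPath E A) : Monotone ω.T := by
  refine monotone_nat_of_le_succ fun n => ?_
  cases n with
  | zero => exact zero_le
  | succ n => exact ω.mono n

theorem T_lt_succ (ω : JumpPath E A) (n : ℕ) (h : ω.T n < ∞) : ω.T n < ω.T (n + 1) := by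
  cases n with
  | zero => exact ω.pos 0
  | succ n => exact ω.strict n h

theorem index_unique_left (ω : JumpPath E A) {m n : ℕ} {t : ℝ≥0∞} (hm : ω.T m < t)
    (hm' : t ≤ ω.T (m + 1)) (hn : ω.T n < t) (hn' : t ≤ ω.T (n + 1)) : m = n := by
  by_contra h
  rcases lt_or_gt_of_ne h with h | h
  · exact absurd (hm'.trans (ω.T_mono h)) (not_le.2 hn)
  · exact absurd (hn'.trans (ω.T_mono h)) (not_le.2 hm)

theorem index_unique (ω : JumpPath E A) {m n : ℕ} {t : ℝ≥0∞} (hm : ω.T m ≤ t)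
    (hm' : t < ω.T (m + 1)) (hn : ω.T n ≤ t) (hn' : t < ω.T (n + 1)) : m = n := by
  by_contra h
  rcases lt_or_gt_of_ne h with h | h
  · exact absurd (hm'.trans_le (ω.T_mono h)) (not_lt.2 hn)
  · exact absurd (hn'.trans_le (ω.T_mono h)) (not_lt.2 hm)

theorem stateLeft_eq (φ : ℝ → E → A → E) (ω : JumpPath E A) {n : ℕ} {t : ℝ≥0} (h1 : ω.T n < t)
    (h2 : (t : ℝ≥0∞) ≤ ω.T (n + 1)) :
    ω.stateLeft φ t = (ω.mark n).map fun z => (φ (t - (ω.T n).toReal) z.1 z.2, z.2) := by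
  have H : ∃ n, ω.T n < t ∧ (t : ℝ≥0∞) ≤ ω.T (n + 1) := ⟨n, h1, h2⟩
  have := ω.index_unique_left H.choose_spec.1 H.choose_spec.2 h1 h2
  rw [stateLeft, dif_pos H, this]

theorem state_eq (φ : ℝ → E → A → E) (ω : JumpPath E A) {n : ℕ} {t : ℝ≥0} (h1 : ω.T n ≤ t)
    (h2 : (t : ℝ≥0∞) < ω.T (n + 1)) :
    ω.state φ t = (ω.mark n).map fun z => (φ (t - (ω.T n).toReal) z.1 z.2, z.2) := by
  have H : ∃ n, ω.T n ≤ t ∧ (t : ℝ≥0∞) < ω.T (n + 1) := ⟨n, h1, h2⟩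
  have := ω.index_unique H.choose_spec.1 H.choose_spec.2 h1 h2
  rw [state, dif_pos H, this]

theorem mark_eq_none_iff (ω : JumpPath E A) (n : ℕ) : ω.mark n = none ↔ ω.T n = ∞ := by
  cases n with
  | zero => simp [mark, T]
  | succ n => simp [mark, T, pointTime_eq_top_iff]

theorem exists_mark (ω : JumpPath E A) {n : ℕ} (h : ω.T n < ∞) : ∃ z, ω.mark n = some z :=
  Option.ne_none_iff_exists'.1 fun h' => h.ne ((ω.mark_eq_none_iff n).1 h')

/-- The path that keeps the first `n` points. -/
def trunc (n : ℕ) (ω : JumpPath E A) : JumpPath E A where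
  init := ω.init
  point i := if i < n then ω.point i else none
  pos i := by
    split_ifs
    · exact ω.pos i
    · simp
  mono i := by
    by_cases h : i + 1 < n
    · simpa [h, Nat.lt_of_succ_lt h] using ω.mono i
    · simp [h]
  strict i := by
    by_cases h : i + 1 < n
    · simpa [h, Nat.lt_of_succ_lt h] using ω.strict i
    · simp [h]

open Classical in
/-- The path that keeps the points with time at most `q`. -/
noncomputable def stopAt (q : ℝ≥0) (ω : JumpPath E A) : JumpPath E A where
  init := ω.init
  point i := if pointTime (ω.point i) ≤ q then ω.point i else none
  pos i := by
    split_ifs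
    · exact ω.pos i
    · simp
  mono i := by
    by_cases h : pointTime (ω.point (i + 1)) ≤ q
    · simpa [h, (ω.mono i).trans h] using ω.mono i
    · simp [h]
  strict i := by
    by_cases h : pointTime (ω.point (i + 1)) ≤ q
    · simpa [h, (ω.mono i).trans h] using ω.strict i
    · simp [h]

@[simp] theorem trunc_init (n : ℕ) (ω : JumpPath E A) : (trunc n ω).init = ω.init := rfl

@[simp] theorem stopAt_init (q : ℝ≥0) (ω : JumpPath E A) : (stopAt q ω).init = ω.init := rfl

theorem trunc_point_of_lt {n i : ℕ} (h : i < n) (ω : JumpPath E A) :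
    (trunc n ω).point i = ω.point i := if_pos h

theorem trunc_point_of_le {n i : ℕ} (h : n ≤ i) (ω : JumpPath E A) :
    (trunc n ω).point i = none := if_neg (not_lt.2 h)

theorem trunc_T {n i : ℕ} (h : i ≤ n) (ω : JumpPath E A) : (trunc n ω).T i = ω.T i := by
  cases i with
  | zero => rfl
  | succ i => simp only [T, trunc_point_of_lt (Nat.lt_of_succ_le h)]

theorem trunc_mark {n i : ℕ} (h : i ≤ n) (ω : JumpPath E A) :
    (trunc n ω).mark i = ω.mark i := by
  cases i with
  | zero => rfl
  | succ i => simp only [mark, trunc_point_of_lt (Nat.lt_of_succ_le h)]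

theorem trunc_trunc {m n : ℕ} (h : m ≤ n) (ω : JumpPath E A) :
    trunc m (trunc n ω) = trunc m ω := by
  refine ext' rfl (funext fun i => ?_)
  by_cases hi : i < m
  · rw [trunc_point_of_lt hi, trunc_point_of_lt hi, trunc_point_of_lt (hi.trans_le h)]
  · rw [trunc_point_of_le (not_lt.1 hi), trunc_point_of_le (not_lt.1 hi)]

theorem trunc_stopAt {n : ℕ} {q : ℝ≥0} {ω : JumpPath E A} (h : ω.T n ≤ q) :
    trunc n (stopAt q ω) = trunc n ω := by
  refine ext' rfl (funext fun i => ?_)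
  by_cases hi : i < n
  · rw [trunc_point_of_lt hi, trunc_point_of_lt hi]
    exact if_pos ((ω.T_mono (Nat.succ_le_of_lt hi)).trans h)
  · rw [trunc_point_of_le (not_lt.1 hi), trunc_point_of_le (not_lt.1 hi)]

theorem stopAt_trunc {n : ℕ} {r : ℝ≥0} {ω : JumpPath E A} (h : (r : ℝ≥0∞) < ω.T (n + 1)) :
    stopAt r (trunc n ω) = stopAt r ω := by
  refine ext' rfl (funext fun i => ?_)
  by_cases hi : i < n
  · simp only [stopAt, trunc_point_of_lt hi]
  · have : ¬ pointTime (ω.point i) ≤ r := by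
      have := ω.T_mono (Nat.succ_le_succ (not_lt.1 hi))
      exact not_le.2 (h.trans_le this)
    simp [stopAt, trunc_point_of_le (not_lt.1 hi), this]

end Basic

/-! ### The σ-algebras -/

section Sigma

variable {E A : Type*} [MeasurableSpace E] [MeasurableSpace A]

open Classical in
theorem jumpMeasure_apply (ω : JumpPath E A) {C : Set (ℝ≥0 × E × A)} (hC : MeasurableSet C) :
    ω.jumpMeasure C = ∑' n, if ω.point n ∈ some '' C then 1 else 0 := by
  rw [jumpMeasure, Measure.sum_apply _ hC]
  refine tsum_congr fun n => ?_
  rcases h : ω.point n with _ | z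
  · simp
  · simp [hC, Set.indicator_apply]

theorem lintegral_jumpMeasure (ω : JumpPath E A) {f : ℝ≥0 × E × A → ℝ≥0∞} (hf : Measurable f) :
    ∫⁻ q, f q ∂ω.jumpMeasure = ∑' n, (ω.point n).elim 0 f := by
  rw [jumpMeasure, lintegral_sum_measure]
  refine tsum_congr fun n => ?_
  rcases h : ω.point n with _ | z
  · simp
  · simp [lintegral_dirac' _ hf]

open Classical in
theorem jumpMeasure_Ioc (ω : JumpPath E A) (s : ℝ≥0) {B : Set (E × A)} (hB : MeasurableSet B) :
    ω.jumpMeasure (Set.Ioc 0 s ×ˢ B) =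
      ∑' n, if ω.T (n + 1) ≤ s ∧ ω.mark (n + 1) ∈ some '' B then 1 else 0 := by
  rw [jumpMeasure_apply _ (measurableSet_Ioc.prod hB)]
  refine tsum_congr fun n => ?_
  have hpos := ω.pos n
  simp only [T, mark]
  refine if_congr ?_ rfl rfl
  generalize ω.point n = y at hpos ⊢
  rcases y with _ | z
  · simp
  · simp only [pointTime_some, ENNReal.coe_pos] at hpos
    simp [hpos]

open Classical in
theorem jumpMeasure_Ioc_eq_sum (ω : JumpPath E A) {n : ℕ} {s : ℝ≥0} (h1 : ω.T n ≤ s)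
    (h2 : (s : ℝ≥0∞) < ω.T (n + 1)) {B : Set (E × A)} (hB : MeasurableSet B) :
    ω.jumpMeasure (Set.Ioc 0 s ×ˢ B) =
      ∑ i ∈ Finset.range n, if ω.mark (i + 1) ∈ some '' B then 1 else 0 := by
  rw [jumpMeasure_Ioc _ _ hB, tsum_eq_sum (s := Finset.range n)]
  · refine Finset.sum_congr rfl fun i hi => ?_
    have : ω.T (i + 1) ≤ s := (ω.T_mono (Finset.mem_range.1 hi)).trans h1
    simp [this]
  · intro i hi
    have : ¬ ω.T (i + 1) ≤ s := not_le.2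
      (h2.trans_le (ω.T_mono (Nat.succ_le_succ (not_lt.1 (fun h => hi (Finset.mem_range.2 h))))))
    simp [this]

/-- The points are ordered in time, so `T n ≤ s` says that at least `n` points occur up to `s`. This
makes each `T n` a stopping time. -/
theorem T_le_iff (ω : JumpPath E A) (n : ℕ) (s : ℝ≥0) :
    ω.T n ≤ s ↔ (n : ℝ≥0∞) ≤ ω.jumpMeasure (Set.Ioc 0 s ×ˢ Set.univ) := by
  classical
  have hmark : ∀ i, (ω.T (i + 1) ≤ s ∧ ω.mark (i + 1) ∈ some '' (Set.univ : Set (E × A))) ↔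
      ω.T (i + 1) ≤ s := fun i => by
    refine ⟨fun h => h.1, fun h => ⟨h, ?_⟩⟩
    obtain ⟨z, hz⟩ := ω.exists_mark (h.trans_lt ENNReal.coe_lt_top)
    simp [hz]
  rw [jumpMeasure_Ioc _ _ .univ]
  simp_rw [hmark]
  constructor
  · intro h
    calc (n : ℝ≥0∞) = ∑ i ∈ Finset.range n, if ω.T (i + 1) ≤ s then 1 else 0 := by
          rw [Finset.sum_congr rfl (g := fun _ => 1)]
          · simp
          · intro i hi
            exact if_pos ((ω.T_mono (Finset.mem_range.1 hi)).trans h)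
      _ ≤ _ := ENNReal.sum_le_tsum _
  · intro h
    by_contra h'
    cases n with
    | zero => exact h' zero_le
    | succ n =>
      -- If `T (n + 1)` exceeds `s`, only the first `n` points can be counted.
      rw [tsum_eq_sum (s := Finset.range n)] at h
      · have h3 : (∑ i ∈ Finset.range n, if ω.T (i + 1) ≤ s then (1 : ℝ≥0∞) else 0) ≤ n := by
          calc _ ≤ ∑ i ∈ Finset.range n, (1 : ℝ≥0∞) :=
                Finset.sum_le_sum fun i _ => by split_ifs <;> simp
            _ = n := by simp
        have := h.trans h3
        norm_cast at this
        omega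
      · intro i hi
        refine if_neg fun h'' => h' ((ω.T_mono ?_).trans h'')
        simp only [Finset.mem_range] at hi
        omega

theorem measurable_init_sigmaAlg (t : ℝ≥0) :
    Measurable[sigmaAlg E A t] (fun ω : JumpPath E A => ω.init) :=
  (comap_measurable _).mono le_sup_left le_rfl

theorem measurable_count {s t : ℝ≥0} (hst : s ≤ t) {B : Set (E × A)} (hB : MeasurableSet B) :
    Measurable[sigmaAlg E A t] (fun ω : JumpPath E A => ω.jumpMeasure (Set.Ioc 0 s ×ˢ B)) := by
  refine (comap_measurable _).mono (le_trans ?_ le_sup_right) le_rfl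
  exact le_iSup_of_le s (le_iSup_of_le hst (le_iSup_of_le B (le_iSup_of_le hB le_rfl)))

theorem measurableSet_T_le {s t : ℝ≥0} (hst : s ≤ t) (n : ℕ) :
    MeasurableSet[sigmaAlg E A t] {ω : JumpPath E A | ω.T n ≤ s} := by
  simp_rw [T_le_iff]
  exact measurable_count hst .univ measurableSet_Ici

/-- The event that the point `n` occurs up to time `s` with mark in `B` depends on the counting
processes up to time `s` only. -/
theorem mark_mem_iff (ω : JumpPath E A) (n : ℕ) (s : ℝ≥0) {B : Set (E × A)}
    (hB : MeasurableSet B) :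
    (ω.T (n + 1) ≤ s ∧ ω.mark (n + 1) ∈ some '' B) ↔
      ∃ q ∈ ratTimes, ∃ r ∈ insert s ratTimes,
        q ≤ s ∧ r ≤ s ∧ ω.T n ≤ q ∧ ¬ ω.T (n + 1) ≤ q ∧ ω.T (n + 1) ≤ r ∧ ¬ ω.T (n + 2) ≤ r ∧
        ω.jumpMeasure (Set.Ioc 0 r ×ˢ B) = ω.jumpMeasure (Set.Ioc 0 q ×ˢ B) + 1 := by
  classical
  -- With exactly `n` points up to `q` and `n + 1` up to `r`, the count of marks in `B` grows by one
  -- exactly when the additional mark lies in `B`. The sum is finite, hence can be cancelled.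
  have key : ∀ {q r : ℝ≥0}, ω.T n ≤ q → ¬ ω.T (n + 1) ≤ q → ω.T (n + 1) ≤ r →
      ¬ ω.T (n + 2) ≤ r →
      (ω.jumpMeasure (Set.Ioc 0 r ×ˢ B) = ω.jumpMeasure (Set.Ioc 0 q ×ˢ B) + 1 ↔
        ω.mark (n + 1) ∈ some '' B) := by
    intro q r h1 h2 h3 h4
    rw [jumpMeasure_Ioc_eq_sum ω h1 (not_le.1 h2) hB, jumpMeasure_Ioc_eq_sum ω h3 (not_le.1 h4) hB,
      Finset.sum_range_succ]
    have hfin : (∑ i ∈ Finset.range n, if ω.mark (i + 1) ∈ some '' B then (1 : ℝ≥0∞) else 0) ≠ ∞ := by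
      refine (ENNReal.sum_lt_top.2 fun i _ => ?_).ne
      split_ifs <;> simp
    rw [ENNReal.add_right_inj hfin]
    split_ifs with h <;> simp [h]
  constructor
  · rintro ⟨h1, h2⟩
    have hT1 : ω.T (n + 1) < ∞ := h1.trans_lt ENNReal.coe_lt_top
    have hT0 : ω.T n < ω.T (n + 1) := ω.T_lt_succ n ((ω.T_mono n.le_succ).trans_lt hT1)
    obtain ⟨q, hq, hq1, hq2⟩ : ∃ q ∈ ratTimes,
        ω.T n ≤ q ∧ (q : ℝ≥0∞) < ω.T (n + 1) := by
      lift ω.T n to ℝ≥0 using (hT0.trans hT1).ne with t0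
      lift ω.T (n + 1) to ℝ≥0 using hT1.ne with t1
      obtain ⟨q, hq, h⟩ := dense_ratTimes.exists_between
        (ENNReal.coe_lt_coe.1 hT0)
      exact ⟨q, hq, by exact_mod_cast h.1.le, by exact_mod_cast h.2⟩
    -- The time `s` itself must be allowed for `r`: when `T (n + 1) = s` there is no dense time in
    -- `[T (n + 1), s]` to rely on.
    obtain ⟨r, hr, hrs, hr1, hr2⟩ : ∃ r ∈ insert s ratTimes, r ≤ s ∧
        ω.T (n + 1) ≤ r ∧ (r : ℝ≥0∞) < ω.T (n + 2) := by
      by_cases hs : ω.T (n + 2) ≤ s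
      · have hT2 : ω.T (n + 2) < ∞ := hs.trans_lt ENNReal.coe_lt_top
        have h12 := ω.T_lt_succ (n + 1) hT1
        change ω.T (n + 1) < ω.T (n + 2) at h12
        lift ω.T (n + 1) to ℝ≥0 using hT1.ne with t1
        lift ω.T (n + 2) to ℝ≥0 using hT2.ne with t2
        obtain ⟨r, hr, h⟩ := dense_ratTimes.exists_between
          (ENNReal.coe_lt_coe.1 h12)
        exact ⟨r, Set.mem_insert_of_mem _ hr, h.2.le.trans (by exact_mod_cast hs),
          by exact_mod_cast h.1.le, by exact_mod_cast h.2⟩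
      · exact ⟨s, Set.mem_insert _ _, le_rfl, h1, not_le.1 hs⟩
    refine ⟨q, hq, r, hr, ?_, hrs, hq1, not_le.2 hq2, hr1, not_le.2 hr2,
      (key hq1 (not_le.2 hq2) hr1 (not_le.2 hr2)).2 h2⟩
    exact_mod_cast hq2.le.trans h1
  · rintro ⟨q, -, r, -, -, hrs, h1, h2, h3, h4, h5⟩
    exact ⟨h3.trans (by exact_mod_cast hrs), (key h1 h2 h3 h4).1 h5⟩

theorem measurableSet_mark_mem (n : ℕ) (s : ℝ≥0) {B : Set (E × A)} (hB : MeasurableSet B) :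
    MeasurableSet[sigmaAlg E A s]
      {ω : JumpPath E A | ω.T (n + 1) ≤ s ∧ ω.mark (n + 1) ∈ some '' B} := by
  have hc := countable_ratTimes
  let _ := sigmaAlg E A s
  have : {ω : JumpPath E A | ω.T (n + 1) ≤ s ∧ ω.mark (n + 1) ∈ some '' B} =
      ⋃ q ∈ ratTimes,
        ⋃ r ∈ insert s ratTimes,
        {ω : JumpPath E A | q ≤ s ∧ r ≤ s ∧ ω.T n ≤ (q : ℝ≥0∞) ∧ ¬ ω.T (n + 1) ≤ (q : ℝ≥0∞) ∧
          ω.T (n + 1) ≤ (r : ℝ≥0∞) ∧ ¬ ω.T (n + 2) ≤ (r : ℝ≥0∞) ∧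
        ω.jumpMeasure (Set.Ioc 0 r ×ˢ B) = ω.jumpMeasure (Set.Ioc 0 q ×ˢ B) + 1} := by
    ext ω
    simp only [Set.mem_ofPred_eq, mark_mem_iff ω n s hB, Set.mem_iUnion, exists_prop]
  rw [this]
  refine MeasurableSet.biUnion hc fun q _ => MeasurableSet.biUnion (hc.insert s) fun r _ => ?_
  by_cases hq : q ≤ s
  · by_cases hr : r ≤ s
    · simp only [hq, hr, true_and]
      refine (measurableSet_T_le hq n).inter ((measurableSet_T_le hq (n + 1)).compl.inter
        ((measurableSet_T_le hr (n + 1)).inter ((measurableSet_T_le hr (n + 2)).compl.inter ?_)))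
      exact measurableSet_eq_fun (measurable_count hr hB)
        ((measurable_count hq hB).add measurable_const)
    · simp [hr]
  · simp [hq]

/-- The time and the mark are observed separately: the time through the events `T (n + 1) ≤ min c
q`, the mark through `measurableSet_mark_mem`. -/
theorem measurable_stopAt_point (q : ℝ≥0) (n : ℕ) :
    Measurable[sigmaAlg E A q] fun ω : JumpPath E A => (stopAt q ω).point n := by
  let _ := sigmaAlg E A q
  refine measurable_option_prod ?_ ?_
  · have hT : Measurable fun ω : JumpPath E A => pointTime ((stopAt q ω).point n) := by
      refine measurable_of_Iic fun c => ?_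
      by_cases hc : c = ∞
      · simp [hc]
      lift c to ℝ≥0 using hc
      have : (fun ω : JumpPath E A => pointTime ((stopAt q ω).point n)) ⁻¹' Set.Iic (c : ℝ≥0∞) =
          {ω | ω.T (n + 1) ≤ ((min c q : ℝ≥0) : ℝ≥0∞)} := by
        ext ω
        simp only [Set.mem_preimage, Set.mem_Iic, Set.mem_ofPred_eq, stopAt, T]
        by_cases h : pointTime (ω.point n) ≤ q <;> simp [h]
      rw [this]
      exact measurableSet_T_le (min_le_right _ _) _
    refine measurable_option_of_image fun s hs => ?_
    have : (fun ω : JumpPath E A => ((stopAt q ω).point n).map Prod.fst) ⁻¹' (some '' s) =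
        (fun ω : JumpPath E A => pointTime ((stopAt q ω).point n)) ⁻¹' (ENNReal.ofNNReal '' s) := by
      ext ω
      simp only [Set.mem_preimage]
      rcases (stopAt q ω).point n with _ | z
      · simp only [pointTime_none, Option.map_none]
        exact iff_of_false (by rintro ⟨c, -, hc⟩; exact Option.some_ne_none _ hc)
          (by rintro ⟨c, -, hc⟩; exact ENNReal.coe_ne_top hc)
      · simp only [pointTime_some, Option.map_some]
        rw [ENNReal.coe_injective.mem_set_image, (Option.some_injective _).mem_set_image]
    rw [this]
    exact hT (ENNReal.isOpenEmbedding_coe.measurableEmbedding.measurableSet_image.2 hs)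
  · refine measurable_option_of_image fun s hs => ?_
    convert measurableSet_mark_mem n q hs using 1
    ext ω
    simp only [Set.mem_preimage, stopAt, Set.mem_ofPred_eq, T, mark]
    by_cases h : pointTime (ω.point n) ≤ q <;> simp [h]

theorem sigmaAlg_le (t : ℝ≥0) : sigmaAlg E A t ≤ instMeasurableSpace := le_iSup (sigmaAlg E A) t

theorem measurable_init : Measurable (fun ω : JumpPath E A => ω.init) :=
  (measurable_init_sigmaAlg 0).mono (sigmaAlg_le 0) le_rfl

/-- Every finite point is already visible in the path stopped at a large enough integer time. -/
theorem measurable_point (n : ℕ) : Measurable (fun ω : JumpPath E A => ω.point n) := by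
  refine measurable_option_of_image fun s hs => ?_
  have : (fun ω : JumpPath E A => ω.point n) ⁻¹' (some '' s) =
      ⋃ k : ℕ, (fun ω : JumpPath E A => (stopAt k ω).point n) ⁻¹' (some '' s) := by
    ext ω
    simp only [Set.mem_preimage, Set.mem_iUnion, stopAt]
    constructor
    · rintro ⟨z, hz, h⟩
      obtain ⟨k, hk⟩ := exists_nat_ge z.1
      refine ⟨k, z, hz, ?_⟩
      rw [← h, if_pos]
      simpa [] using (by exact_mod_cast hk : (z.1 : ℝ≥0∞) ≤ ((k : ℝ≥0) : ℝ≥0∞))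
    · rintro ⟨k, h⟩
      split_ifs at h with h'
      · exact h
      · simp at h
  rw [this]
  exact MeasurableSet.iUnion fun k =>
    sigmaAlg_le (k : ℝ≥0) _ (measurable_stopAt_point (k : ℝ≥0) n (measurableSet_image_some hs))

/-- A path as an initial condition and a sequence of points. -/
def toSeq (ω : JumpPath E A) : (E × A) × (ℕ → Option (ℝ≥0 × E × A)) := (ω.init, ω.point)

theorem measurable_toSeq : Measurable (toSeq : JumpPath E A → _) :=
  measurable_init.prodMk (measurable_pi_iff.2 measurable_point)

/-- The counts and the sequence of points determine each other measurably. Measurability of a map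
into the path space can therefore be checked on the coordinates. -/
theorem instMeasurableSpace_eq_comap :
    (instMeasurableSpace : MeasurableSpace (JumpPath E A)) =
      MeasurableSpace.comap toSeq inferInstance := by
  classical
  refine le_antisymm (iSup_le fun t => sup_le ?_ ?_) measurable_toSeq.comap_le
  · rw [← measurable_iff_comap_le]
    exact measurable_fst.comp (comap_measurable _)
  · refine iSup_le fun s => iSup_le fun _ => iSup_le fun B => iSup_le fun hB => ?_
    rw [← measurable_iff_comap_le]
    let _ := MeasurableSpace.comap (toSeq (E := E) (A := A)) inferInstance
    simp_rw [jumpMeasure_apply _ (measurableSet_Ioc.prod hB)]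
    refine Measurable.tsum fun n => Measurable.ite ?_ measurable_const measurable_const
    have h1 : Measurable fun ω : JumpPath E A => ω.point n :=
      (measurable_pi_apply n).comp (measurable_snd.comp (comap_measurable _))
    exact h1 (measurableSet_image_some (measurableSet_Ioc.prod hB))

theorem measurable_of_toSeq {β : Type*} [MeasurableSpace β] {f : β → JumpPath E A}
    (h1 : Measurable fun b => (f b).init) (h2 : ∀ n, Measurable fun b => (f b).point n) :
    Measurable f := by
  rw [instMeasurableSpace_eq_comap, measurable_comap_iff]
  exact h1.prodMk (measurable_pi_iff.2 h2)

theorem measurable_T (n : ℕ) : Measurable (fun ω : JumpPath E A => ω.T n) := by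
  cases n with
  | zero => exact measurable_const
  | succ n => exact measurable_pointTime.comp (measurable_point n)

theorem measurable_mark (n : ℕ) : Measurable (fun ω : JumpPath E A => ω.mark n) := by
  cases n with
  | zero => exact measurable_some.comp measurable_init
  | succ n => exact measurable_snd.option_map.comp (measurable_point n)

theorem measurable_trunc (n : ℕ) : Measurable (trunc n : JumpPath E A → JumpPath E A) := by
  refine measurable_of_toSeq measurable_init fun i => ?_
  by_cases h : i < n
  · simpa [trunc, h] using measurable_point i
  · simp [trunc, h]

theorem measurable_stopAt (q : ℝ≥0) :
    Measurable[sigmaAlg E A q] (stopAt q : JumpPath E A → JumpPath E A) := by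
  let _ := sigmaAlg E A q
  exact measurable_of_toSeq (measurable_init_sigmaAlg q) (measurable_stopAt_point q)

/-- A count up to a time `s ≤ q` ignores the points after `q`. Together with `measurable_stopAt`
this shows that `stopAt q` generates the σ-algebra at time `q`. -/
theorem sigmaAlg_le_comap_stopAt (q : ℝ≥0) :
    sigmaAlg E A q ≤ MeasurableSpace.comap (stopAt q) instMeasurableSpace := by
  classical
  refine sup_le ?_ (iSup_le fun s => iSup_le fun hs => iSup_le fun B => iSup_le fun hB => ?_)
  · rw [← measurable_iff_comap_le]
    exact Measurable.comp (f := stopAt q) measurable_init (comap_measurable (stopAt q))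
  · rw [← measurable_iff_comap_le]
    have : (fun ω : JumpPath E A => ω.jumpMeasure (Set.Ioc 0 s ×ˢ B)) =
        (fun ω => ω.jumpMeasure (Set.Ioc 0 s ×ˢ B)) ∘ stopAt q := by
      ext ω
      simp only [Function.comp]
      rw [jumpMeasure_apply _ (measurableSet_Ioc.prod hB),
        jumpMeasure_apply _ (measurableSet_Ioc.prod hB)]
      refine tsum_congr fun n => ?_
      refine if_congr ?_ rfl rfl
      simp only [stopAt]
      by_cases h2 : pointTime (ω.point n) ≤ q
      · rw [if_pos h2]
      · rw [if_neg h2]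
        refine ⟨?_, by simp⟩
        rintro ⟨z, hz, h⟩
        refine absurd ?_ h2
        rw [← h, pointTime_some]
        exact_mod_cast hz.1.2.trans hs
    rw [this]
    exact ((measurable_count le_rfl hB).mono (sigmaAlg_le s) le_rfl).comp (comap_measurable (stopAt q))

/-! ### Predictability -/

theorem predictable_le : predictableSigma E A ≤ Prod.instMeasurableSpace := by
  refine measurableSpace_le_predictable_of_measurableSet ?_ ?_
  · exact fun B hB => (measurableSet_singleton _).prod ((natFiltration E A).le ⊥ _ hB)
  · exact fun i B hB => measurableSet_Ioi.prod ((natFiltration E A).le i _ hB)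

/-- It suffices to look at generators. Those at time zero are excluded by `0 < s`, and membership in
`(i, ∞) × B` with `i < s` is decided by the path stopped at `i`. -/
theorem predictable_mem_iff {S : Set (ℝ≥0 × JumpPath E A)}
    (hS : MeasurableSet[predictableSigma E A] S) {s : ℝ≥0} (hs : 0 < s) {ω ω' : JumpPath E A}
    (h : ∀ r < s, stopAt r ω = stopAt r ω') : (s, ω) ∈ S ↔ (s, ω') ∈ S := by
  induction S, hS using MeasurableSpace.generateFrom_induction with
  | hC S hS _ =>
    rcases hS with ⟨B, -, rfl⟩ | ⟨i, B, hB, rfl⟩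
    · simp [hs.ne']
    · obtain ⟨G, -, rfl⟩ := sigmaAlg_le_comap_stopAt i B hB
      simp only [Set.mem_prod, Set.mem_Ioi, Set.mem_preimage]
      exact and_congr_right fun hi => by rw [h i hi]
  | empty => simp
  | compl S _ ih => simpa using not_congr ih
  | iUnion S _ ih => simpa using exists_congr ih

/-- A predictable process is, between two consecutive jump times, a function of the past up to
the first of them. -/
theorem predictable_trunc {β : Type*} [MeasurableSpace β] [MeasurableSingletonClass β]
    {f : ℝ≥0 × JumpPath E A → β} (hf : Measurable[predictableSigma E A] f) {ω : JumpPath E A}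
    {n : ℕ} {s : ℝ≥0} (h1 : ω.T n < s) (h2 : (s : ℝ≥0∞) ≤ ω.T (n + 1)) :
    f (s, trunc n ω) = f (s, ω) := by
  have hs : 0 < s := by
    rcases eq_or_ne s 0 with rfl | h
    · simp at h1
    · exact pos_iff_ne_zero.2 h
  -- The level set of `f` through `(s, ω)` is predictable, and the two paths agree when stopped at
  -- any `r < s ≤ T (n + 1)`.
  refine (predictable_mem_iff (hf (measurableSet_singleton (f (s, ω)))) hs fun r hr => ?_).2 rfl
  exact stopAt_trunc (lt_of_lt_of_le (by exact_mod_cast hr) h2)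

theorem measurableSet_predictable_univ_prod {G : Set (JumpPath E A)}
    (hG : MeasurableSet[sigmaAlg E A 0] G) :
    MeasurableSet[predictableSigma E A] (Set.univ ×ˢ G) := by
  have : (Set.univ : Set ℝ≥0) ×ˢ G = {⊥} ×ˢ G ∪ Set.Ioi 0 ×ˢ G := by
    rw [← Set.union_prod]
    congr
    ext s
    rcases eq_or_ne s 0 with rfl | h <;> simp [*]
  rw [this]
  let _ := predictableSigma E A
  exact (measurableSet_predictable_singleton_bot_prod (𝓕 := natFiltration E A) hG).union
    (measurableSet_predictable_Ioi_prod (𝓕 := natFiltration E A) hG)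

theorem measurable_fst_predictable :
    Measurable[predictableSigma E A] (Prod.fst : ℝ≥0 × JumpPath E A → ℝ≥0) := by
  let _ := predictableSigma E A
  refine measurable_of_Ioi fun c => ?_
  have : (Prod.fst : ℝ≥0 × JumpPath E A → ℝ≥0) ⁻¹' Set.Ioi c = Set.Ioi c ×ˢ Set.univ := by
    ext; simp
  rw [this]
  exact measurableSet_predictable_Ioi_prod (𝓕 := natFiltration E A) .univ

/-- The path stopped at `q` is known after `q`. Up to `q` the value is a default that is known at
time zero. -/
theorem measurable_stopAt_predictable (q : ℝ≥0) : Measurable[predictableSigma E A]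
    fun p : ℝ≥0 × JumpPath E A => if q < p.1 then stopAt q p.2 else stopAt 0 p.2 := by
  let _ := predictableSigma E A
  intro G hG
  have : (fun p : ℝ≥0 × JumpPath E A => if q < p.1 then stopAt q p.2 else stopAt 0 p.2) ⁻¹' G =
      Set.Ioi q ×ˢ (stopAt q ⁻¹' G) ∪ (Prod.fst ⁻¹' Set.Iic q ∩ Set.univ ×ˢ (stopAt 0 ⁻¹' G)) := by
    ext p
    by_cases h : q < p.1
    · simp [h]
    · simp [h, not_lt.1 h]
  rw [this]
  exact (measurableSet_predictable_Ioi_prod (𝓕 := natFiltration E A) (measurable_stopAt q hG)).union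
    ((measurable_fst_predictable measurableSet_Iic).inter
      (measurableSet_predictable_univ_prod (measurable_stopAt 0 hG)))

/-- On `{T_n < s}`, the time `s` and the path up to `T_n` are predictable. -/
theorem measurableSet_predictable_trunc (n : ℕ) {G : Set (ℝ≥0 × JumpPath E A)}
    (hG : MeasurableSet G) :
    MeasurableSet[predictableSigma E A] {p | p.2.T n < p.1 ∧ (p.1, trunc n p.2) ∈ G} := by
  let _ := predictableSigma E A
  have hc := countable_ratTimes
  let ψ (q : ℝ≥0) (p : ℝ≥0 × JumpPath E A) : ℝ≥0 × JumpPath E A :=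
    (p.1, trunc n (if q < p.1 then stopAt q p.2 else stopAt 0 p.2))
  have hψ (q : ℝ≥0) : @Measurable _ _ (predictableSigma E A) Prod.instMeasurableSpace (ψ q) := by
    refine Measurable.prodMk measurable_fst_predictable ?_
    exact (measurable_trunc n).comp (measurable_stopAt_predictable q)
  -- If `T n ≤ q < s`, the path up to `T n` can be read off from the path stopped at `q`, and
  -- countably many `q` suffice.
  have : {p : ℝ≥0 × JumpPath E A | p.2.T n < p.1 ∧ (p.1, trunc n p.2) ∈ G} =
      ⋃ q ∈ ratTimes ∪ {0},
        (Set.Ioi q ×ˢ {ω : JumpPath E A | ω.T n ≤ (q : ℝ≥0∞)}) ∩ ψ q ⁻¹' G := by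
    ext ⟨s, ω⟩
    simp only [Set.mem_ofPred_eq, Set.mem_iUnion, exists_prop, Set.mem_inter_iff, Set.mem_prod,
      Set.mem_Ioi, Set.mem_preimage, ψ]
    constructor
    · rintro ⟨h1, h2⟩
      have hfin : ω.T n ≠ ∞ := (h1.trans ENNReal.coe_lt_top).ne
      obtain ⟨q, hq, hq1, hq2⟩ : ∃ q ∈ ratTimes ∪ {0},
          q < s ∧ ω.T n ≤ q := by
        lift ω.T n to ℝ≥0 using hfin with t0
        obtain ⟨q, hq, h⟩ := dense_ratTimes.exists_between
          (ENNReal.coe_lt_coe.1 h1)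
        exact ⟨q, Or.inl hq, h.2, by exact_mod_cast h.1.le⟩
      exact ⟨q, hq, ⟨hq1, hq2⟩, by simpa [hq1, trunc_stopAt hq2] using h2⟩
    · rintro ⟨q, -, ⟨h1, h2⟩, h3⟩
      rw [if_pos h1, trunc_stopAt h2] at h3
      exact ⟨lt_of_le_of_lt h2 (by exact_mod_cast h1), h3⟩
  rw [this]
  refine MeasurableSet.biUnion (hc.union (Set.countable_singleton 0)) fun q _ => ?_
  exact (measurableSet_predictable_Ioi_prod (𝓕 := natFiltration E A)
    (measurableSet_T_le le_rfl n)).inter (hψ q hG)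

theorem measurableSet_predictable_T_lt (n : ℕ) :
    MeasurableSet[predictableSigma E A] {p : ℝ≥0 × JumpPath E A | p.2.T n < p.1} := by
  simpa using measurableSet_predictable_trunc (E := E) (A := A) n .univ

/-- The stochastic interval `(T_n, T_{n+1}]`. -/
def stochInterval (E A : Type*) (n : ℕ) : Set (ℝ≥0 × JumpPath E A) :=
  {p | p.2.T n < p.1 ∧ (p.1 : ℝ≥0∞) ≤ p.2.T (n + 1)}

theorem measurableSet_stochInterval (n : ℕ) :
    MeasurableSet[predictableSigma E A] (stochInterval E A n) := by
  let _ := predictableSigma E A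
  convert (measurableSet_predictable_T_lt n).inter (measurableSet_predictable_T_lt (n + 1)).compl
  ext p
  simp [stochInterval]

theorem measurableSet_predictable_trunc_stochInterval (n : ℕ) {G : Set (ℝ≥0 × JumpPath E A)}
    (hG : MeasurableSet G) :
    MeasurableSet[predictableSigma E A]
      (stochInterval E A n ∩ {p | (p.1, trunc n p.2) ∈ G}) := by
  let _ := predictableSigma E A
  convert (measurableSet_stochInterval n).inter (measurableSet_predictable_trunc n hG) using 1
  ext p
  simp only [stochInterval, Set.mem_inter_iff, Set.mem_ofPred_eq]
  tauto

end Sigma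

end JumpPath

/-! ### The time axis -/

/-- Lebesgue measure on the time axis `ℝ≥0`. -/
noncomputable def timeMeasure : Measure ℝ≥0 :=
  (volume.restrict (Set.Ioi (0 : ℝ))).map Real.toNNReal

instance : SFinite timeMeasure := by unfold timeMeasure; infer_instance

theorem lintegral_timeMeasure {f : ℝ≥0 → ℝ≥0∞} (hf : Measurable f) :
    ∫⁻ s, f s ∂timeMeasure = ∫⁻ s in Set.Ioi (0 : ℝ), f s.toNNReal :=
  lintegral_map hf measurable_real_toNNReal

namespace JumpPath

variable {E A : Type*} [MeasurableSpace E] [MeasurableSpace A]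

/-! ### Compensators with bounded intensity -/

/-- A predictable random measure `Γ(ω, s, dz)` on the space of marks, with mass at most `K` and
vanishing after the explosion time. -/
structure IsBoundedIntensity (Γ : JumpPath E A → ℝ≥0 → Measure (E × A)) (K : ℝ≥0) : Prop where
  measurable : Measurable[predictableSigma E A] fun p : ℝ≥0 × JumpPath E A => Γ p.2 p.1
  le : ∀ ω s, Γ ω s Set.univ ≤ K
  eq_zero : ∀ ω s, (∀ n, (s, ω) ∉ stochInterval E A n) → Γ ω s = 0

/-- `Γ(ω, s, dz) ds` is the compensator of the jump measure under `P`. -/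
def Compensates (Γ : JumpPath E A → ℝ≥0 → Measure (E × A)) (P : Measure (JumpPath E A)) : Prop :=
  ∀ H : (ℝ≥0 × JumpPath E A) × (E × A) → ℝ≥0∞,
    Measurable[(predictableSigma E A).prod inferInstance] H →
    ∫⁻ ω, (∫⁻ q, H ((q.1, ω), q.2) ∂ω.jumpMeasure) ∂P =
      ∫⁻ ω, (∫⁻ s in Set.Ioi (0 : ℝ), (∫⁻ z, H ((s.toNNReal, ω), z) ∂(Γ ω s.toNNReal))) ∂P

/-- The compensation identity for the point with index `n`, in terms of the past up to `T_n`. -/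
def StepCompensates (Γ : JumpPath E A → ℝ≥0 → Measure (E × A)) (n : ℕ)
    (P : Measure (JumpPath E A)) : Prop :=
  ∀ G : (ℝ≥0 × JumpPath E A) × (E × A) → ℝ≥0∞, Measurable G →
    ∫⁻ ω, (ω.point n).elim 0 (fun q => G ((q.1, trunc n ω), q.2)) ∂P =
      ∫⁻ ω, ∫⁻ s, (stochInterval E A n).indicator
        (fun p => ∫⁻ z, G ((p.1, trunc n p.2), z) ∂Γ (trunc n p.2) p.1) (s, ω) ∂timeMeasure ∂P

theorem mem_stochInterval_of_point {E A : Type*} {ω : JumpPath E A} {n : ℕ} {q : ℝ≥0 × E × A}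
    (h : ω.point n = some q) : (q.1, ω) ∈ stochInterval E A n := by
  have hT : ω.T (n + 1) = q.1 := by simp [T, h]
  refine ⟨?_, hT.ge⟩
  rw [← hT]
  refine ω.T_lt_succ n ((ω.T_mono n.le_succ).trans_lt ?_)
  rw [hT]
  exact ENNReal.coe_lt_top

theorem stochInterval_index_unique {E A : Type*} {p : ℝ≥0 × JumpPath E A} {m n : ℕ}
    (hm : p ∈ stochInterval E A m) (hn : p ∈ stochInterval E A n) : m = n :=
  p.2.index_unique_left hm.1 hm.2 hn.1 hn.2

open Classical in
/-- On `(T_n, T_{n+1}]`, the current time and the path up to `T_n`. -/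
noncomputable def pastAt (n : ℕ) (p : ℝ≥0 × JumpPath E A) : ℝ≥0 × JumpPath E A :=
  if p ∈ stochInterval E A n then (p.1, trunc n p.2) else (p.1, stopAt 0 p.2)

theorem measurable_pastAt (n : ℕ) :
    @Measurable _ _ (predictableSigma E A) Prod.instMeasurableSpace
      (pastAt n : ℝ≥0 × JumpPath E A → _) := by
  intro G hG
  let _ := predictableSigma E A
  have h0 : @Measurable _ _ (predictableSigma E A) Prod.instMeasurableSpace
      (fun p : ℝ≥0 × JumpPath E A => (p.1, stopAt 0 p.2)) := by
    refine Measurable.prodMk measurable_fst_predictable ?_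
    have := measurable_stopAt_predictable (E := E) (A := A) 0
    simpa using this
  have : pastAt n ⁻¹' G = (stochInterval E A n ∩ {p | (p.1, trunc n p.2) ∈ G}) ∪
      ((stochInterval E A n)ᶜ ∩ (fun p : ℝ≥0 × JumpPath E A => (p.1, stopAt 0 p.2)) ⁻¹' G) := by
    ext p
    by_cases h : p ∈ stochInterval E A n <;> simp [pastAt, h]
  rw [this]
  exact (measurableSet_predictable_trunc_stochInterval n hG).union
    ((measurableSet_stochInterval n).compl.inter (h0 hG))

/-- This makes the integrands of `StepCompensates` admissible test functions in `Compensates`. -/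
theorem measurable_indicator_trunc {β : Type*} [MeasurableSpace β] (n : ℕ)
    {g : (ℝ≥0 × JumpPath E A) × β → ℝ≥0∞} (hg : Measurable g) :
    Measurable[(predictableSigma E A).prod inferInstance] fun q : (ℝ≥0 × JumpPath E A) × β =>
      (stochInterval E A n).indicator (fun p => g ((p.1, trunc n p.2), q.2)) q.1 := by
  have h1 : @Measurable _ _ ((predictableSigma E A).prod inferInstance) Prod.instMeasurableSpace
      (fun q : (ℝ≥0 × JumpPath E A) × β => (pastAt n q.1, q.2)) := by
    let _ := predictableSigma E A
    exact Measurable.prodMk ((measurable_pastAt n).comp measurable_fst) measurable_snd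
  have h2 := hg.comp h1
  have h3 : MeasurableSet[(predictableSigma E A).prod inferInstance]
      (Prod.fst ⁻¹' stochInterval E A n : Set ((ℝ≥0 × JumpPath E A) × β)) := by
    let _ := predictableSigma E A
    exact measurable_fst (measurableSet_stochInterval n)
  convert h2.indicator h3 using 1
  ext q
  by_cases h : q.1 ∈ stochInterval E A n <;> simp [h, pastAt]

theorem measurable_elim_point {n : ℕ} {f : JumpPath E A × (ℝ≥0 × E × A) → ℝ≥0∞}
    (hf : Measurable f) :
    Measurable fun ω : JumpPath E A => (ω.point n).elim 0 fun q => f (ω, q) := by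
  have : Measurable fun p : JumpPath E A × Option (ℝ≥0 × E × A) =>
      p.2.elim 0 fun q => f (p.1, q) :=
    measurable_prod_option (by simp) (by simpa using hf)
  exact this.comp (measurable_id.prodMk (measurable_point n))

theorem measurableSet_stochInterval' (n : ℕ) : MeasurableSet (stochInterval E A n) :=
  predictable_le _ (measurableSet_stochInterval n)

theorem measurable_prod_of_predictable {β γ : Type*} [MeasurableSpace β] [MeasurableSpace γ]
    {H : (ℝ≥0 × JumpPath E A) × β → γ}
    (hH : Measurable[(predictableSigma E A).prod inferInstance] H) : Measurable H :=
  hH.mono (sup_le_sup (MeasurableSpace.comap_mono predictable_le) le_rfl) le_rfl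

section Intensity

variable {Γ : JumpPath E A → ℝ≥0 → Measure (E × A)} {K : ℝ≥0}

/-- The intensity as a kernel. -/
noncomputable def IsBoundedIntensity.kernel (hΓ : IsBoundedIntensity Γ K) :
    Kernel (ℝ≥0 × JumpPath E A) (E × A) where
  toFun p := Γ p.2 p.1
  measurable' := hΓ.measurable.mono predictable_le le_rfl

instance IsBoundedIntensity.isFiniteKernel (hΓ : IsBoundedIntensity Γ K) :
    IsFiniteKernel hΓ.kernel :=
  ⟨⟨K, ENNReal.coe_lt_top, fun p => hΓ.le p.2 p.1⟩⟩

theorem IsBoundedIntensity.measurable_lintegral (hΓ : IsBoundedIntensity Γ K)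
    {G : (ℝ≥0 × JumpPath E A) × (E × A) → ℝ≥0∞} (hG : Measurable G) :
    Measurable fun p : ℝ≥0 × JumpPath E A => ∫⁻ z, G (p, z) ∂Γ p.2 p.1 :=
  hG.lintegral_kernel_prod_right' (κ := hΓ.kernel)

theorem IsBoundedIntensity.measurable_trunc_lintegral (hΓ : IsBoundedIntensity Γ K) (n : ℕ)
    {G : (ℝ≥0 × JumpPath E A) × (E × A) → ℝ≥0∞} (hG : Measurable G) :
    Measurable fun p : ℝ≥0 × JumpPath E A =>
      ∫⁻ z, G ((p.1, trunc n p.2), z) ∂Γ (trunc n p.2) p.1 :=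
  (hΓ.measurable_lintegral hG).comp
    (measurable_fst.prodMk ((measurable_trunc n).comp measurable_snd))

theorem IsBoundedIntensity.trunc_eq (hΓ : IsBoundedIntensity Γ K) {n : ℕ}
    {p : ℝ≥0 × JumpPath E A} (hp : p ∈ stochInterval E A n) : Γ (trunc n p.2) p.1 = Γ p.2 p.1 := by
  ext B hB
  have hm : Measurable[predictableSigma E A] fun p : ℝ≥0 × JumpPath E A => Γ p.2 p.1 B :=
    (Measure.measurable_coe hB).comp hΓ.measurable
  exact predictable_trunc hm hp.1 hp.2

theorem predictable_trunc_section {H : (ℝ≥0 × JumpPath E A) × (E × A) → ℝ≥0∞}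
    (hH : Measurable[(predictableSigma E A).prod inferInstance] H) {n : ℕ}
    {p : ℝ≥0 × JumpPath E A} (hp : p ∈ stochInterval E A n) (z : E × A) :
    H ((p.1, trunc n p.2), z) = H (p, z) := by
  have hm : Measurable[predictableSigma E A] fun p : ℝ≥0 × JumpPath E A => H (p, z) := by
    let _ := predictableSigma E A
    exact hH.comp measurable_prodMk_right
  exact predictable_trunc hm hp.1 hp.2

/-- Restricted to `(T n, T (n + 1)]`, a function of the time and of the path up to `T n` is
predictable, and of all points only the one with index `n` falls into this interval. -/
theorem Compensates.step (hΓ : IsBoundedIntensity Γ K) {P : Measure (JumpPath E A)}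
    (h : Compensates Γ P) (n : ℕ) : StepCompensates Γ n P := by
  intro G hG
  have := h _ (measurable_indicator_trunc n hG)
  have hHm := measurable_prod_of_predictable (measurable_indicator_trunc (E := E) (A := A) n hG)
  convert this using 1
  · refine lintegral_congr fun ω => ?_
    rw [lintegral_jumpMeasure, tsum_eq_single n]
    · rcases hpt : ω.point n with _ | q
      · rfl
      · simp [Set.indicator_of_mem (mem_stochInterval_of_point hpt)]
    · intro m hm
      rcases hpt : ω.point m with _ | q
      · rfl
      · have hq : (q.1, ω) ∉ stochInterval E A n := fun hq =>
          hm (stochInterval_index_unique (mem_stochInterval_of_point hpt) hq)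
        simp [Set.indicator_of_notMem hq]
    · exact hHm.comp (by fun_prop : Measurable fun q : ℝ≥0 × E × A => ((q.1, ω), q.2))
  · refine lintegral_congr fun ω => ?_
    rw [lintegral_timeMeasure]
    · refine lintegral_congr fun s => ?_
      by_cases hs : (s.toNNReal, ω) ∈ stochInterval E A n
      · simp only [Set.indicator_of_mem hs]
        rw [hΓ.trunc_eq hs]
      · simp [Set.indicator_of_notMem hs]
    · exact ((hΓ.measurable_trunc_lintegral n hG).indicator
        (measurableSet_stochInterval' n)).comp (by fun_prop)

/-- The stochastic intervals are disjoint, contain all points, and carry the whole intensity by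
`eq_zero`. On each of them a predictable integrand only sees the path up to the left endpoint, so
the identities for single points add up. -/
theorem compensates_of_step (hΓ : IsBoundedIntensity Γ K) {P : Measure (JumpPath E A)}
    (h : ∀ n, StepCompensates Γ n P) : Compensates Γ P := by
  intro H hH
  have hHm := measurable_prod_of_predictable hH
  have hsec : ∀ ω : JumpPath E A, Measurable fun q : ℝ≥0 × E × A => H ((q.1, ω), q.2) :=
    fun ω => hHm.comp (by fun_prop : Measurable fun q : ℝ≥0 × E × A => ((q.1, ω), q.2))
  have hl : ∫⁻ ω, (∫⁻ q, H ((q.1, ω), q.2) ∂ω.jumpMeasure) ∂P =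
      ∑' n, ∫⁻ ω, (ω.point n).elim 0 (fun q => H ((q.1, trunc n ω), q.2)) ∂P := by
    rw [← lintegral_tsum]
    · refine lintegral_congr fun ω => ?_
      rw [lintegral_jumpMeasure _ (hsec ω)]
      refine tsum_congr fun n => ?_
      rcases hpt : ω.point n with _ | q
      · rfl
      · exact (predictable_trunc_section hH (mem_stochInterval_of_point hpt) q.2).symm
    · intro n
      refine (measurable_elim_point (f := fun r => H ((r.2.1, trunc n r.1), r.2.2))
        (hHm.comp ?_)).aemeasurable
      exact (measurable_snd.fst.prodMk ((measurable_trunc n).comp measurable_fst)).prodMk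
        measurable_snd.snd
  have hm := fun n => ((hΓ.measurable_trunc_lintegral n hHm).indicator
    (measurableSet_stochInterval' (E := E) (A := A) n))
  rw [hl, tsum_congr fun n => h n H hHm, ← lintegral_tsum fun n => ?_]
  · refine lintegral_congr fun ω => ?_
    have hmω := fun n => (hm n).comp (measurable_prodMk_right (y := ω))
    simp only [Function.comp_def] at hmω
    rw [← lintegral_tsum fun n => (hmω n).aemeasurable, lintegral_timeMeasure]
    · refine lintegral_congr fun s => ?_
      by_cases hs : ∃ n, (s.toNNReal, ω) ∈ stochInterval E A n
      · obtain ⟨n, hn⟩ := hs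
        rw [tsum_eq_single n]
        · rw [Set.indicator_of_mem hn, hΓ.trunc_eq hn]
          exact lintegral_congr fun z => predictable_trunc_section hH hn z
        · exact fun m hm => Set.indicator_of_notMem
            (fun h => hm (stochInterval_index_unique h hn)) _
      · push Not at hs
        rw [hΓ.eq_zero ω _ hs]
        simp [Set.indicator_of_notMem (hs _)]
    · exact Measurable.tsum hmω
  · refine Measurable.aemeasurable ?_
    have : Measurable fun q : JumpPath E A × ℝ≥0 => (stochInterval E A n).indicator
        (fun p => ∫⁻ z, H ((p.1, trunc n p.2), z) ∂Γ (trunc n p.2) p.1) (q.2, q.1) :=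
      (hm n).comp measurable_swap
    exact this.lintegral_prod_right'

end Intensity

/-! ### Paths from sequences -/

section OfSeq

variable {E A : Type*}

open Classical in
/-- The points of a sequence, replaced by the cemetery where the times fail to increase. -/
noncomputable def increasing (y : ℕ → Option (ℝ≥0 × E × A)) : ℕ → Option (ℝ≥0 × E × A)
  | 0 => if 0 < pointTime (y 0) then y 0 else none
  | n + 1 => if pointTime (increasing y n) < pointTime (y (n + 1)) then y (n + 1) else none

/-- The path with initial condition `z` and with the points of the sequence `y`. -/
noncomputable def ofSeq (z : E × A) (y : ℕ → Option (ℝ≥0 × E × A)) : JumpPath E A where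
  init := z
  point := increasing y
  pos n := by
    induction n with
    | zero => rw [increasing]; split_ifs with h <;> simp [h]
    | succ n ih =>
      rw [increasing]
      split_ifs with h
      · exact ih.trans h
      · simp
  mono n := by
    rw [increasing]
    split_ifs with h
    · exact h.le
    · simp
  strict n hn := by
    rw [increasing]
    split_ifs with h
    · exact h
    · simpa using hn

theorem ofSeq_point_of_lt {z : E × A} {y : ℕ → Option (ℝ≥0 × E × A)} {n : ℕ}
    (h : (ofSeq z y).T n < pointTime (y n)) : (ofSeq z y).point n = y n := by
  cases n with
  | zero => exact if_pos h
  | succ n => exact if_pos h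

theorem ofSeq_point_of_not_lt {z : E × A} {y : ℕ → Option (ℝ≥0 × E × A)} {n : ℕ}
    (h : ¬ (ofSeq z y).T n < pointTime (y n)) : (ofSeq z y).point n = none := by
  cases n with
  | zero => exact if_neg h
  | succ n => exact if_neg h

theorem ofSeq_point_congr {z : E × A} {y y' : ℕ → Option (ℝ≥0 × E × A)} {n : ℕ}
    (h : ∀ i ≤ n, y i = y' i) : (ofSeq z y).point n = (ofSeq z y').point n := by
  change increasing y n = increasing y' n
  induction n with
  | zero => simp only [increasing, h 0 le_rfl]
  | succ n ih =>
    simp only [increasing, h (n + 1) le_rfl, ih fun i hi => h i (hi.trans n.le_succ)]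

theorem ofSeq_toSeq (ω : JumpPath E A) : ofSeq ω.init ω.point = ω := by
  refine ext' rfl (funext fun n => ?_)
  induction n with
  | zero => exact ofSeq_point_of_lt (ω.pos 0)
  | succ n ih =>
    have hT : (ofSeq ω.init ω.point).T (n + 1) = ω.T (n + 1) := by simp only [T, ih]
    by_cases h : ω.T (n + 1) < ∞
    · exact ofSeq_point_of_lt (hT ▸ ω.T_lt_succ (n + 1) h)
    · have h1 : ω.T (n + 1) = ∞ := by simpa using h
      rw [ofSeq_point_of_not_lt (by simp [hT, h1]), eq_comm]
      have := ω.T_mono (n + 1).le_succ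
      rw [h1, top_le_iff] at this
      exact pointTime_eq_top_iff.1 this

theorem trunc_ofSeq (n : ℕ) (z : E × A) (y : ℕ → Option (ℝ≥0 × E × A)) :
    trunc n (ofSeq z y) = ofSeq z (fun i => if i < n then y i else none) := by
  refine ext' rfl (funext fun i => ?_)
  by_cases hi : i < n
  · rw [trunc_point_of_lt hi]
    exact ofSeq_point_congr fun j hj => by rw [if_pos (hj.trans_lt hi)]
  · rw [trunc_point_of_le (not_lt.1 hi), eq_comm]
    by_cases h : (ofSeq z (fun i => if i < n then y i else none)).T i <
      pointTime ((fun i => if i < n then y i else none) i)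
    · rw [ofSeq_point_of_lt h, if_neg hi]
    · exact ofSeq_point_of_not_lt h

/-- The path that keeps the first `n` points of `ω`, followed by the point `y`. -/
noncomputable def append (n : ℕ) (ω : JumpPath E A) (y : Option (ℝ≥0 × E × A)) : JumpPath E A :=
  ofSeq ω.init fun i => if i < n then ω.point i else if i = n then y else none

/-- This is what drives the induction on `n`: the path up to the next point is a measurable function
of the path up to `T n` and of that point. -/
theorem append_trunc (n : ℕ) (ω : JumpPath E A) :
    append n (trunc n ω) (ω.point n) = trunc (n + 1) ω := by
  conv_rhs => rw [← ofSeq_toSeq ω, trunc_ofSeq]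
  unfold append
  congr 1
  ext1 i
  rcases lt_trichotomy i n with h | rfl | h
  · simp [h, trunc_point_of_lt h, h.trans n.lt_succ_self]
  · simp
  · simp [h.not_gt, h.ne', show ¬ i < n + 1 by omega]

variable [MeasurableSpace E] [MeasurableSpace A]

theorem measurable_increasing (n : ℕ) : Measurable
    fun y : ℕ → Option (ℝ≥0 × E × A) => increasing y n := by
  induction n with
  | zero =>
    simp only [increasing]
    refine Measurable.ite ?_ (measurable_pi_apply 0) measurable_const
    exact measurableSet_lt measurable_const (measurable_pointTime.comp (measurable_pi_apply 0))
  | succ n ih =>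
    simp only [increasing]
    refine Measurable.ite ?_ (measurable_pi_apply (n + 1)) measurable_const
    exact measurableSet_lt (measurable_pointTime.comp ih)
      (measurable_pointTime.comp (measurable_pi_apply (n + 1)))

theorem measurable_ofSeq : Measurable
    fun p : (E × A) × (ℕ → Option (ℝ≥0 × E × A)) => ofSeq p.1 p.2 :=
  measurable_of_toSeq measurable_fst fun n => (measurable_increasing n).comp measurable_snd

theorem measurable_append (n : ℕ) : Measurable
    fun p : JumpPath E A × Option (ℝ≥0 × E × A) => append n p.1 p.2 := by
  have hpt : ∀ i, Measurable fun p : JumpPath E A × Option (ℝ≥0 × E × A) =>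
      if i < n then p.1.point i else if i = n then p.2 else none := fun i => by
    by_cases h : i < n
    · simp only [if_pos h]
      exact (measurable_point i).comp measurable_fst
    · by_cases h' : i = n
      · simp only [if_neg h, if_pos h']
        exact measurable_snd
      · simp only [if_neg h, if_neg h']
        exact measurable_const
  exact measurable_ofSeq.comp ((measurable_init.comp measurable_fst).prodMk
    (measurable_pi_iff.2 hpt))

end OfSeq

end JumpPath

/-! ### Integrals over initial time intervals -/

/-- Integrals over `[0, t)` with respect to `timeMeasure` as integrals over real intervals. -/
theorem lintegral_timeMeasure_Iio {f : ℝ≥0 → ℝ≥0∞} (hf : Measurable f) (t : ℝ≥0) :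
    ∫⁻ s in Set.Iio t, f s ∂timeMeasure = ∫⁻ s in Set.Ioc (0 : ℝ) t, f s.toNNReal := by
  rw [← lintegral_indicator measurableSet_Iio,
    lintegral_timeMeasure (hf.indicator measurableSet_Iio),
    ← restrict_Ioo_eq_restrict_Ioc, ← lintegral_indicator measurableSet_Ioi,
    ← lintegral_indicator measurableSet_Ioo]
  refine lintegral_congr fun s => ?_
  by_cases h0 : 0 < s
  · by_cases ht : s < t
    · have : s.toNNReal < t := (Real.toNNReal_lt_iff_lt_coe h0.le).2 ht
      simp [Set.indicator, h0, ht, this]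
    · have : ¬ s.toNNReal < t := fun h => ht ((Real.toNNReal_lt_iff_lt_coe h0.le).1 h)
      simp [Set.indicator, h0, ht, this]
  · simp [Set.indicator, h0]

/-- One Picard step: integration sends a term of the exponential series to the next one. -/
theorem lintegral_timeMeasure_pow (K : ℝ≥0) (k : ℕ) (t : ℝ≥0) :
    ∫⁻ s in Set.Iio t, K * ENNReal.ofReal ((K * s) ^ k / k.factorial) ∂timeMeasure =
      ENNReal.ofReal ((K * t) ^ (k + 1) / (k + 1).factorial) := by
  rw [lintegral_timeMeasure_Iio (by fun_prop)]
  have h1 : ∀ s ∈ Set.Ioc (0 : ℝ) t,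
      (K : ℝ≥0∞) * ENNReal.ofReal ((K * (s.toNNReal : ℝ)) ^ k / k.factorial) =
        ENNReal.ofReal (K ^ (k + 1) / k.factorial * s ^ k) := by
    intro s hs
    rw [← ENNReal.ofReal_coe_nnreal, ← ENNReal.ofReal_mul K.coe_nonneg, Real.coe_toNNReal _ hs.1.le]
    congr 1
    ring
  rw [setLIntegral_congr_fun measurableSet_Ioc h1, ← ofReal_integral_eq_lintegral_ofReal,
    ← intervalIntegral.integral_of_le t.coe_nonneg]
  · congr 1
    rw [intervalIntegral.integral_const_mul, integral_pow, Nat.factorial_succ]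
    have := Nat.cast_ne_zero (R := ℝ).2 k.factorial_ne_zero
    push_cast
    field_simp
    ring
  · exact (Continuous.integrableOn_Icc (by fun_prop)).mono_set Set.Ioc_subset_Icc_self
  · refine (ae_restrict_iff' measurableSet_Ioc).2 (ae_of_all _ fun s hs => ?_)
    have := hs.1.le
    change 0 ≤ (K : ℝ) ^ (k + 1) / k.factorial * s ^ k
    positivity

namespace JumpPath

variable {E A : Type*} [MeasurableSpace E] [MeasurableSpace A]
  {Γ : JumpPath E A → ℝ≥0 → Measure (E × A)} {K : ℝ≥0}

/-! ### Uniqueness of the law with a given bounded intensity -/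

/-- The intensity integral of `G` at time `s`, given the path up to `T_n`. -/
noncomputable def stepRate (Γ : JumpPath E A → ℝ≥0 → Measure (E × A)) (n : ℕ)
    (G : (ℝ≥0 × JumpPath E A) × (E × A) → ℝ≥0∞) (s : ℝ≥0) (ω : JumpPath E A) : ℝ≥0∞ :=
  {ω : JumpPath E A | ω.T n < s}.indicator (fun ω => ∫⁻ z, G ((s, ω), z) ∂Γ ω s) ω

theorem measurableSet_T_lt (n : ℕ) :
    MeasurableSet {p : ℝ≥0 × JumpPath E A | p.2.T n < p.1} :=
  measurableSet_lt ((measurable_T n).comp measurable_snd) measurable_fst.coe_nnreal_ennreal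

theorem IsBoundedIntensity.measurable_stepRate (hΓ : IsBoundedIntensity Γ K) (n : ℕ)
    {G : (ℝ≥0 × JumpPath E A) × (E × A) → ℝ≥0∞} (hG : Measurable G) :
    Measurable fun p : ℝ≥0 × JumpPath E A => stepRate Γ n G p.1 p.2 := by
  convert (hΓ.measurable_lintegral hG).indicator (measurableSet_T_lt n) using 1
  ext p
  simp [stepRate, Set.indicator]

theorem IsBoundedIntensity.stepRate_le (hΓ : IsBoundedIntensity Γ K) (n : ℕ)
    {G : (ℝ≥0 × JumpPath E A) × (E × A) → ℝ≥0∞} {c : ℝ≥0∞} (hc : ∀ q, G q ≤ c) (s : ℝ≥0)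
    (ω : JumpPath E A) : stepRate Γ n G s ω ≤ c * K := by
  refine (Set.indicator_le_self _ _ _).trans ?_
  calc ∫⁻ z, G ((s, ω), z) ∂Γ ω s ≤ ∫⁻ _, c ∂Γ ω s := lintegral_mono fun z => hc _
    _ = c * Γ ω s Set.univ := lintegral_const c
    _ ≤ c * K := by gcongr; exact hΓ.le ω s

theorem measurableSet_le_T (n : ℕ) (t : ℝ≥0) :
    MeasurableSet {ω : JumpPath E A | (t : ℝ≥0∞) ≤ ω.T n} :=
  measurableSet_le measurable_const (measurable_T n)

/-- By Tonelli the time integral is taken last. What remains inside are expectations of functions of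
`trunc n ω` on `{s ≤ T (n + 1)}`, the only quantities that uniqueness has to control. -/
theorem StepCompensates.eq_lintegral (hΓ : IsBoundedIntensity Γ K) {n : ℕ}
    {P : Measure (JumpPath E A)} [SFinite P] (h : StepCompensates Γ n P)
    {G : (ℝ≥0 × JumpPath E A) × (E × A) → ℝ≥0∞} (hG : Measurable G) :
    ∫⁻ ω, (ω.point n).elim 0 (fun q => G ((q.1, trunc n ω), q.2)) ∂P =
      ∫⁻ s, ∫⁻ ω in {ω : JumpPath E A | (s : ℝ≥0∞) ≤ ω.T (n + 1)}, stepRate Γ n G s (trunc n ω) ∂P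
        ∂timeMeasure := by
  rw [h G hG, lintegral_lintegral_swap]
  · refine lintegral_congr fun s => ?_
    rw [← lintegral_indicator (measurableSet_le_T _ _)]
    refine lintegral_congr fun ω => ?_
    simp only [stochInterval, stepRate, Set.indicator, Set.mem_ofPred_eq, trunc_T le_rfl]
    by_cases h1 : ω.T n < s <;> by_cases h2 : (s : ℝ≥0∞) ≤ ω.T (n + 1) <;> simp [h1, h2]
  · exact (((hΓ.measurable_trunc_lintegral n hG).indicator
      (measurableSet_stochInterval' n)).comp measurable_swap).aemeasurable

/-- The compensation identity for `1_{s < t} g` computes the expectation of `g` on `{T (n + 1) <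
t}`. This yields the Volterra identity `u_g(t) + ∫₀ᵗ u_{g_s}(s) ds = E[g]` for `u_g(t) = E[g; T (n +
1) ≥ t]`, where `g_s` is the `stepRate` of `g` at time `s`. -/
theorem lintegral_trunc_split {P : Measure (JumpPath E A)} [SFinite P]
    (hΓ : IsBoundedIntensity Γ K) {n : ℕ} (h : StepCompensates Γ n P)
    {g : JumpPath E A → ℝ≥0∞} (hg : Measurable g) (t : ℝ≥0) :
    ∫⁻ ω in {ω : JumpPath E A | (t : ℝ≥0∞) ≤ ω.T (n + 1)}, g (trunc n ω) ∂P +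
      ∫⁻ s in Set.Iio t, ∫⁻ ω in {ω : JumpPath E A | (s : ℝ≥0∞) ≤ ω.T (n + 1)},
        stepRate Γ n (fun q => g q.1.2) s (trunc n ω) ∂P ∂timeMeasure = ∫⁻ ω, g (trunc n ω) ∂P := by
  have hG : Measurable fun q : (ℝ≥0 × JumpPath E A) × (E × A) =>
      (Set.Iio t).indicator (fun _ => g q.1.2) q.1.1 := by
    have : Measurable fun q : (ℝ≥0 × JumpPath E A) × (E × A) => g q.1.2 :=
      hg.comp measurable_fst.snd
    convert this.indicator (measurable_fst.fst (measurableSet_Iio (a := t))) using 1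
    ext q
    simp [Set.indicator]
  have h1 := h.eq_lintegral hΓ hG
  have h2 : ∀ s : ℝ≥0, ∫⁻ ω in {ω : JumpPath E A | (s : ℝ≥0∞) ≤ ω.T (n + 1)},
      stepRate Γ n (fun q => (Set.Iio t).indicator (fun _ => g q.1.2) q.1.1) s (trunc n ω) ∂P =
      (Set.Iio t).indicator (fun s => ∫⁻ ω in {ω : JumpPath E A | (s : ℝ≥0∞) ≤ ω.T (n + 1)},
        stepRate Γ n (fun q => g q.1.2) s (trunc n ω) ∂P) s := by
    intro s
    by_cases hs : s ∈ Set.Iio t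
    · simp only [Set.indicator_of_mem hs, stepRate]
    · have hs' : ¬ s < t := hs
      simp [stepRate, Set.indicator, hs']
  rw [lintegral_congr h2, lintegral_indicator measurableSet_Iio] at h1
  rw [← h1]
  conv_rhs => rw [← lintegral_add_compl (fun ω => g (trunc n ω)) (measurableSet_le_T (n + 1) t)]
  rw [← lintegral_indicator (measurableSet_le_T (n + 1) t).compl]
  congr 1
  refine lintegral_congr fun ω => ?_
  rcases hpt : ω.point n with _ | q
  · simp [Set.indicator, T, hpt]
  · simp [Set.indicator, T, hpt]

variable {P P' : Measure (JumpPath E A)} [IsProbabilityMeasure P] [IsProbabilityMeasure P']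

/-- Iteration of the Volterra identity. Each step replaces `g` by its `stepRate`, which multiplies
the bound `c` by `K`, and adds one time integration, whence the factor `(Kt)^k / k!`. -/
theorem lintegral_trunc_le_of_step (hΓ : IsBoundedIntensity Γ K) {n : ℕ}
    (h : StepCompensates Γ n P) (h' : StepCompensates Γ n P')
    (hn : P.map (trunc n) = P'.map (trunc n)) (k : ℕ) : ∀ {g : JumpPath E A → ℝ≥0∞}
    (_ : Measurable g) {c : ℝ≥0∞} (_ : c ≠ ∞) (_ : ∀ ω, g ω ≤ c) (t : ℝ≥0),
    ∫⁻ ω in {ω : JumpPath E A | (t : ℝ≥0∞) ≤ ω.T (n + 1)}, g (trunc n ω) ∂P ≤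
      ∫⁻ ω in {ω : JumpPath E A | (t : ℝ≥0∞) ≤ ω.T (n + 1)}, g (trunc n ω) ∂P' +
        c * ENNReal.ofReal ((K * t) ^ k / k.factorial) := by
  induction k generalizing P P' with
  | zero =>
    intro g hg c hc hgc t
    refine le_add_left ?_
    calc _ ≤ ∫⁻ ω, c ∂P := (setLIntegral_le_lintegral _ _).trans (lintegral_mono fun ω => hgc _)
      _ = _ := by simp
  | succ k ih =>
    intro g hg c hc hgc t
    have e1 := lintegral_trunc_split hΓ h hg t
    have e2 := lintegral_trunc_split hΓ h' hg t
    -- Here the equality of the laws up to the point `n` enters.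
    have e3 : ∫⁻ ω, g (trunc n ω) ∂P = ∫⁻ ω, g (trunc n ω) ∂P' := by
      rw [← lintegral_map hg (measurable_trunc n), hn, lintegral_map hg (measurable_trunc n)]
    have hfin : ∫⁻ s in Set.Iio t, ∫⁻ ω in {ω : JumpPath E A | (s : ℝ≥0∞) ≤ ω.T (n + 1)},
        stepRate Γ n (fun q => g q.1.2) s (trunc n ω) ∂P ∂timeMeasure ≠ ∞ := by
      refine ne_top_of_le_ne_top ?_ (le_add_self.trans e1.le)
      refine ne_top_of_le_ne_top hc ((lintegral_mono fun ω => hgc _).trans ?_)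
      simp
    have hle : ∫⁻ s in Set.Iio t, ∫⁻ ω in {ω : JumpPath E A | (s : ℝ≥0∞) ≤ ω.T (n + 1)},
        stepRate Γ n (fun q => g q.1.2) s (trunc n ω) ∂P' ∂timeMeasure ≤
        ∫⁻ s in Set.Iio t, ∫⁻ ω in {ω : JumpPath E A | (s : ℝ≥0∞) ≤ ω.T (n + 1)},
        stepRate Γ n (fun q => g q.1.2) s (trunc n ω) ∂P ∂timeMeasure +
        c * ENNReal.ofReal ((K * t) ^ (k + 1) / (k + 1).factorial) := by
      rw [← lintegral_timeMeasure_pow, ← lintegral_const_mul _ (by fun_prop),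
        ← lintegral_add_right _ (by fun_prop)]
      refine lintegral_mono fun s => ?_
      rw [← mul_assoc]
      have hG : Measurable fun q : (ℝ≥0 × JumpPath E A) × (E × A) => g q.1.2 :=
        hg.comp measurable_fst.snd
      -- The integral enters the Volterra identity with the opposite sign, so the two measures
      -- exchange their roles at every step.
      exact ih h' h hn.symm ((hΓ.measurable_stepRate n hG).comp measurable_prodMk_left)
        (ENNReal.mul_ne_top hc ENNReal.coe_ne_top)
        (fun ω => hΓ.stepRate_le n (fun q => hgc _) s ω) s
    -- The finite integral under `P` is added on both sides, which turns both sides into the known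
    -- expectation of `g` plus an error.
    rw [← ENNReal.add_le_add_iff_right hfin, e1, e3, ← e2, add_assoc, add_comm (c * _)]
    gcongr

theorem lintegral_trunc_eq_of_step (hΓ : IsBoundedIntensity Γ K) {n : ℕ}
    (h : StepCompensates Γ n P) (h' : StepCompensates Γ n P')
    (hn : P.map (trunc n) = P'.map (trunc n)) {g : JumpPath E A → ℝ≥0∞}
    (hg : Measurable g) {c : ℝ≥0∞} (hc : c ≠ ∞) (hgc : ∀ ω, g ω ≤ c) (t : ℝ≥0) :
    ∫⁻ ω in {ω : JumpPath E A | (t : ℝ≥0∞) ≤ ω.T (n + 1)}, g (trunc n ω) ∂P =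
      ∫⁻ ω in {ω : JumpPath E A | (t : ℝ≥0∞) ≤ ω.T (n + 1)}, g (trunc n ω) ∂P' := by
  have hlim : Tendsto (fun k : ℕ => c * ENNReal.ofReal (((K : ℝ) * t) ^ k / k.factorial)) atTop
      (𝓝 0) := by
    have := ENNReal.Tendsto.const_mul (a := c) (ENNReal.tendsto_ofReal
      (FloorSemiring.tendsto_pow_div_factorial_atTop ((K : ℝ) * t))) (Or.inr hc)
    simpa using this
  refine le_antisymm ?_ ?_
  · refine ge_of_tendsto' (b := ∫⁻ ω in {ω : JumpPath E A | (t : ℝ≥0∞) ≤ ω.T (n + 1)},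
      g (trunc n ω) ∂P) (by simpa using hlim.const_add _) fun k =>
      lintegral_trunc_le_of_step hΓ h h' hn k hg hc hgc t
  · refine ge_of_tendsto' (b := ∫⁻ ω in {ω : JumpPath E A | (t : ℝ≥0∞) ≤ ω.T (n + 1)},
      g (trunc n ω) ∂P') (by simpa using hlim.const_add _) fun k =>
      lintegral_trunc_le_of_step hΓ h' h hn.symm k hg hc hgc t

theorem lintegral_point_eq_of_step (hΓ : IsBoundedIntensity Γ K) {n : ℕ}
    (h : StepCompensates Γ n P) (h' : StepCompensates Γ n P')
    (hn : P.map (trunc n) = P'.map (trunc n)) {G : (ℝ≥0 × JumpPath E A) × (E × A) → ℝ≥0∞}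
    (hG : Measurable G) (hG1 : ∀ q, G q ≤ 1) :
    ∫⁻ ω, (ω.point n).elim 0 (fun q => G ((q.1, trunc n ω), q.2)) ∂P =
      ∫⁻ ω, (ω.point n).elim 0 (fun q => G ((q.1, trunc n ω), q.2)) ∂P' := by
  rw [h.eq_lintegral hΓ hG, h'.eq_lintegral hΓ hG]
  exact lintegral_congr fun s => lintegral_trunc_eq_of_step hΓ h h' hn
    ((hΓ.measurable_stepRate n hG).comp measurable_prodMk_left)
    (ENNReal.mul_ne_top ENNReal.one_ne_top ENNReal.coe_ne_top)
    (fun ω => hΓ.stepRate_le n hG1 s ω) s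

/-- The compensation identity determines the joint law of the past and the next point where that
point exists. The event that there is no further point is then determined by complementation,
because the law of the past is known. -/
theorem map_trunc_succ_eq_of_step (hΓ : IsBoundedIntensity Γ K) {n : ℕ}
    (h : StepCompensates Γ n P) (h' : StepCompensates Γ n P')
    (hn : P.map (trunc n) = P'.map (trunc n)) :
    P.map (trunc (n + 1)) = P'.map (trunc (n + 1)) := by
  classical
  have hpair : Measurable fun ω : JumpPath E A => (trunc n ω, ω.point n) :=
    (measurable_trunc n).prodMk (measurable_point n)
  suffices hS : P.map (fun ω => (trunc n ω, ω.point n)) =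
      P'.map (fun ω => (trunc n ω, ω.point n)) by
    have hcomp : (trunc (n + 1) : JumpPath E A → JumpPath E A) =
        (fun p : JumpPath E A × Option (ℝ≥0 × E × A) => append n p.1 p.2) ∘
          fun ω => (trunc n ω, ω.point n) := by
      ext1 ω
      exact (append_trunc n ω).symm
    rw [hcomp, ← Measure.map_map (measurable_append n) hpair, hS,
      Measure.map_map (measurable_append n) hpair]
  ext S hS
  rw [Measure.map_apply hpair hS, Measure.map_apply hpair hS]
  set U : Set (JumpPath E A) := {ω | (trunc n ω, (none : Option (ℝ≥0 × E × A))) ∈ S} with hU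
  have hUm : MeasurableSet U := ((measurable_trunc n).prodMk measurable_const) hS
  set W : Set (JumpPath E A) := {ω | ω.point n ≠ none} with hW
  have hWm : MeasurableSet W := (measurable_point n measurableSet_singleton_none).compl
  -- the part of `S` on which a point occurs
  have hsome : ∀ S : Set (JumpPath E A × Option (ℝ≥0 × E × A)), MeasurableSet S →
      P ((fun ω : JumpPath E A => (trunc n ω, ω.point n)) ⁻¹' S ∩ W) =
        P' ((fun ω : JumpPath E A => (trunc n ω, ω.point n)) ⁻¹' S ∩ W) := by
    intro S hS
    have hm : Measurable fun q : (ℝ≥0 × JumpPath E A) × (E × A) =>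
        (q.1.2, (some (q.1.1, q.2) : Option (ℝ≥0 × E × A))) :=
      measurable_fst.snd.prodMk (measurable_some.comp (measurable_fst.fst.prodMk measurable_snd))
    have key : ∀ μ : Measure (JumpPath E A),
        μ ((fun ω : JumpPath E A => (trunc n ω, ω.point n)) ⁻¹' S ∩ W) =
        ∫⁻ ω, (ω.point n).elim 0 (fun q => ((fun q : (ℝ≥0 × JumpPath E A) × (E × A) =>
          (q.1.2, (some (q.1.1, q.2) : Option (ℝ≥0 × E × A)))) ⁻¹' S).indicator 1
            ((q.1, trunc n ω), q.2)) ∂μ := by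
      intro μ
      rw [← lintegral_indicator_one ((hpair hS).inter hWm)]
      refine lintegral_congr fun ω => ?_
      rcases hpt : ω.point n with _ | q
      · simp [Set.indicator, hW, hpt]
      · simp [Set.indicator, hW, hpt]
    rw [key, key]
    exact lintegral_point_eq_of_step hΓ h h' hn (measurable_one.indicator (hm hS))
      fun q => Set.indicator_le_self' (by simp) q
  have hnone : P (U \ W) = P' (U \ W) := by
    have h1 : P U = P' U := by
      have hV : MeasurableSet {ω : JumpPath E A | (ω, (none : Option (ℝ≥0 × E × A))) ∈ S} :=
        measurable_prodMk_right hS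
      have := congrArg (fun μ => μ {ω : JumpPath E A | (ω, (none : Option (ℝ≥0 × E × A))) ∈ S}) hn
      simpa [Measure.map_apply (measurable_trunc n) hV] using this
    have h2 : P (U ∩ W) = P' (U ∩ W) := by
      have := hsome ({ω : JumpPath E A | (ω, (none : Option (ℝ≥0 × E × A))) ∈ S} ×ˢ Set.univ)
        (((measurable_prodMk_right hS)).prod .univ)
      simpa [hU, Set.preimage] using this
    have e1 := measure_inter_add_sdiff (μ := P) U hWm
    have e2 := measure_inter_add_sdiff (μ := P') U hWm
    rw [h2, h1, ← e2] at e1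
    exact (ENNReal.add_right_inj (measure_ne_top P' _)).1 e1
  rw [← measure_inter_add_sdiff (μ := P) _ hWm, ← measure_inter_add_sdiff (μ := P') _ hWm, hsome S hS]
  congr 1
  have hdiff : (fun ω : JumpPath E A => (trunc n ω, ω.point n)) ⁻¹' S \ W = U \ W := by
    ext ω
    simp only [hU, hW, Set.mem_sdiff, Set.mem_preimage, Set.mem_ofPred_eq, not_not]
    exact and_congr_left fun hω => by rw [hω]
  rw [hdiff, hnone]

theorem instMeasurableSpace_le_iSup_trunc :
    (instMeasurableSpace : MeasurableSpace (JumpPath E A)) ≤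
      ⨆ n, MeasurableSpace.comap (trunc n) instMeasurableSpace := by
  have hle : ∀ n, Measurable[⨆ n, MeasurableSpace.comap (trunc n) instMeasurableSpace]
      (trunc n : JumpPath E A → JumpPath E A) := fun n =>
    (comap_measurable (trunc n)).mono (le_iSup (fun n => MeasurableSpace.comap
      (trunc n : JumpPath E A → JumpPath E A) instMeasurableSpace) n) le_rfl
  have hi : Measurable[⨆ n, MeasurableSpace.comap (trunc n) instMeasurableSpace]
      (fun ω : JumpPath E A => ω.init) :=
    Measurable.comp (f := trunc 0) (g := fun ω : JumpPath E A => ω.init) measurable_init (hle 0)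
  have hp : ∀ i, Measurable[⨆ n, MeasurableSpace.comap (trunc n) instMeasurableSpace]
      (fun ω : JumpPath E A => ω.point i) := fun i => by
    have := Measurable.comp (measurable_point i) (hle (i + 1))
    have he : (fun ω : JumpPath E A => ω.point i) ∘ trunc (i + 1) = fun ω => ω.point i :=
      funext fun ω => trunc_point_of_lt i.lt_succ_self ω
    rwa [he] at this
  have hseq : Measurable[⨆ n, MeasurableSpace.comap (trunc n) instMeasurableSpace]
      (toSeq : JumpPath E A → _) :=
    @Measurable.prodMk _ _ _ _ _ (_) _ _ hi (@measurable_pi_iff _ _ _ (_) _ _ |>.2 hp)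
  conv_lhs => rw [instMeasurableSpace_eq_comap]
  exact hseq.comap_le

/-- The σ-algebras generated by the truncations increase with `n`, so their union is a π-system, and
it generates. -/
theorem ext_of_map_trunc (h : ∀ n, P.map (trunc n) = P'.map (trunc n)) : P = P' := by
  refine ext_of_generate_finite (⋃ n, {S : Set (JumpPath E A) |
    MeasurableSet[MeasurableSpace.comap (trunc n) instMeasurableSpace] S}) ?_ ?_ ?_ ?_
  · refine le_antisymm (instMeasurableSpace_le_iSup_trunc.trans (iSup_le fun n S hS => ?_)) ?_
    · exact MeasurableSpace.measurableSet_generateFrom (Set.mem_iUnion.2 ⟨n, hS⟩)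
    · refine MeasurableSpace.generateFrom_le fun S hS => ?_
      obtain ⟨n, hn⟩ := Set.mem_iUnion.1 hS
      exact (measurable_trunc n).comap_le S hn
  · refine isPiSystem_iUnion_of_monotone _ (fun n =>
      @MeasurableSpace.isPiSystem_measurableSet _ (MeasurableSpace.comap (trunc n) instMeasurableSpace))
      fun m n hmn S hS => ?_
    obtain ⟨B, hB, rfl⟩ := hS
    refine ⟨trunc m ⁻¹' B, measurable_trunc m hB, ?_⟩
    ext ω
    simp [trunc_trunc hmn]
  · intro S hS
    obtain ⟨n, B, hB, rfl⟩ := Set.mem_iUnion.1 hS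
    rw [← Measure.map_apply (measurable_trunc n) hB, h n,
      Measure.map_apply (measurable_trunc n) hB]
  · simp

/-- A law on the path space is determined by its initial law and a bounded intensity. -/
theorem Compensates.unique (hΓ : IsBoundedIntensity Γ K) (h : Compensates Γ P)
    (h' : Compensates Γ P') (h0 : P.map (fun ω => ω.init) = P'.map (fun ω => ω.init)) :
    P = P' := by
  refine ext_of_map_trunc fun n => ?_
  induction n with
  | zero =>
    have hm : Measurable fun z : E × A => ofSeq z (fun _ => (none : Option (ℝ≥0 × E × A))) :=
      measurable_ofSeq.comp (measurable_id.prodMk measurable_const)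
    have hcomp : (trunc 0 : JumpPath E A → JumpPath E A) =
        (fun z : E × A => ofSeq z (fun _ => none)) ∘ fun ω => ω.init := by
      ext1 ω
      conv_lhs => rw [← ofSeq_toSeq ω, trunc_ofSeq]
      simp
    rw [hcomp, ← Measure.map_map hm measurable_init, h0, Measure.map_map hm measurable_init]
  | succ n ih => exact map_trunc_succ_eq_of_step hΓ (h.step hΓ n) (h'.step hΓ n) ih

end JumpPath

/-! ### Survival functions -/

/-- As `f` is only measurable, its primitive is differentiable merely almost everywhere. The
exponential is Lipschitz since `f` is bounded, hence absolutely continuous, and the fundamental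
theorem of calculus still applies. -/
theorem integral_mul_exp_neg_integral {f : ℝ → ℝ} (hf : Measurable f) (h0 : ∀ s, 0 ≤ f s) {K : ℝ}
    (hK : ∀ s, f s ≤ K) {t : ℝ} (ht : 0 ≤ t) :
    ∫ s in (0 : ℝ)..t, f s * Real.exp (-∫ r in (0 : ℝ)..s, f r) =
      1 - Real.exp (-∫ r in (0 : ℝ)..t, f r) := by
  have hint : ∀ a b : ℝ, IntervalIntegrable f volume a b := fun a b => by
    refine (intervalIntegrable_const (c := K)).mono_fun hf.aestronglyMeasurable
      (ae_of_all _ fun s => ?_)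
    change ‖f s‖ ≤ ‖K‖
    rw [Real.norm_of_nonneg (h0 s), Real.norm_of_nonneg ((h0 s).trans (hK s))]
    exact hK s
  have hlip : LipschitzOnWith K.toNNReal (fun s => Real.exp (-∫ r in (0 : ℝ)..s, f r))
      (Set.uIcc 0 t) := by
    rw [Set.uIcc_of_le ht]
    refine LipschitzOnWith.of_le_add_mul _ fun a ha b hb => ?_
    have hK0 : 0 ≤ K := (h0 0).trans (hK 0)
    rw [Real.coe_toNNReal _ hK0]
    have hRa : 0 ≤ ∫ r in (0 : ℝ)..a, f r :=
      intervalIntegral.integral_nonneg ha.1 fun _ _ => h0 _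
    have hRb : 0 ≤ ∫ r in (0 : ℝ)..b, f r :=
      intervalIntegral.integral_nonneg hb.1 fun _ _ => h0 _
    have hdiff : (∫ r in (0 : ℝ)..b, f r) - ∫ r in (0 : ℝ)..a, f r ≤ K * dist a b := by
      rw [intervalIntegral.integral_interval_sub_left (hint 0 b) (hint 0 a)]
      refine (le_abs_self _).trans ?_
      have := intervalIntegral.norm_integral_le_of_norm_le_const (a := a) (b := b) (f := f) (C := K)
        fun x _ => by rw [Real.norm_of_nonneg (h0 x)]; exact hK x
      rwa [Real.norm_eq_abs, abs_sub_comm b a] at this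
    have h1 := Real.add_one_le_exp (-((∫ r in (0 : ℝ)..b, f r) - ∫ r in (0 : ℝ)..a, f r))
    have h2 : Real.exp (-∫ r in (0 : ℝ)..a, f r) ≤ 1 := Real.exp_le_one_iff.2 (by linarith)
    have h3 : Real.exp (-∫ r in (0 : ℝ)..b, f r) = Real.exp (-∫ r in (0 : ℝ)..a, f r) *
        Real.exp (-((∫ r in (0 : ℝ)..b, f r) - ∫ r in (0 : ℝ)..a, f r)) := by
      rw [← Real.exp_add]
      congr 1
      ring
    have h4 := Real.exp_pos (-∫ r in (0 : ℝ)..a, f r)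
    have h5 : 0 ≤ K * dist a b := mul_nonneg hK0 dist_nonneg
    nlinarith
  have hac := hlip.absolutelyContinuousOnInterval.integral_deriv_eq_sub
  have hder : ∀ᵐ x, x ∈ Set.uIcc 0 t →
      HasDerivAt (fun s => Real.exp (-∫ r in (0 : ℝ)..s, f r))
        (-(f x * Real.exp (-∫ r in (0 : ℝ)..x, f r))) x := by
    filter_upwards [(hint 0 t).ae_hasDerivAt_integral] with x hx hxt
    have := (hx hxt 0 (by simp)).fun_neg.exp
    convert this using 1
    ring
  have hcongr : ∫ s in (0 : ℝ)..t, deriv (fun s => Real.exp (-∫ r in (0 : ℝ)..s, f r)) s =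
      ∫ s in (0 : ℝ)..t, -(f s * Real.exp (-∫ r in (0 : ℝ)..s, f r)) := by
    refine intervalIntegral.integral_congr_ae ?_
    filter_upwards [hder] with x hx hxt
    exact (hx (Set.uIoc_subset_uIcc hxt)).deriv
  rw [hcongr, intervalIntegral.integral_neg] at hac
  simp only [intervalIntegral.integral_same, neg_zero, Real.exp_zero] at hac
  linarith

/-- The survival function with hazard rate `m`. -/
noncomputable def survival (m : ℝ≥0 → ℝ≥0∞) (t : ℝ≥0) : ℝ≥0∞ :=
  ENNReal.ofReal (Real.exp (-(∫⁻ s in Set.Iio t, m s ∂timeMeasure).toReal))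

/-- The integral is the probability that the event happens before `t`, by the equation `S' = -m S`
for the survival function. -/
theorem survival_add_lintegral {m : ℝ≥0 → ℝ≥0∞} (hm : Measurable m) {K : ℝ≥0}
    (hK : ∀ s, m s ≤ K) (t : ℝ≥0) :
    survival m t + ∫⁻ s in Set.Iio t, survival m s * m s ∂timeMeasure = 1 := by
  set f : ℝ → ℝ := fun s => (m s.toNNReal).toReal with hfdef
  have hf : Measurable f := (hm.comp measurable_real_toNNReal).ennreal_toReal
  have hfin : ∀ s, m s ≠ ∞ := fun s => ne_top_of_le_ne_top ENNReal.coe_ne_top (hK s)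
  have h0 : ∀ s, 0 ≤ f s := fun s => ENNReal.toReal_nonneg
  have hfK : ∀ s, f s ≤ K := fun s => by
    have := ENNReal.toReal_mono ENNReal.coe_ne_top (hK s.toNNReal)
    simpa using this
  have hint : ∀ a b : ℝ, IntervalIntegrable f volume a b := fun a b => by
    refine (intervalIntegrable_const (c := (K : ℝ))).mono_fun hf.aestronglyMeasurable
      (ae_of_all _ fun s => ?_)
    change ‖f s‖ ≤ ‖(K : ℝ)‖
    rw [Real.norm_of_nonneg (h0 s), Real.norm_of_nonneg K.coe_nonneg]
    exact hfK s
  have hhaz : ∀ t : ℝ≥0, (∫⁻ s in Set.Iio t, m s ∂timeMeasure).toReal =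
      ∫ r in (0 : ℝ)..t, f r := fun t => by
    rw [lintegral_timeMeasure_Iio hm, intervalIntegral.integral_of_le t.coe_nonneg,
      integral_eq_lintegral_of_nonneg_ae (ae_of_all _ h0) hf.aestronglyMeasurable]
    congr 1
    refine lintegral_congr fun s => ?_
    rw [hfdef, ENNReal.ofReal_toReal (hfin _)]
  have hmono : Monotone fun t : ℝ≥0 => ∫⁻ s in Set.Iio t, m s ∂timeMeasure := fun a b hab =>
    lintegral_mono_set (Set.Iio_subset_Iio hab)
  have hSm : Measurable (survival m) := by
    unfold survival
    exact (hmono.measurable.ennreal_toReal.neg.exp).ennreal_ofReal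
  rw [lintegral_timeMeasure_Iio (f := fun s => survival m s * m s) (hSm.mul hm)]
  have hcongr : ∀ s ∈ Set.Ioc (0 : ℝ) t, survival m s.toNNReal * m s.toNNReal =
      ENNReal.ofReal (f s * Real.exp (-∫ r in (0 : ℝ)..s, f r)) := fun s hs => by
    rw [survival, hhaz, Real.coe_toNNReal _ hs.1.le, mul_comm, ENNReal.ofReal_mul (h0 s), hfdef,
      ENNReal.ofReal_toReal (hfin _)]
  have hcont : Continuous fun s => Real.exp (-∫ r in (0 : ℝ)..s, f r) :=
    (intervalIntegral.continuous_primitive hint 0).neg.rexp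
  rw [setLIntegral_congr_fun measurableSet_Ioc hcongr, ← ofReal_integral_eq_lintegral_ofReal,
    ← intervalIntegral.integral_of_le t.coe_nonneg,
    integral_mul_exp_neg_integral hf h0 hfK t.coe_nonneg, survival, hhaz,
    ← ENNReal.ofReal_add (Real.exp_pos _).le]
  · simp
  · simp only [sub_nonneg, Real.exp_le_one_iff, Left.neg_nonpos_iff]
    exact intervalIntegral.integral_nonneg t.coe_nonneg fun _ _ => h0 _
  · have := (hint 0 t).mul_continuousOn hcont.continuousOn
    exact (intervalIntegrable_iff_integrableOn_Ioc_of_le t.coe_nonneg).1 this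
  · exact ae_of_all _ fun s => mul_nonneg (h0 s) (Real.exp_pos _).le

theorem lintegral_survival_le_one {m : ℝ≥0 → ℝ≥0∞} (hm : Measurable m) {K : ℝ≥0}
    (hK : ∀ s, m s ≤ K) : ∫⁻ s, survival m s * m s ∂timeMeasure ≤ 1 := by
  have hu : (⋃ k : ℕ, Set.Iio (k : ℝ≥0)) = Set.univ := by
    refine Set.eq_univ_of_forall fun s => ?_
    obtain ⟨k, hk⟩ := exists_nat_gt s
    exact Set.mem_iUnion.2 ⟨k, hk⟩
  rw [← setLIntegral_univ, ← hu, setLIntegral_iUnion_of_directed]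
  · refine iSup_le fun k => ?_
    rw [← survival_add_lintegral hm hK k]
    exact le_add_self
  · refine Monotone.directed_le fun a b hab => Set.Iio_subset_Iio (by exact_mod_cast hab)

namespace JumpPath

variable {E A : Type*} [MeasurableSpace E] [MeasurableSpace A]
  {Γ : JumpPath E A → ℝ≥0 → Measure (E × A)} {K : ℝ≥0}

/-! ### The law of the next point -/

/-- The hazard rate of `T_{n+1}` given the path up to `T_n`. -/
noncomputable def hazard (Γ : JumpPath E A → ℝ≥0 → Measure (E × A)) (n : ℕ) (ω : JumpPath E A)
    (s : ℝ≥0) : ℝ≥0∞ := stepRate Γ n (fun _ => 1) s ω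

theorem hazard_eq (n : ℕ) (ω : JumpPath E A) (s : ℝ≥0) :
    hazard Γ n ω s = {s : ℝ≥0 | ω.T n < s}.indicator (fun s => Γ ω s Set.univ) s := by
  simp [hazard, stepRate, Set.indicator]

theorem IsBoundedIntensity.measurable_hazard (hΓ : IsBoundedIntensity Γ K) (n : ℕ) :
    Measurable fun p : JumpPath E A × ℝ≥0 => hazard Γ n p.1 p.2 :=
  (hΓ.measurable_stepRate n measurable_const).comp measurable_swap

theorem IsBoundedIntensity.hazard_le (hΓ : IsBoundedIntensity Γ K) (n : ℕ) (ω : JumpPath E A)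
    (s : ℝ≥0) : hazard Γ n ω s ≤ K := by
  simpa [hazard] using hΓ.stepRate_le n (G := fun _ => 1) (c := 1) (fun _ => le_rfl) s ω

theorem IsBoundedIntensity.measurable_survival (hΓ : IsBoundedIntensity Γ K) (n : ℕ) :
    Measurable fun p : JumpPath E A × ℝ≥0 => survival (hazard Γ n p.1) p.2 := by
  unfold survival
  refine (Measurable.ennreal_toReal ?_).neg.exp.ennreal_ofReal
  have : Measurable fun q : (JumpPath E A × ℝ≥0) × ℝ≥0 =>
      (Set.Iio q.1.2).indicator (hazard Γ n q.1.1) q.2 := by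
    have h1 : Measurable fun q : (JumpPath E A × ℝ≥0) × ℝ≥0 => hazard Γ n q.1.1 q.2 :=
      (hΓ.measurable_hazard n).comp (measurable_fst.fst.prodMk measurable_snd)
    have h2 : MeasurableSet {q : (JumpPath E A × ℝ≥0) × ℝ≥0 | q.2 < q.1.2} :=
      measurableSet_lt measurable_snd measurable_fst.snd
    convert h1.indicator h2 using 1
    ext q
    simp [Set.indicator]
  have h3 := this.lintegral_prod_right' (ν := timeMeasure)
  simpa only [lintegral_indicator measurableSet_Iio] using h3

/-- The density of `T_{n+1}` with respect to the intensity, given the path up to `T_n`. -/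
noncomputable def stepDensity (Γ : JumpPath E A → ℝ≥0 → Measure (E × A)) (n : ℕ)
    (ω : JumpPath E A) (s : ℝ≥0) : ℝ≥0∞ :=
  {s : ℝ≥0 | ω.T n < s}.indicator (survival (hazard Γ n ω)) s

theorem IsBoundedIntensity.measurable_stepDensity (hΓ : IsBoundedIntensity Γ K) (n : ℕ) :
    Measurable (Function.uncurry (stepDensity Γ n)) := by
  have h2 : MeasurableSet {q : JumpPath E A × ℝ≥0 | q.1.T n < q.2} :=
    measurableSet_lt ((measurable_T n).comp measurable_fst) measurable_snd.coe_nnreal_ennreal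
  convert (hΓ.measurable_survival n).indicator h2 using 1
  ext q
  simp [Function.uncurry, stepDensity, Set.indicator]

theorem stepDensity_ne_top (n : ℕ) (ω : JumpPath E A) (s : ℝ≥0) : stepDensity Γ n ω s ≠ ∞ := by
  refine ne_top_of_le_ne_top ?_ (Set.indicator_le_self _ _ _)
  simp [survival]

/-- The law of the next point, restricted to the event that it occurs in finite time. -/
noncomputable def IsBoundedIntensity.finiteStep (hΓ : IsBoundedIntensity Γ K) (n : ℕ) :
    Kernel (JumpPath E A) (ℝ≥0 × E × A) :=
  (Kernel.const (JumpPath E A) timeMeasure).withDensity (stepDensity Γ n) ⊗ₖ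
    hΓ.kernel.comap Prod.swap measurable_swap

theorem IsBoundedIntensity.lintegral_finiteStep (hΓ : IsBoundedIntensity Γ K) (n : ℕ)
    (ω : JumpPath E A) {f : ℝ≥0 × E × A → ℝ≥0∞} (hf : Measurable f) :
    ∫⁻ q, f q ∂hΓ.finiteStep n ω =
      ∫⁻ s, stepDensity Γ n ω s * ∫⁻ z, f (s, z) ∂Γ ω s ∂timeMeasure := by
  have : IsSFiniteKernel
      ((Kernel.const (JumpPath E A) timeMeasure).withDensity (stepDensity Γ n)) :=
    Kernel.IsSFiniteKernel.withDensity _ fun ω s => stepDensity_ne_top n ω s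
  rw [finiteStep, Kernel.lintegral_compProd _ _ _ hf,
    Kernel.lintegral_withDensity _ (hΓ.measurable_stepDensity n)]
  · rfl
  · exact Measurable.lintegral_kernel_prod_right' (κ := (hΓ.kernel.comap Prod.swap measurable_swap).comap
      (fun s : ℝ≥0 => (ω, s)) measurable_prodMk_left) hf

theorem stepDensity_mul (n : ℕ) (ω : JumpPath E A) (s : ℝ≥0) :
    stepDensity Γ n ω s * Γ ω s Set.univ = survival (hazard Γ n ω) s * hazard Γ n ω s := by
  rw [hazard_eq, stepDensity]
  by_cases h : s ∈ {s : ℝ≥0 | ω.T n < s}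
  · simp [Set.indicator_of_mem h]
  · simp [Set.indicator_of_notMem h]

theorem IsBoundedIntensity.finiteStep_univ_le (hΓ : IsBoundedIntensity Γ K) (n : ℕ)
    (ω : JumpPath E A) : hΓ.finiteStep n ω Set.univ ≤ 1 := by
  rw [← lintegral_one, hΓ.lintegral_finiteStep n ω (f := fun _ => 1) measurable_const]
  simp only [lintegral_one, stepDensity_mul]
  exact lintegral_survival_le_one ((hΓ.measurable_hazard n).comp measurable_prodMk_left)
    (hΓ.hazard_le n ω)

/-- The law of the next point given the path up to `T_n`. -/
noncomputable def IsBoundedIntensity.stepLaw (hΓ : IsBoundedIntensity Γ K) (n : ℕ) :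
    Kernel (JumpPath E A) (Option (ℝ≥0 × E × A)) where
  toFun ω := (hΓ.finiteStep n ω).map some + (1 - hΓ.finiteStep n ω Set.univ) • Measure.dirac none
  measurable' := by
    refine Measure.measurable_of_measurable_coe _ fun S hS => ?_
    simp only [Measure.add_apply, Measure.smul_apply, smul_eq_mul,
      Measure.map_apply measurable_some hS]
    exact ((hΓ.finiteStep n).measurable_coe (measurable_some hS)).add
      ((measurable_const.sub ((hΓ.finiteStep n).measurable_coe .univ)).mul_const _)

theorem IsBoundedIntensity.stepLaw_apply (hΓ : IsBoundedIntensity Γ K) (n : ℕ)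
    (ω : JumpPath E A) : hΓ.stepLaw n ω =
      (hΓ.finiteStep n ω).map some + (1 - hΓ.finiteStep n ω Set.univ) • Measure.dirac none := rfl

instance IsBoundedIntensity.isMarkovKernel_stepLaw (hΓ : IsBoundedIntensity Γ K) (n : ℕ) :
    IsMarkovKernel (hΓ.stepLaw n) := by
  refine ⟨fun ω => ⟨?_⟩⟩
  rw [stepLaw_apply, Measure.add_apply, Measure.map_apply measurable_some .univ]
  simp [add_tsub_cancel_of_le (hΓ.finiteStep_univ_le n ω)]

theorem IsBoundedIntensity.lintegral_stepLaw (hΓ : IsBoundedIntensity Γ K) (n : ℕ)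
    (ω : JumpPath E A) {f : Option (ℝ≥0 × E × A) → ℝ≥0∞} (hf : Measurable f) (h0 : f none = 0) :
    ∫⁻ y, f y ∂hΓ.stepLaw n ω =
      ∫⁻ s, stepDensity Γ n ω s * ∫⁻ z, f (some (s, z)) ∂Γ ω s ∂timeMeasure := by
  rw [stepLaw_apply, lintegral_add_measure, lintegral_map hf measurable_some, lintegral_smul_measure,
    lintegral_dirac' _ hf, h0]
  rw [hΓ.lintegral_finiteStep n ω (f := fun q => f (some q)) (hf.comp measurable_some)]
  simp

/-- The complementary event consists of finite points only, and its mass is one minus the survival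
function, so the atom at `none` need not be computed. -/
theorem IsBoundedIntensity.stepLaw_le_pointTime (hΓ : IsBoundedIntensity Γ K) {n : ℕ}
    {ω : JumpPath E A} {t : ℝ≥0} :
    hΓ.stepLaw n ω {y | (t : ℝ≥0∞) ≤ pointTime y} = survival (hazard Γ n ω) t := by
  have hm : MeasurableSet {y : Option (ℝ≥0 × E × A) | pointTime y < t} :=
    measurableSet_lt measurable_pointTime measurable_const
  have hc : {y : Option (ℝ≥0 × E × A) | (t : ℝ≥0∞) ≤ pointTime y} = {y | pointTime y < t}ᶜ := by
    ext; simp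
  have hlt : hΓ.stepLaw n ω {y | pointTime y < t} =
      ∫⁻ s in Set.Iio t, survival (hazard Γ n ω) s * hazard Γ n ω s ∂timeMeasure := by
    rw [← lintegral_indicator_one hm,
      hΓ.lintegral_stepLaw n ω (measurable_one.indicator hm) (by simp),
      ← lintegral_indicator measurableSet_Iio]
    refine lintegral_congr fun s => ?_
    by_cases hs : s < t
    · simp [Set.indicator, hs, ← stepDensity_mul]
    · simp [Set.indicator, hs]
  have hh : Measurable (hazard Γ n ω) := (hΓ.measurable_hazard n).comp measurable_prodMk_left
  rw [hc, prob_compl_eq_one_sub hm, hlt, ← survival_add_lintegral hh (hΓ.hazard_le n ω) t]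
  refine ENNReal.add_sub_cancel_right (ne_top_of_le_ne_top ENNReal.one_ne_top ?_)
  rw [← hlt]
  exact prob_le_one

/-- The density vanishes up to `T n`, so the drawn times almost surely increase and `ofSeq` discards
none of the points. -/
theorem IsBoundedIntensity.stepLaw_ae (hΓ : IsBoundedIntensity Γ K) (n : ℕ) (ω : JumpPath E A) :
    hΓ.stepLaw n ω {y | ¬ ω.T n < pointTime y ∧ y ≠ none} = 0 := by
  have hm : MeasurableSet {y : Option (ℝ≥0 × E × A) | ¬ ω.T n < pointTime y ∧ y ≠ none} :=
    (measurableSet_lt measurable_const measurable_pointTime).compl.inter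
      measurableSet_singleton_none.compl
  rw [← lintegral_indicator_one hm,
    hΓ.lintegral_stepLaw n ω (measurable_one.indicator hm) (by simp)]
  convert lintegral_zero with s
  by_cases hs : ω.T n < s
  · simp [Set.indicator, hs]
  · simp [stepDensity, Set.indicator, hs]

/-! ### Existence of the law with a given bounded intensity -/

/-- The path with initial condition `z` and the points `h 1, …, h n`. -/
noncomputable def ofHistory (z : E × A) (n : ℕ)
    (h : (i : Finset.Iic n) → Option (ℝ≥0 × E × A)) : JumpPath E A :=
  ofSeq z fun i => if hi : i < n then h ⟨i + 1, Finset.mem_Iic.2 hi⟩ else none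

theorem measurable_ofHistory (z : E × A) (n : ℕ) : Measurable (ofHistory z n) := by
  have hp : ∀ i, Measurable fun h : (i : Finset.Iic n) → Option (ℝ≥0 × E × A) =>
      if hi : i < n then h ⟨i + 1, Finset.mem_Iic.2 hi⟩ else none := fun i => by
    by_cases hi : i < n
    · simp only [dif_pos hi]
      exact measurable_pi_apply _
    · simp only [dif_neg hi]
      exact measurable_const
  exact measurable_ofSeq.comp (measurable_const.prodMk (measurable_pi_iff.2 hp))

/-- The transition kernels of the sequence of points. -/
noncomputable def IsBoundedIntensity.transition (hΓ : IsBoundedIntensity Γ K) (z : E × A) (n : ℕ) :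
    Kernel ((i : Finset.Iic n) → Option (ℝ≥0 × E × A)) (Option (ℝ≥0 × E × A)) :=
  (hΓ.stepLaw n).comap (ofHistory z n) (measurable_ofHistory z n)

instance (hΓ : IsBoundedIntensity Γ K) (z : E × A) (n : ℕ) :
    IsMarkovKernel (hΓ.transition z n) := by
  unfold IsBoundedIntensity.transition; infer_instance

/-- The law of the sequence of points. -/
noncomputable def IsBoundedIntensity.seqLaw (hΓ : IsBoundedIntensity Γ K) (z : E × A) :
    Measure (ℕ → Option (ℝ≥0 × E × A)) :=
  -- Coordinate zero of the trajectory is a dummy start. The point with index `i` of the path is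
  -- coordinate `i + 1`.
  Kernel.traj (X := fun _ => Option (ℝ≥0 × E × A)) (hΓ.transition z) 0 fun _ => none

instance (hΓ : IsBoundedIntensity Γ K) (z : E × A) : IsProbabilityMeasure (hΓ.seqLaw z) := by
  unfold IsBoundedIntensity.seqLaw; infer_instance

/-- The path with initial condition `z` and points `y 1, y 2, …`. -/
noncomputable def ofTail (z : E × A) (y : ℕ → Option (ℝ≥0 × E × A)) : JumpPath E A :=
  ofSeq z fun i => y (i + 1)

theorem measurable_ofTail (z : E × A) : Measurable (ofTail z) :=
  measurable_ofSeq.comp (measurable_const.prodMk (measurable_pi_iff.2 fun i =>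
    measurable_pi_apply (i + 1)))

theorem trunc_ofTail {E A : Type*} (z : E × A) (n : ℕ) (y : ℕ → Option (ℝ≥0 × E × A)) :
    trunc n (ofTail z y) = ofHistory z n (Preorder.frestrictLe n y) := by
  rw [ofTail, trunc_ofSeq, ofHistory]
  congr 1

/-- The law on the path space with initial condition `z` and intensity `Γ`. -/
noncomputable def IsBoundedIntensity.law (hΓ : IsBoundedIntensity Γ K) (z : E × A) :
    Measure (JumpPath E A) := (hΓ.seqLaw z).map (ofTail z)

instance (hΓ : IsBoundedIntensity Γ K) (z : E × A) : IsProbabilityMeasure (hΓ.law z) :=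
  Measure.isProbabilityMeasure_map (measurable_ofTail z).aemeasurable

/-- By the Ionescu-Tulcea theorem the coordinates up to `n` and the coordinate `n + 1` have as joint
law the composition product of the marginal with the transition kernel. -/
theorem IsBoundedIntensity.lintegral_seqLaw (hΓ : IsBoundedIntensity Γ K) (z : E × A) (n : ℕ)
    {F : JumpPath E A × Option (ℝ≥0 × E × A) → ℝ≥0∞} (hF : Measurable F) :
    ∫⁻ y, F (trunc n (ofTail z y), y (n + 1)) ∂hΓ.seqLaw z =
      ∫⁻ y, ∫⁻ u, F (trunc n (ofTail z y), u) ∂hΓ.stepLaw n (trunc n (ofTail z y)) ∂hΓ.seqLaw z := by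
  have hkey := Kernel.partialTraj_compProd_eq_map_traj (X := fun _ => Option (ℝ≥0 × E × A))
    (κ := hΓ.transition z) (Nat.zero_le n) (x₀ := fun _ => none)
  have hmarg := Kernel.traj_map_frestrictLe_apply (X := fun _ => Option (ℝ≥0 × E × A))
    (κ := hΓ.transition z) 0 n (fun _ => none)
  have hF' : Measurable fun p : ((i : Finset.Iic n) → Option (ℝ≥0 × E × A)) ×
      Option (ℝ≥0 × E × A) => F (ofHistory z n p.1, p.2) :=
    hF.comp (((measurable_ofHistory z n).comp measurable_fst).prodMk measurable_snd)
  have hpair : Measurable fun x : ℕ → Option (ℝ≥0 × E × A) =>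
      (Preorder.frestrictLe (π := fun _ => Option (ℝ≥0 × E × A)) n x, x (n + 1)) := by fun_prop
  simp_rw [trunc_ofTail]
  have e1 : ∫⁻ y, F (ofHistory z n (Preorder.frestrictLe n y), y (n + 1)) ∂hΓ.seqLaw z =
      ∫⁻ p, F (ofHistory z n p.1, p.2) ∂((hΓ.seqLaw z).map fun x =>
        (Preorder.frestrictLe (π := fun _ => Option (ℝ≥0 × E × A)) n x, x (n + 1))) := by
    rw [lintegral_map hF' hpair]
  rw [e1, IsBoundedIntensity.seqLaw, ← hkey, Measure.lintegral_compProd hF', ← hmarg,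
    lintegral_map _ (by fun_prop)]
  · rfl
  · exact hF'.lintegral_kernel_prod_right'

theorem IsBoundedIntensity.seqLaw_ae (hΓ : IsBoundedIntensity Γ K) (z : E × A) (n : ℕ) :
    ∀ᵐ y ∂hΓ.seqLaw z, (ofTail z y).point n = y (n + 1) := by
  have hm : MeasurableSet {p : JumpPath E A × Option (ℝ≥0 × E × A) |
      ¬ p.1.T n < pointTime p.2 ∧ p.2 ≠ none} :=
    (measurableSet_lt ((measurable_T n).comp measurable_fst)
      (measurable_pointTime.comp measurable_snd)).compl.inter
      (measurable_snd measurableSet_singleton_none.compl)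
  have h := hΓ.lintegral_seqLaw z n (measurable_one.indicator hm)
  have h0 : ∀ ω : JumpPath E A, ∫⁻ u, {p : JumpPath E A × Option (ℝ≥0 × E × A) |
      ¬ p.1.T n < pointTime p.2 ∧ p.2 ≠ none}.indicator 1 (ω, u) ∂hΓ.stepLaw n ω = 0 := fun ω => by
    have hm' : MeasurableSet {y : Option (ℝ≥0 × E × A) | ¬ ω.T n < pointTime y ∧ y ≠ none} :=
      measurable_prodMk_left hm
    rw [← hΓ.stepLaw_ae n ω, ← lintegral_indicator_one hm']
    rfl
  simp only [h0, lintegral_zero] at h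
  have hmeas : Measurable fun y : ℕ → Option (ℝ≥0 × E × A) =>
      {p : JumpPath E A × Option (ℝ≥0 × E × A) | ¬ p.1.T n < pointTime p.2 ∧ p.2 ≠ none}.indicator
        (1 : JumpPath E A × Option (ℝ≥0 × E × A) → ℝ≥0∞) (trunc n (ofTail z y), y (n + 1)) :=
    (measurable_one.indicator hm).comp
      (((measurable_trunc n).comp (measurable_ofTail z)).prodMk (measurable_pi_apply (n + 1)))
  filter_upwards [(lintegral_eq_zero_iff hmeas).1 h] with y hy
  have hy' : ¬ (¬ (ofTail z y).T n < pointTime (y (n + 1)) ∧ y (n + 1) ≠ none) := by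
    intro hmem
    have : (trunc n (ofTail z y), y (n + 1)) ∈ {p : JumpPath E A × Option (ℝ≥0 × E × A) |
      ¬ p.1.T n < pointTime p.2 ∧ p.2 ≠ none} := by
      simpa [trunc_T le_rfl] using hmem
    rw [Set.indicator_of_mem this] at hy
    simp at hy
  by_cases hlt : (ofTail z y).T n < pointTime (y (n + 1))
  · exact ofSeq_point_of_lt hlt
  · have hnone : y (n + 1) = none := by
      by_contra hne
      exact hy' ⟨hlt, hne⟩
    rw [hnone]
    exact ofSeq_point_of_not_lt hlt

theorem IsBoundedIntensity.lintegral_law (hΓ : IsBoundedIntensity Γ K) (z : E × A) (n : ℕ)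
    {F : JumpPath E A × Option (ℝ≥0 × E × A) → ℝ≥0∞} (hF : Measurable F) :
    ∫⁻ ω, F (trunc n ω, ω.point n) ∂hΓ.law z =
      ∫⁻ ω, ∫⁻ u, F (trunc n ω, u) ∂hΓ.stepLaw n (trunc n ω) ∂hΓ.law z := by
  have hFm : Measurable fun ω : JumpPath E A => F (trunc n ω, ω.point n) :=
    hF.comp ((measurable_trunc n).prodMk (measurable_point n))
  rw [IsBoundedIntensity.law, lintegral_map hFm (measurable_ofTail z),
    lintegral_map _ (measurable_ofTail z), ← hΓ.lintegral_seqLaw z n hF]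
  · refine lintegral_congr_ae ?_
    filter_upwards [hΓ.seqLaw_ae z n] with y hy
    rw [hy]
  · exact (hF.lintegral_kernel_prod_right' (κ := hΓ.stepLaw n)).comp (measurable_trunc n)

/-- Given the past `ω` up to `T n`, both sides equal `∫ S(s) ∫ G dΓ(ω, s) ds` over `s > T n`, with
`S` the survival function: on the left `S(s) Γ(ω, s, dz) ds` is the law of the next point, on the
right `S(s)` is the probability that this point has not occurred before `s`. -/
theorem IsBoundedIntensity.stepCompensates_law (hΓ : IsBoundedIntensity Γ K) (z : E × A) (n : ℕ) :
    StepCompensates Γ n (hΓ.law z) := by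
  intro G hG
  have hG1 := hΓ.measurable_lintegral hG
  have hF : Measurable fun p : JumpPath E A × Option (ℝ≥0 × E × A) =>
      p.2.elim 0 fun q => G ((q.1, p.1), q.2) := by
    refine measurable_prod_option (by simp) ?_
    simp only [Option.elim_some]
    exact hG.comp ((measurable_snd.fst.prodMk measurable_fst).prodMk measurable_snd.snd)
  have hset : MeasurableSet {q : (JumpPath E A × Option (ℝ≥0 × E × A)) × ℝ≥0 |
      q.1.1.T n < q.2 ∧ (q.2 : ℝ≥0∞) ≤ pointTime q.1.2} :=
    (measurableSet_lt ((measurable_T n).comp measurable_fst.fst)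
      measurable_snd.coe_nnreal_ennreal).inter (measurableSet_le measurable_snd.coe_nnreal_ennreal
        (measurable_pointTime.comp measurable_fst.snd))
  have hF2u : Measurable fun q : (JumpPath E A × Option (ℝ≥0 × E × A)) × ℝ≥0 =>
      {q : (JumpPath E A × Option (ℝ≥0 × E × A)) × ℝ≥0 |
        q.1.1.T n < q.2 ∧ (q.2 : ℝ≥0∞) ≤ pointTime q.1.2}.indicator
        (fun q => ∫⁻ w, G ((q.2, q.1.1), w) ∂Γ q.1.1 q.2) q :=
    (hG1.comp (measurable_snd.prodMk measurable_fst.fst)).indicator hset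
  have hF2 := hF2u.lintegral_prod_right' (ν := timeMeasure)
  have h1 := hΓ.lintegral_law z n hF
  have h2 := hΓ.lintegral_law z n hF2
  have hl : ∀ ω : JumpPath E A, ∫⁻ u, (u.elim 0 fun q => G ((q.1, ω), q.2)) ∂hΓ.stepLaw n ω =
      ∫⁻ s, stepDensity Γ n ω s * ∫⁻ w, G ((s, ω), w) ∂Γ ω s ∂timeMeasure := fun ω => by
    rw [hΓ.lintegral_stepLaw n ω (f := fun u => u.elim 0 fun q => G ((q.1, ω), q.2))
      (hF.comp measurable_prodMk_left) rfl]
    rfl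
  have hr : ∀ ω : JumpPath E A, ∫⁻ u, ∫⁻ s, {q : (JumpPath E A × Option (ℝ≥0 × E × A)) × ℝ≥0 |
        q.1.1.T n < q.2 ∧ (q.2 : ℝ≥0∞) ≤ pointTime q.1.2}.indicator
        (fun q => ∫⁻ w, G ((q.2, q.1.1), w) ∂Γ q.1.1 q.2) ((ω, u), s) ∂timeMeasure
        ∂hΓ.stepLaw n ω =
      ∫⁻ s, stepDensity Γ n ω s * ∫⁻ w, G ((s, ω), w) ∂Γ ω s ∂timeMeasure := fun ω => by
    rw [lintegral_lintegral_swap]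
    · refine lintegral_congr fun s => ?_
      have hms : MeasurableSet {y : Option (ℝ≥0 × E × A) | (s : ℝ≥0∞) ≤ pointTime y} :=
        measurableSet_le measurable_const measurable_pointTime
      by_cases hs : ω.T n < s
      · have : ∀ u : Option (ℝ≥0 × E × A), {q : (JumpPath E A × Option (ℝ≥0 × E × A)) × ℝ≥0 |
            q.1.1.T n < q.2 ∧ (q.2 : ℝ≥0∞) ≤ pointTime q.1.2}.indicator
            (fun q => ∫⁻ w, G ((q.2, q.1.1), w) ∂Γ q.1.1 q.2) ((ω, u), s) =
            {y : Option (ℝ≥0 × E × A) | (s : ℝ≥0∞) ≤ pointTime y}.indicator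
              (fun _ => ∫⁻ w, G ((s, ω), w) ∂Γ ω s) u := fun u => by
          simp [Set.indicator, hs]
        rw [lintegral_congr this, lintegral_indicator_const hms, hΓ.stepLaw_le_pointTime, mul_comm]
        simp [stepDensity, Set.indicator, hs]
      · simp [stepDensity, Set.indicator, hs]
    · exact (hF2u.comp ((measurable_const.prodMk measurable_fst).prodMk
        measurable_snd)).aemeasurable
  simp_rw [hl] at h1
  simp_rw [hr] at h2
  rw [h1, ← h2]
  refine lintegral_congr fun ω => lintegral_congr fun s => ?_
  have hiff : ((trunc n ω, ω.point n), s) ∈ {q : (JumpPath E A × Option (ℝ≥0 × E × A)) × ℝ≥0 |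
      q.1.1.T n < q.2 ∧ (q.2 : ℝ≥0∞) ≤ pointTime q.1.2} ↔ (s, ω) ∈ stochInterval E A n := by
    simp only [Set.mem_ofPred_eq, trunc_T le_rfl]
    exact Iff.rfl
  by_cases h : (s, ω) ∈ stochInterval E A n
  · rw [Set.indicator_of_mem h, Set.indicator_of_mem (hiff.2 h)]
  · rw [Set.indicator_of_notMem h, Set.indicator_of_notMem fun h' => h (hiff.1 h')]

theorem IsBoundedIntensity.map_init_law (hΓ : IsBoundedIntensity Γ K) (z : E × A) :
    (hΓ.law z).map (fun ω => ω.init) = Measure.dirac z := by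
  rw [IsBoundedIntensity.law, Measure.map_map measurable_init (measurable_ofTail z)]
  have : (fun ω : JumpPath E A => ω.init) ∘ ofTail z = fun _ => z := rfl
  rw [this, Measure.map_const]
  simp

theorem IsBoundedIntensity.existsUnique (hΓ : IsBoundedIntensity Γ K) (z : E × A) :
    ∃! P : Measure (JumpPath E A), IsProbabilityMeasure P ∧
      P.map (fun ω => ω.init) = Measure.dirac z ∧ Compensates Γ P := by
  refine ⟨hΓ.law z, ⟨inferInstance, hΓ.map_init_law z,
    compensates_of_step hΓ (hΓ.stepCompensates_law z)⟩, ?_⟩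
  rintro P ⟨hP, h0, hc⟩
  exact hc.unique hΓ (compensates_of_step hΓ (hΓ.stepCompensates_law z))
    (h0.trans (hΓ.map_init_law z).symm)

end JumpPath

namespace PDMPData

/-! ### The flow -/

variable {d : ℕ} {E : Set (EuclideanSpace ℝ (Fin d))} {A : Type*} [MeasurableSpace A]
  {D : PDMPData E A}

theorem IsTrajectory.hasDerivWithinAt_Ici {x : E} {a : A} {γ : ℝ → E}
    (h : D.IsTrajectory x a γ) {t : ℝ} (ht : 0 ≤ t) :
    HasDerivWithinAt (fun s => (γ s : EuclideanSpace ℝ (Fin d))) (D.h (γ t, a)) (Set.Ici t) t :=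
  (h.2 t ht).mono (Set.Ici_subset_Ici.2 ht)

theorem IsTrajectory.continuousOn {x : E} {a : A} {γ : ℝ → E} (h : D.IsTrajectory x a γ) :
    ContinuousOn (fun s => (γ s : EuclideanSpace ℝ (Fin d))) (Set.Ici 0) :=
  fun t ht => (h.2 t ht).continuousWithinAt

/-- The flow on `E × A`, with the action kept constant. -/
noncomputable def flowPair (D : PDMPData E A) (t : ℝ) (z : E × A) : E × A := (D.flow t z.1 z.2, z.2)

variable [MetricSpace A]

theorem DynamicsHyp.exists_lipschitz (hdyn : D.DynamicsHyp) :
    ∃ L : ℝ≥0, 1 ≤ L ∧ ∀ (x x' : E) (a a' : A),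
      ‖D.h (x, a) - D.h (x', a')‖ ≤ L * (dist x x' + dist a a') := by
  obtain ⟨L, hL⟩ := hdyn.lipschitz
  refine ⟨(max L 1).toNNReal, ?_, fun x x' a a' => (hL x x' a a').trans ?_⟩
  · rw [← Real.toNNReal_one]
    exact Real.toNNReal_mono (le_max_right _ _)
  · rw [Real.coe_toNNReal _ (zero_le_one.trans (le_max_right _ _))]
    gcongr
    exact le_max_left _ _

theorem DynamicsHyp.isTrajectory_flow (hdyn : D.DynamicsHyp) (x : E) (a : A) :
    D.IsTrajectory x a (fun t => D.flow t x a) := by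
  have H := hdyn.flow_exists x a
  have : (fun t => D.flow t x a) = H.choose := by
    ext1 t
    rw [flow, dif_pos H]
  rw [this]
  exact H.choose_spec

/-- Grönwall's inequality: a trajectory with action `a'` is an approximate trajectory for the field
with action `a`, with error at most `L * dist a a'`. The assumption `1 ≤ L` keeps away from the
degenerate case `L = 0` of the bound. -/
theorem IsTrajectory.dist_le {L : ℝ≥0} (hL1 : 1 ≤ L)
    (hL : ∀ (x x' : E) (a a' : A), ‖D.h (x, a) - D.h (x', a')‖ ≤ L * (dist x x' + dist a a'))
    {x x' : E} {a a' : A} {γ γ' : ℝ → E} (h : D.IsTrajectory x a γ) (h' : D.IsTrajectory x' a' γ')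
    {t : ℝ} (ht : 0 ≤ t) :
    dist (γ t) (γ' t) ≤ (dist x x' + dist a a') * Real.exp (L * t) := by
  classical
  let v : ℝ → EuclideanSpace ℝ (Fin d) → EuclideanSpace ℝ (Fin d) :=
    -- The extension by zero may be discontinuous, but the Lipschitz condition is only needed on
    -- `E`, where both trajectories stay.
    fun _ y => if hy : y ∈ E then D.h (⟨y, hy⟩, a) else 0
  have hv : ∀ (s : ℝ) (y : E), v s y = D.h (y, a) := fun s y => by simp [v]
  have hlip : ∀ s ∈ Set.Ico 0 t, LipschitzOnWith L (v s) E := fun s _ =>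
    LipschitzOnWith.of_dist_le_mul fun y hy y' hy' => by
      have := hL ⟨y, hy⟩ ⟨y', hy'⟩ a a
      rw [dist_self, add_zero] at this
      rw [dist_eq_norm, hv s ⟨y, hy⟩, hv s ⟨y', hy'⟩]
      exact this
  have key := dist_le_of_approx_trajectories_ODE_of_mem (v := v) (s := fun _ => E) (K := L)
    (f := fun s => (γ s : EuclideanSpace ℝ (Fin d))) (f' := fun s => D.h (γ s, a))
    (g := fun s => (γ' s : EuclideanSpace ℝ (Fin d))) (g' := fun s => D.h (γ' s, a'))
    (a := 0) (b := t) (εf := 0) (εg := L * dist a a') (δ := dist x x') hlip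
    (h.continuousOn.mono Set.Icc_subset_Ici_self) (fun s hs => h.hasDerivWithinAt_Ici hs.1)
    (fun s _ => by rw [hv s (γ s), dist_self]) (fun s _ => (γ s).2)
    (h'.continuousOn.mono Set.Icc_subset_Ici_self) (fun s hs => h'.hasDerivWithinAt_Ici hs.1)
    (fun s _ => by
      rw [hv s (γ' s), dist_eq_norm]
      refine (hL (γ' s) (γ' s) a' a).trans ?_
      rw [dist_self, zero_add, dist_comm])
    (fun s _ => (γ' s).2) (by rw [h.1, h'.1]; rfl) t (Set.right_mem_Icc.2 ht)
  refine key.trans ?_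
  have hL0 : (L : ℝ) ≠ 0 := (zero_lt_one.trans_le (by exact_mod_cast hL1)).ne'
  rw [gronwallBound_of_K_ne_0 hL0, zero_add, sub_zero, mul_div_cancel_left₀ _ hL0]
  have := dist_nonneg (x := a) (y := a')
  nlinarith [Real.exp_pos (L * t)]

theorem DynamicsHyp.flow_eq_of_isTrajectory (hdyn : D.DynamicsHyp) {x : E} {a : A} {γ : ℝ → E}
    (h : D.IsTrajectory x a γ) {t : ℝ} (ht : 0 ≤ t) : D.flow t x a = γ t := by
  obtain ⟨L, hL1, hL⟩ := hdyn.exists_lipschitz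
  have := (hdyn.isTrajectory_flow x a).dist_le hL1 hL h ht
  simp only [dist_self, add_zero, zero_mul] at this
  exact dist_le_zero.1 this

theorem DynamicsHyp.flow_zero (hdyn : D.DynamicsHyp) (x : E) (a : A) : D.flow 0 x a = x :=
  (hdyn.isTrajectory_flow x a).1

theorem DynamicsHyp.flow_add (hdyn : D.DynamicsHyp) {s t : ℝ} (hs : 0 ≤ s) (ht : 0 ≤ t) (x : E)
    (a : A) : D.flow s (D.flow t x a) a = D.flow (t + s) x a := by
  refine hdyn.flow_eq_of_isTrajectory (γ := fun s => D.flow (t + s) x a) ⟨by simp, fun r hr => ?_⟩ hs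
  have h1 := (hdyn.isTrajectory_flow x a).2 (t + r) (add_nonneg ht hr)
  have h2 : HasDerivWithinAt (fun r : ℝ => t + r) 1 (Set.Ici 0) r :=
    ((hasDerivAt_id r).const_add t).hasDerivWithinAt
  have := h1.scomp r h2 (fun u hu => add_nonneg ht hu)
  simpa [Function.comp_def] using this

theorem DynamicsHyp.dist_flow_self_le (hdyn : D.DynamicsHyp) :
    ∃ M : ℝ, 0 ≤ M ∧ ∀ (x : E) (a : A) (s t : ℝ), 0 ≤ s → 0 ≤ t →
      dist (D.flow s x a) (D.flow t x a) ≤ M * dist s t := by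
  obtain ⟨M, hM⟩ := hdyn.bounded
  refine ⟨max M 0, le_max_right _ _, fun x a s t hs ht => ?_⟩
  have h := hdyn.isTrajectory_flow x a
  have := (convex_Ici (0 : ℝ)).norm_image_sub_le_of_norm_hasDerivWithin_le
    (f := fun s => (D.flow s x a : EuclideanSpace ℝ (Fin d))) (f' := fun s => D.h (D.flow s x a, a))
    (C := max M 0) (fun r hr => h.2 r hr) (fun r _ => (hM _).trans (le_max_left _ _)) ht hs
  rwa [Subtype.dist_eq, dist_eq_norm, dist_eq_norm]

theorem DynamicsHyp.continuous_flow (hdyn : D.DynamicsHyp) :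
    Continuous fun p : ℝ≥0 × (E × A) => D.flow p.1 p.2.1 p.2.2 := by
  obtain ⟨L, hL1, hL⟩ := hdyn.exists_lipschitz
  obtain ⟨M, hM0, hM⟩ := hdyn.dist_flow_self_le
  refine continuous_iff_continuousAt.2 fun p₀ => ?_
  have hb : ∀ p : ℝ≥0 × (E × A), dist (D.flow p.1 p.2.1 p.2.2) (D.flow p₀.1 p₀.2.1 p₀.2.2) ≤
      (dist p.2.1 p₀.2.1 + dist p.2.2 p₀.2.2) * Real.exp (L * p.1) +
        M * dist (p.1 : ℝ) (p₀.1 : ℝ) := fun p => by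
    refine (dist_triangle _ (D.flow p.1 p₀.2.1 p₀.2.2) _).trans (add_le_add ?_ ?_)
    · exact (hdyn.isTrajectory_flow _ _).dist_le hL1 hL (hdyn.isTrajectory_flow _ _)
        p.1.coe_nonneg
    · exact hM _ _ _ _ p.1.coe_nonneg p₀.1.coe_nonneg
  have hlim : Tendsto (fun p : ℝ≥0 × (E × A) =>
      (dist p.2.1 p₀.2.1 + dist p.2.2 p₀.2.2) * Real.exp (L * p.1) +
        M * dist (p.1 : ℝ) (p₀.1 : ℝ)) (𝓝 p₀) (𝓝 0) := by
    have hc : Continuous fun p : ℝ≥0 × (E × A) =>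
      (dist p.2.1 p₀.2.1 + dist p.2.2 p₀.2.2) * Real.exp (L * p.1) +
        M * dist (p.1 : ℝ) (p₀.1 : ℝ) := by fun_prop
    have := hc.tendsto p₀
    simpa using this
  exact tendsto_iff_dist_tendsto_zero.2 (squeeze_zero (fun _ => dist_nonneg) hb hlim)

theorem DynamicsHyp.continuous_flowPair (hdyn : D.DynamicsHyp) :
    Continuous fun p : ℝ≥0 × (E × A) => D.flowPair p.1 p.2 :=
  hdyn.continuous_flow.prodMk continuous_snd.snd

theorem DynamicsHyp.flowPair_zero (hdyn : D.DynamicsHyp) (z : E × A) : D.flowPair 0 z = z := by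
  simp [flowPair, hdyn.flow_zero]

theorem DynamicsHyp.flowPair_add (hdyn : D.DynamicsHyp) {s t : ℝ} (hs : 0 ≤ s) (ht : 0 ≤ t)
    (z : E × A) : D.flowPair s (D.flowPair t z) = D.flowPair (t + s) z := by
  simp [flowPair, hdyn.flow_add hs ht]

end PDMPData

namespace PDMPData

/-! ### The intensity of the controlled process -/

variable {d : ℕ} {E : Set (EuclideanSpace ℝ (Fin d))} {A : Type*} [MeasurableSpace A]
  {D : PDMPData E A}

open JumpPath

theorem stateLeft_of_mem (D : PDMPData E A) {p : ℝ≥0 × JumpPath E A} {n : ℕ}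
    (hp : p ∈ stochInterval E A n) :
    p.2.stateLeft D.flow p.1 =
      (p.2.mark n).map (D.flowPair (p.1 - (p.2.T n).toNNReal : ℝ≥0)) := by
  rw [stateLeft_eq D.flow p.2 hp.1 hp.2]
  have : (((p.1 - (p.2.T n).toNNReal : ℝ≥0)) : ℝ) = p.1 - (p.2.T n).toReal :=
    NNReal.coe_sub (ENNReal.toNNReal_mono ENNReal.coe_ne_top hp.1.le)
  rw [this]
  rfl

theorem stateLeft_of_notMem (D : PDMPData E A) {p : ℝ≥0 × JumpPath E A}
    (hp : ∀ n, p ∉ stochInterval E A n) : p.2.stateLeft D.flow p.1 = none :=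
  dif_neg fun ⟨n, hn⟩ => hp n hn

theorem exists_stateLeft (D : PDMPData E A) {p : ℝ≥0 × JumpPath E A} {n : ℕ}
    (hp : p ∈ stochInterval E A n) : ∃ z, p.2.mark n = some z ∧
      p.2.stateLeft D.flow p.1 = some (D.flowPair (p.1 - (p.2.T n).toNNReal : ℝ≥0) z) := by
  obtain ⟨z, hz⟩ := p.2.exists_mark (hp.1.trans_le le_top)
  exact ⟨z, hz, by rw [stateLeft_of_mem D hp, hz]; rfl⟩

/-- The intensity as a function of the control at a given time and of the state. -/
theorem measurable_intensity_some {γ : Type*} [MeasurableSpace γ] (D : PDMPData E A)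
    [SFinite D.lam0] [IsSFiniteKernel D.Q] (hrate : Measurable D.rate) {w : γ × A → ℝ}
    (hw : Measurable w) :
    Measurable fun p : γ × (E × A) =>
      (D.lam0.withDensity fun b => ENNReal.ofReal (w (p.1, b))).map (fun b => (p.2.1, b)) +
      ENNReal.ofReal (D.rate p.2) • (D.Q p.2).map (fun y => (y, p.2.2)) := by
  refine Measure.measurable_of_measurable_coe _ fun B hB => ?_
  have h1 : Measurable fun p : γ × (E × A) => ∫⁻ b, {q : (γ × (E × A)) × A | (q.1.2.1, q.2) ∈ B}.indicator
      (fun q => ENNReal.ofReal (w (q.1.1, q.2))) (p, b) ∂D.lam0 := by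
    refine Measurable.lintegral_prod_right' ?_
    refine Measurable.indicator ?_ ?_
    · exact (hw.comp (by fun_prop)).ennreal_ofReal
    · exact (by fun_prop : Measurable fun q : (γ × (E × A)) × A => (q.1.2.1, q.2)) hB
  have h2 : Measurable fun z : E × A => D.Q z (Prod.mk z ⁻¹' {q : (E × A) × E | (q.2, q.1.2) ∈ B}) :=
    Kernel.measurable_kernel_prodMk_left
      ((by fun_prop : Measurable fun q : (E × A) × E => (q.2, q.1.2)) hB)
  convert h1.add ((hrate.ennreal_ofReal.mul h2).comp measurable_snd) using 2 with p
  simp only [Measure.add_apply, Measure.smul_apply, smul_eq_mul]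
  rw [Measure.map_apply (by fun_prop) hB, Measure.map_apply (by fun_prop) hB,
    withDensity_apply _ ((by fun_prop : Measurable fun b : A => (p.2.1, b)) hB),
    ← lintegral_indicator ((by fun_prop : Measurable fun b : A => (p.2.1, b)) hB)]
  rfl

theorem intensity_some (D : PDMPData E A) {ν : JumpPath E A → ℝ≥0 → A → ℝ} {ω : JumpPath E A}
    {s : ℝ≥0} {z : E × A} (h : ω.stateLeft D.flow s = some z) :
    D.intensity ν ω s = (D.lam0.withDensity fun b => ENNReal.ofReal (ν ω s b)).map
        (fun b => (z.1, b)) + ENNReal.ofReal (D.rate z) • (D.Q z).map (fun y => (y, z.2)) := by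
  rw [intensity, h]
  rfl

theorem intensity_none (D : PDMPData E A) {ν : JumpPath E A → ℝ≥0 → A → ℝ} {ω : JumpPath E A}
    {s : ℝ≥0} (h : ω.stateLeft D.flow s = none) : D.intensity ν ω s = 0 := by
  rw [intensity, h]
  rfl

theorem lintegral_intensity (D : PDMPData E A) {ν : JumpPath E A → ℝ≥0 → A → ℝ}
    {ω : JumpPath E A} {s : ℝ≥0} {z : E × A} (h : ω.stateLeft D.flow s = some z)
    (hν : Measurable (ν ω s)) {F : E × A → ℝ≥0∞} (hF : Measurable F) :
    ∫⁻ y, F y ∂D.intensity ν ω s = ∫⁻ b, ENNReal.ofReal (ν ω s b) * F (z.1, b) ∂D.lam0 +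
      ENNReal.ofReal (D.rate z) * ∫⁻ y, F (y, z.2) ∂D.Q z := by
  rw [intensity_some D h, lintegral_add_measure, lintegral_smul_measure,
    lintegral_map hF (by fun_prop), lintegral_map hF (by fun_prop),
    lintegral_withDensity_eq_lintegral_mul _ hν.ennreal_ofReal
      (by fun_prop : Measurable fun b => F (z.1, b))]
  rfl

theorem intensity_univ (D : PDMPData E A) [IsMarkovKernel D.Q] {ν : JumpPath E A → ℝ≥0 → A → ℝ}
    {ω : JumpPath E A} {s : ℝ≥0} {z : E × A} (h : ω.stateLeft D.flow s = some z)
    (hν : Measurable (ν ω s)) :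
    D.intensity ν ω s Set.univ =
      ∫⁻ b, ENNReal.ofReal (ν ω s b) ∂D.lam0 + ENNReal.ofReal (D.rate z) := by
  have := lintegral_intensity D h hν (F := fun _ => 1) measurable_const
  simpa using this

theorem measurable_control {ν : JumpPath E A → ℝ≥0 → A → ℝ} (hν : ν ∈ controls E A)
    (ω : JumpPath E A) (s : ℝ≥0) : Measurable (ν ω s) :=
  (measurable_prod_of_predictable hν.2.2).comp (measurable_prodMk_left (x := (s, ω)))

theorem isDualLaw_iff {ν : JumpPath E A → ℝ≥0 → A → ℝ} {x : E} {a : A}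
    {P : Measure (JumpPath E A)} : D.IsDualLaw x a ν P ↔ IsProbabilityMeasure P ∧
      P.map (fun ω => ω.init) = Measure.dirac (x, a) ∧ Compensates (D.intensity ν) P :=
  ⟨fun h => ⟨h.1, h.2, h.3⟩, fun h => ⟨h.1, h.2.1, h.2.2⟩⟩

variable [MetricSpace A] [SecondCountableTopology A] [BorelSpace A]

theorem DynamicsHyp.measurable_flowPair (hdyn : D.DynamicsHyp) :
    Measurable fun p : ℝ≥0 × (E × A) => D.flowPair p.1 p.2 :=
  hdyn.continuous_flowPair.measurable

/-- On each stochastic interval the left limit is a measurable function of the time and of the path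
up to `T n`. Outside all of them it is `none`. -/
theorem DynamicsHyp.measurable_stateLeft (hdyn : D.DynamicsHyp) :
    Measurable[predictableSigma E A] fun p : ℝ≥0 × JumpPath E A =>
      p.2.stateLeft D.flow p.1 := by
  let g (n : ℕ) (p : ℝ≥0 × JumpPath E A) : Option (E × A) :=
    (p.2.mark n).map (D.flowPair (p.1 - (p.2.T n).toNNReal : ℝ≥0))
  have hg (n : ℕ) : Measurable (g n) := by
    have h1 : Measurable fun q : ℝ≥0 × Option (E × A) => q.2.map (D.flowPair (q.1 : ℝ)) :=
      measurable_prod_option measurable_const (measurable_some.comp hdyn.measurable_flowPair)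
    have h2 : Measurable fun p : ℝ≥0 × JumpPath E A =>
        (p.1 - (p.2.T n).toNNReal, p.2.mark n) :=
      (measurable_fst.sub ((measurable_T n).comp measurable_snd).ennreal_toNNReal).prodMk
        ((measurable_mark n).comp measurable_snd)
    exact h1.comp h2
  let _ := predictableSigma E A
  refine measurable_option_of_image fun B hB => ?_
  have : (fun p : ℝ≥0 × JumpPath E A => p.2.stateLeft D.flow p.1) ⁻¹' (some '' B) =
      ⋃ n, stochInterval E A n ∩ {p | (p.1, trunc n p.2) ∈ g n ⁻¹' (some '' B)} := by
    ext p
    have hgt : ∀ n, g n (p.1, trunc n p.2) = g n p := fun n => by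
      simp only [g, trunc_T le_rfl, trunc_mark le_rfl]
    simp only [Set.mem_preimage, Set.mem_iUnion, Set.mem_inter_iff, Set.mem_ofPred_eq, hgt]
    constructor
    · intro h
      by_cases hp : ∃ n, p ∈ stochInterval E A n
      · obtain ⟨n, hn⟩ := hp
        refine ⟨n, hn, ?_⟩
        rwa [stateLeft_of_mem D hn] at h
      · rw [stateLeft_of_notMem D (not_exists.1 hp)] at h
        simp at h
    · rintro ⟨n, hn, h⟩
      rwa [stateLeft_of_mem D hn]
  rw [this]
  exact MeasurableSet.iUnion fun n =>
    measurableSet_predictable_trunc_stochInterval n (hg n (measurableSet_image_some hB))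

theorem DynamicsHyp.measurable_rate (hdyn : D.DynamicsHyp) : Measurable D.rate :=
  hdyn.rate_unifCont.continuous.measurable

theorem measurable_intensity (hdyn : D.DynamicsHyp) (hlam0 : D.ActionMeasureHyp)
    {ν : JumpPath E A → ℝ≥0 → A → ℝ} (hν : ν ∈ controls E A) :
    Measurable[predictableSigma E A] fun p : ℝ≥0 × JumpPath E A => D.intensity ν p.2 p.1 := by
  have := hlam0.finite
  have := hdyn.markov
  have hs := hdyn.measurable_stateLeft
  have hν' := hν.2.2
  let _ := predictableSigma E A
  have h1 := measurable_intensity_some D hdyn.measurable_rate hν'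
  have h2 : Measurable fun p : (ℝ≥0 × JumpPath E A) × Option (E × A) =>
      p.2.elim (0 : Measure (E × A)) fun z =>
        (D.lam0.withDensity fun b => ENNReal.ofReal (ν p.1.2 p.1.1 b)).map (fun b => (z.1, b)) +
        ENNReal.ofReal (D.rate z) • (D.Q z).map (fun y => (y, z.2)) :=
    measurable_prod_option measurable_const h1
  exact h2.comp (measurable_id.prodMk hs)

theorem isBoundedIntensity (hdyn : D.DynamicsHyp) (hlam0 : D.ActionMeasureHyp)
    {ν : JumpPath E A → ℝ≥0 → A → ℝ} (hν : ν ∈ controls E A) :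
    ∃ K : ℝ≥0, IsBoundedIntensity (D.intensity ν) K := by
  have := hlam0.finite
  have := hdyn.markov
  obtain ⟨C, hC⟩ := hν.2.1
  obtain ⟨M, hM⟩ := hdyn.rate_bounded
  refine ⟨C.toNNReal * (D.lam0 Set.univ).toNNReal + M.toNNReal,
    measurable_intensity hdyn hlam0 hν, fun ω s => ?_, fun ω s h => ?_⟩
  · cases h : ω.stateLeft D.flow s with
    | none => simp [intensity_none D h]
    | some z =>
      rw [intensity_univ D h (measurable_control hν ω s)]
      push_cast
      rw [ENNReal.coe_toNNReal (measure_ne_top _ _)]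
      refine add_le_add ?_ (ENNReal.ofReal_le_ofReal (hM z))
      refine (lintegral_mono fun b => ENNReal.ofReal_le_ofReal (hC ω s b)).trans ?_
      rw [lintegral_const]
      rfl
  · exact intensity_none D (stateLeft_of_notMem D h)

theorem existsUnique_isDualLaw (hdyn : D.DynamicsHyp)
    (hlam0 : D.ActionMeasureHyp) {ν : JumpPath E A → ℝ≥0 → A → ℝ} (hν : ν ∈ controls E A)
    (x : E) (a : A) : ∃! P, D.IsDualLaw x a ν P := by
  obtain ⟨K, hK⟩ := isBoundedIntensity hdyn hlam0 hν
  simp only [isDualLaw_iff]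
  exact hK.existsUnique (x, a)

theorem isDualLaw_dualLaw (hdyn : D.DynamicsHyp)
    (hlam0 : D.ActionMeasureHyp) {ν : JumpPath E A → ℝ≥0 → A → ℝ} (hν : ν ∈ controls E A)
    (x : E) (a : A) : D.IsDualLaw x a ν (D.dualLaw x a ν) := by
  have H := (existsUnique_isDualLaw hdyn hlam0 hν x a).exists
  rw [dualLaw, dif_pos H]
  exact H.choose_spec

end PDMPData

set_option linter.unusedSectionVars false

namespace PDMPData

/-! ### The semilinear resolvent equation -/

variable {d : ℕ} {E : Set (EuclideanSpace ℝ (Fin d))} {A : Type*} [MeasurableSpace A]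
  [MetricSpace A] [SecondCountableTopology A] [BorelSpace A] {D : PDMPData E A}

theorem integrable_of_bounded {α : Type*} [MeasurableSpace α] [TopologicalSpace α]
    [OpensMeasurableSpace α] {μ : Measure α} [IsFiniteMeasure μ] {g : α → ℝ} (hg : Continuous g)
    {c : ℝ} (hc : ∀ y, ‖g y‖ ≤ c) : Integrable g μ :=
  Integrable.of_bound hg.measurable.aestronglyMeasurable c (.of_forall hc)

/-- The Feller property covers integrands that do not depend on the action. For a bounded Lipschitz
integrand, freezing the action costs at most `L * dist z.2 z₀.2`; bounded Lipschitz functions detect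
weak convergence, which then handles every bounded continuous `V`. -/
theorem DynamicsHyp.continuous_integral_kernel (hdyn : D.DynamicsHyp) (V : (E × A) →ᵇ ℝ) :
    Continuous fun z : E × A => ∫ y, V (y, z.2) ∂D.Q z := by
  have := hdyn.markov
  let μ (z : E × A) : ProbabilityMeasure (E × A) :=
    ⟨(D.Q z).map (fun y => (y, z.2)), Measure.isProbabilityMeasure_map (by fun_prop)⟩
  have hμ (z : E × A) (f : E × A → ℝ) (hf : Continuous f) :
      ∫ y, f y ∂(μ z : Measure (E × A)) = ∫ y, f (y, z.2) ∂D.Q z :=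
    integral_map (by fun_prop) hf.measurable.aestronglyMeasurable
  refine continuous_iff_continuousAt.2 fun z₀ => ?_
  have hlim : Tendsto μ (𝓝 z₀) (𝓝 (μ z₀)) := by
    refine tendsto_iff_forall_lipschitz_integral_tendsto.2 fun f ⟨c, hc⟩ ⟨L, hL⟩ => ?_
    simp only [hμ _ f hL.continuous]
    let v (a : A) : E →ᵇ ℝ := BoundedContinuousFunction.mkOfBound
      ⟨fun y => f (y, a), hL.continuous.comp (by fun_prop)⟩ c fun y y' => hc _ _
    have h1 : Tendsto (fun z => ∫ y, v z₀.2 y ∂D.Q z) (𝓝 z₀) (𝓝 (∫ y, v z₀.2 y ∂D.Q z₀)) :=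
      (hdyn.feller (v z₀.2)).tendsto z₀
    have h2 : Tendsto (fun z => ∫ y, v z.2 y ∂D.Q z - ∫ y, v z₀.2 y ∂D.Q z) (𝓝 z₀) (𝓝 0) := by
      have hb : ∀ z : E × A, ‖∫ y, v z.2 y ∂D.Q z - ∫ y, v z₀.2 y ∂D.Q z‖ ≤ L * dist z.2 z₀.2 := by
        intro z
        rw [← integral_sub ((v z.2).integrable _) ((v z₀.2).integrable _)]
        refine (norm_integral_le_of_norm_le_const (C := L * dist z.2 z₀.2)
          (.of_forall fun y => ?_)).trans (by simp)
        have := hL.dist_le_mul (y, z.2) (y, z₀.2)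
        rw [Prod.dist_eq, dist_self, max_eq_right dist_nonneg, dist_eq_norm] at this
        exact this
      refine squeeze_zero_norm hb ?_
      have : Continuous fun z : E × A => (L : ℝ) * dist z.2 z₀.2 := by fun_prop
      simpa using this.tendsto z₀
    have := h2.add h1
    simp only [sub_add_cancel, zero_add] at this
    exact this
  have := ProbabilityMeasure.tendsto_iff_forall_integral_tendsto.1 hlim V
  simp only [hμ _ V V.continuous] at this
  exact this

/-- The drift towards lower values with weight `C (1 - θ)` and towards higher ones with weight
`C θ`. -/
noncomputable def tilt (C θ u : ℝ) : ℝ := C * (1 - θ) * min u 0 + C * θ * max u 0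

theorem continuous_tilt (C θ : ℝ) : Continuous (tilt C θ) := by
  unfold tilt; fun_prop

/-- The function is nondecreasing and piecewise linear with slopes `C (1 - θ)` and `C θ`, both in
`[0, C]`. -/
theorem tilt_le {C θ u u' : ℝ} (hC : 0 ≤ C) (hθ : θ ∈ Set.Icc (0 : ℝ) 1) {m : ℝ} (hm : 0 ≤ m)
    (h : u ≤ u' + m) : tilt C θ u ≤ tilt C θ u' + C * m := by
  have h1 : u ≤ u' + m → min u 0 ≤ min (u' + m) 0 := fun h => min_le_min_right _ h
  have h2 : max u 0 ≤ max (u' + m) 0 := max_le_max_right _ h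
  have ha : 0 ≤ C * (1 - θ) := mul_nonneg hC (by linarith [hθ.2])
  have hb : 0 ≤ C * θ := mul_nonneg hC hθ.1
  have h3 : min (u' + m) 0 ≤ min u' 0 + m := by
    rcases le_total u' 0 with h | h
    · rw [min_eq_left h]; exact min_le_left _ _
    · rw [min_eq_right h, zero_add]; exact (min_le_right _ _).trans hm
  have h4 : max (u' + m) 0 ≤ max u' 0 + m :=
    max_le (by linarith [le_max_left u' 0]) (by linarith [le_max_right u' 0])
  have h5 := mul_le_mul_of_nonneg_left ((h1 h).trans h3) ha
  have h6 := mul_le_mul_of_nonneg_left (h2.trans h4) hb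
  unfold tilt
  linarith

theorem abs_tilt_le {C θ u : ℝ} (hC : 0 ≤ C) (hθ : θ ∈ Set.Icc (0 : ℝ) 1) :
    |tilt C θ u| ≤ C * |u| := by
  have h0 : tilt C θ 0 = 0 := by simp [tilt]
  rw [abs_le]
  constructor
  · have := tilt_le hC hθ (abs_nonneg u) (u := 0) (u' := u) (by linarith [neg_abs_le u])
    linarith
  · have := tilt_le hC hθ (abs_nonneg u) (u := u) (u' := 0) (by linarith [le_abs_self u])
    linarith

theorem abs_tilt_sub_le {C θ θ' u : ℝ} (hC : 0 ≤ C) :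
    |tilt C θ u - tilt C θ' u| ≤ C * |θ - θ'| * |u| := by
  have : tilt C θ u - tilt C θ' u = C * (θ - θ') * (max u 0 - min u 0) := by unfold tilt; ring
  rw [this, max_sub_min_eq_abs, zero_sub, abs_neg, abs_mul, abs_mul, abs_abs, abs_of_nonneg hC]

/-- The nonlinear nonlocal operator
`λ Q V + (K - λ) V + ∫ ψ_θ(V(x,b) - V(x,a)) λ₀(db)`. -/
noncomputable def nonlocal (D : PDMPData E A) (C K θ : ℝ) (V : E × A → ℝ) (z : E × A) : ℝ :=
  D.rate z * ∫ y, V (y, z.2) ∂D.Q z + (K - D.rate z) * V z +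
    ∫ b, tilt C θ (V (z.1, b) - V z) ∂D.lam0

theorem integrable_tilt (hlam0 : D.ActionMeasureHyp) {C θ : ℝ} (hC : 0 ≤ C)
    (hθ : θ ∈ Set.Icc (0 : ℝ) 1) (V : (E × A) →ᵇ ℝ) (z : E × A) :
    Integrable (fun b => tilt C θ (V (z.1, b) - V z)) D.lam0 := by
  have := hlam0.finite
  refine integrable_of_bounded (c := C * (‖V‖ + ‖V‖)) ?_ fun b => ?_
  · exact (continuous_tilt C θ).comp (by fun_prop)
  · refine (abs_tilt_le hC hθ).trans (mul_le_mul_of_nonneg_left ?_ hC)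
    exact (abs_sub _ _).trans (add_le_add (V.norm_coe_le_norm _) (V.norm_coe_le_norm _))

/-- A larger value at `z` itself lowers the jump terms at rate at most `C λ₀(A) + λ(z)`, and the
summand `K V z` outweighs this. Hence the operator is monotone, and adding a constant `m ≥ 0` raises
it by at most `K m`. -/
theorem nonlocal_le (hdyn : D.DynamicsHyp) (hlam0 : D.ActionMeasureHyp) {C K θ : ℝ} (hC : 0 ≤ C)
    (hK : ∀ z, C * D.lam0.real Set.univ + D.rate z ≤ K) (hθ : θ ∈ Set.Icc (0 : ℝ) 1)
    (V W : (E × A) →ᵇ ℝ) {m : ℝ} (h : ∀ z, V z ≤ W z + m) (z : E × A) :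
    D.nonlocal C K θ V z ≤ D.nonlocal C K θ W z + K * m := by
  have := hlam0.finite
  have := hdyn.markov
  have hV : ∀ (V : (E × A) →ᵇ ℝ), Integrable (fun y => V (y, z.2)) (D.Q z) := fun V =>
    integrable_of_bounded (by fun_prop) fun y => V.norm_coe_le_norm _
  have h1 : ∫ y, V (y, z.2) ∂D.Q z ≤ ∫ y, W (y, z.2) ∂D.Q z + m := by
    have : ∫ y, (W (y, z.2) + m) ∂D.Q z = ∫ y, W (y, z.2) ∂D.Q z + m := by
      rw [integral_add (hV W) (integrable_const m)]; simp
    rw [← this]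
    exact integral_mono (hV V) ((hV W).add (integrable_const m)) fun y => h _
  -- The slack of the hypothesis at `z`; it bounds how much the differences `V (z.1, b) - V z` can
  -- exceed those of `W`.
  have hu : 0 ≤ m - (V z - W z) := by linarith [h z]
  have h2 : ∫ b, tilt C θ (V (z.1, b) - V z) ∂D.lam0 ≤ ∫ b, tilt C θ (W (z.1, b) - W z) ∂D.lam0 +
      D.lam0.real Set.univ * (C * (m - (V z - W z))) := by
    have : ∫ b, (tilt C θ (W (z.1, b) - W z) + C * (m - (V z - W z))) ∂D.lam0 =
        ∫ b, tilt C θ (W (z.1, b) - W z) ∂D.lam0 +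
          D.lam0.real Set.univ * (C * (m - (V z - W z))) := by
      rw [integral_add (integrable_tilt hlam0 hC hθ W z) (integrable_const _)]; simp
    rw [← this]
    refine integral_mono (integrable_tilt hlam0 hC hθ V z)
      ((integrable_tilt hlam0 hC hθ W z).add (integrable_const _)) fun b => ?_
    exact tilt_le hC hθ hu (by linarith [h (z.1, b)])
  have h3 := mul_le_mul_of_nonneg_left h1 (hdyn.rate_nonneg z)
  have h4 := mul_le_mul_of_nonneg_right (hK z) hu
  unfold nonlocal
  nlinarith

theorem nonlocal_zero (D : PDMPData E A) (C K θ : ℝ) (z : E × A) :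
    D.nonlocal C K θ (0 : (E × A) →ᵇ ℝ) z = 0 := by
  simp [nonlocal, tilt]

theorem nonlocal_nonneg (hdyn : D.DynamicsHyp) (hlam0 : D.ActionMeasureHyp) {C K θ : ℝ}
    (hC : 0 ≤ C) (hK : ∀ z, C * D.lam0.real Set.univ + D.rate z ≤ K)
    (hθ : θ ∈ Set.Icc (0 : ℝ) 1) {V : (E × A) →ᵇ ℝ} (hV : ∀ z, 0 ≤ V z) (z : E × A) :
    0 ≤ D.nonlocal C K θ V z := by
  have := nonlocal_le hdyn hlam0 hC hK hθ 0 V (m := 0) (by simpa using hV) z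
  rwa [nonlocal_zero, mul_zero, add_zero] at this

theorem abs_nonlocal_sub_le (hdyn : D.DynamicsHyp) (hlam0 : D.ActionMeasureHyp) {C K θ : ℝ}
    (hC : 0 ≤ C) (hK : ∀ z, C * D.lam0.real Set.univ + D.rate z ≤ K)
    (hθ : θ ∈ Set.Icc (0 : ℝ) 1) (V W : (E × A) →ᵇ ℝ) (z : E × A) :
    |D.nonlocal C K θ V z - D.nonlocal C K θ W z| ≤ K * ‖V - W‖ := by
  have h : ∀ y, |V y - W y| ≤ ‖V - W‖ := fun y => (V - W).norm_coe_le_norm y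
  rw [abs_le]
  constructor
  · have := nonlocal_le hdyn hlam0 hC hK hθ W V (m := ‖V - W‖)
      (fun y => by linarith [(abs_le.1 (h y)).1]) z
    linarith
  · have := nonlocal_le hdyn hlam0 hC hK hθ V W (m := ‖V - W‖)
      (fun y => by linarith [(abs_le.1 (h y)).2]) z
    linarith

theorem abs_nonlocal_sub_param_le (hlam0 : D.ActionMeasureHyp) {C K θ θ' : ℝ} (hC : 0 ≤ C)
    (hθ : θ ∈ Set.Icc (0 : ℝ) 1) (hθ' : θ' ∈ Set.Icc (0 : ℝ) 1) (V : (E × A) →ᵇ ℝ) (z : E × A) :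
    |D.nonlocal C K θ V z - D.nonlocal C K θ' V z| ≤
      C * |θ - θ'| * (‖V‖ + ‖V‖) * D.lam0.real Set.univ := by
  have := hlam0.finite
  have : D.nonlocal C K θ V z - D.nonlocal C K θ' V z =
      ∫ b, (tilt C θ (V (z.1, b) - V z) - tilt C θ' (V (z.1, b) - V z)) ∂D.lam0 := by
    rw [integral_sub (integrable_tilt hlam0 hC hθ V z) (integrable_tilt hlam0 hC hθ' V z)]
    unfold nonlocal
    ring
  rw [this, ← Real.norm_eq_abs]
  refine norm_integral_le_of_norm_le_const (.of_forall fun b => ?_)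
  rw [Real.norm_eq_abs]
  refine (abs_tilt_sub_le hC).trans ?_
  gcongr
  exact (abs_sub _ _).trans (add_le_add (V.norm_coe_le_norm _) (V.norm_coe_le_norm _))

theorem continuous_nonlocal (hdyn : D.DynamicsHyp) (hlam0 : D.ActionMeasureHyp) {C K θ : ℝ}
    (hC : 0 ≤ C) (hθ : θ ∈ Set.Icc (0 : ℝ) 1) (V : (E × A) →ᵇ ℝ) :
    Continuous (D.nonlocal C K θ V) := by
  have := hlam0.finite
  have hr := hdyn.rate_unifCont.continuous
  refine ((hr.mul (hdyn.continuous_integral_kernel V)).add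
    ((continuous_const.sub hr).mul V.continuous)).add ?_
  refine continuous_of_dominated (bound := fun _ => C * (‖V‖ + ‖V‖))
    (fun z => (integrable_tilt hlam0 hC hθ V z).1) (fun z => .of_forall fun b => ?_)
    (integrable_const _) (.of_forall fun b => (continuous_tilt C θ).comp (by fun_prop))
  refine (abs_tilt_le hC hθ).trans (mul_le_mul_of_nonneg_left ?_ hC)
  exact (abs_sub _ _).trans (add_le_add (V.norm_coe_le_norm _) (V.norm_coe_le_norm _))

/-- Passing through `Real.toNNReal` freezes the flow at negative times, where `flow` is unspecified,
and makes it continuous on the whole line. -/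
theorem DynamicsHyp.continuous_flowPair_toNNReal (hdyn : D.DynamicsHyp) :
    Continuous fun p : ℝ × (E × A) => D.flowPair (p.1.toNNReal : ℝ≥0) p.2 :=
  hdyn.continuous_flowPair.comp
    ((continuous_real_toNNReal.comp continuous_fst).prodMk continuous_snd)

theorem DynamicsHyp.continuous_along_flow (hdyn : D.DynamicsHyp) (g : (E × A) →ᵇ ℝ) (z : E × A) :
    Continuous fun t : ℝ => g (D.flowPair (t.toNNReal : ℝ≥0) z) :=
  g.continuous.comp (hdyn.continuous_flowPair_toNNReal.comp (by fun_prop :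
    Continuous fun t : ℝ => (t, z)))

theorem integrableOn_exp_mul {κ : ℝ} (hκ : 0 < κ) (t : ℝ) {g : ℝ → ℝ} (hg : Continuous g) {c : ℝ}
    (hc : ∀ s, |g s| ≤ c) :
    IntegrableOn (fun s => Real.exp (-κ * s) * g s) (Set.Ioi t) := by
  refine ((integrableOn_exp_mul_Ioi (neg_lt_zero.2 hκ) t).mul_bdd hg.aestronglyMeasurable
    (.of_forall hc)).congr (.of_forall fun s => ?_)
  simp

theorem abs_integral_exp_mul_le {κ : ℝ} (hκ : 0 < κ) {g : ℝ → ℝ} {c : ℝ} (hc : ∀ s, |g s| ≤ c) :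
    |∫ s in Set.Ioi (0 : ℝ), Real.exp (-κ * s) * g s| ≤ c / κ := by
  have h := norm_integral_le_of_norm_le (μ := volume.restrict (Set.Ioi (0 : ℝ)))
    (f := fun s => Real.exp (-κ * s) * g s) (g := fun s => Real.exp (-κ * s) * c)
    ((integrableOn_exp_mul_Ioi (neg_lt_zero.2 hκ) 0).mul_const c) (.of_forall fun s => by
      rw [norm_mul, Real.norm_of_nonneg (Real.exp_pos _).le]
      exact mul_le_mul_of_nonneg_left (hc s) (Real.exp_pos _).le)
  rw [integral_mul_const, integral_exp_mul_Ioi (neg_lt_zero.2 hκ)] at h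
  refine h.trans (le_of_eq ?_)
  simp
  ring

/-- The resolvent of the flow, `∫₀^∞ e^{-κt} g(φ_t z) dt`. -/
noncomputable def discounted (D : PDMPData E A) (κ : ℝ) (g : E × A → ℝ) (z : E × A) : ℝ :=
  ∫ t in Set.Ioi (0 : ℝ), Real.exp (-κ * t) * g (D.flowPair (t.toNNReal : ℝ≥0) z)

theorem DynamicsHyp.continuous_discounted (hdyn : D.DynamicsHyp) {κ : ℝ} (hκ : 0 < κ)
    (g : (E × A) →ᵇ ℝ) : Continuous (D.discounted κ g) := by
  refine continuous_of_dominated (bound := fun s => Real.exp (-κ * s) * ‖g‖)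
    (fun z => (integrableOn_exp_mul hκ 0 (hdyn.continuous_along_flow g z)
      fun s => g.norm_coe_le_norm _).1) (fun z => .of_forall fun s => ?_)
    ((integrableOn_exp_mul_Ioi (neg_lt_zero.2 hκ) 0).mul_const _) (.of_forall fun s => ?_)
  · rw [norm_mul, Real.norm_of_nonneg (Real.exp_pos _).le]
    exact mul_le_mul_of_nonneg_left (g.norm_coe_le_norm _) (Real.exp_pos _).le
  · exact continuous_const.mul (g.continuous.comp (hdyn.continuous_flowPair_toNNReal.comp
      (by fun_prop : Continuous fun z : E × A => (s, z))))

theorem DynamicsHyp.discounted_sub (hdyn : D.DynamicsHyp) {κ : ℝ} (hκ : 0 < κ)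
    (g g' : (E × A) →ᵇ ℝ) (z : E × A) :
    D.discounted κ g z - D.discounted κ g' z = D.discounted κ (g - g' : (E × A) →ᵇ ℝ) z := by
  unfold discounted
  rw [← integral_sub (integrableOn_exp_mul hκ 0 (hdyn.continuous_along_flow g z)
      fun s => g.norm_coe_le_norm _) (integrableOn_exp_mul hκ 0 (hdyn.continuous_along_flow g' z)
      fun s => g'.norm_coe_le_norm _)]
  congr 1 with s
  simp [mul_sub]

theorem abs_discounted_le {κ : ℝ} (hκ : 0 < κ) (g : (E × A) →ᵇ ℝ) (z : E × A) :
    |D.discounted κ g z| ≤ ‖g‖ / κ :=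
  abs_integral_exp_mul_le hκ fun _ => g.norm_coe_le_norm _

theorem discounted_nonneg {κ : ℝ} {g : E × A → ℝ} (hg : ∀ z, 0 ≤ g z) (z : E × A) :
    0 ≤ D.discounted κ g z :=
  integral_nonneg fun _ => mul_nonneg (Real.exp_pos _).le (hg _)

end PDMPData

/-! ### The fixed point and its dependence on the parameter -/

namespace PDMPData

variable {d : ℕ} {E : Set (EuclideanSpace ℝ (Fin d))} {A : Type*} [MeasurableSpace A]
  [MetricSpace A] [SecondCountableTopology A] [BorelSpace A] {D : PDMPData E A}

/-- The resolvent of order `δ + K` has norm at most `1 / (δ + K)` and the nonlocal operator has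
Lipschitz constant `K`, so their composition contracts. The ratio does not depend on `θ`, which
gives continuity in `θ`. -/
theorem exists_fixedPoint (hδ : 0 < D.δ) (hdyn : D.DynamicsHyp) (hlam0 : D.ActionMeasureHyp)
    (hf : D.CostHyp) {C K : ℝ} (hC : 0 ≤ C) (hK0 : 0 ≤ K)
    (hK : ∀ z, C * D.lam0.real Set.univ + D.rate z ≤ K) :
    ∃ W : Set.Icc (0 : ℝ) 1 → (E × A) →ᵇ ℝ, Continuous W ∧ ∀ θ, (∀ z, 0 ≤ W θ z) ∧
      ∃ g : (E × A) →ᵇ ℝ, (∀ z, g z = D.f z + D.nonlocal C K θ (W θ) z) ∧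
        ∀ z, W θ z = D.discounted (D.δ + K) g z := by
  have hκ : 0 < D.δ + K := by linarith
  obtain ⟨F, hF⟩ := hf.bounded
  let G (θ : Set.Icc (0 : ℝ) 1) (V : (E × A) →ᵇ ℝ) : (E × A) →ᵇ ℝ :=
    BoundedContinuousFunction.ofNormedAddCommGroup (fun z => D.f z + D.nonlocal C K θ V z)
      (hf.unifCont.continuous.add (continuous_nonlocal hdyn hlam0 hC θ.2 V)) (F + K * ‖V‖)
      fun z => by
        refine (norm_add_le _ _).trans (add_le_add ?_ ?_)
        · rw [Real.norm_of_nonneg (hf.nonneg z)]; exact hF z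
        · have := abs_nonlocal_sub_le hdyn hlam0 hC hK θ.2 V 0 z
          rwa [nonlocal_zero, sub_zero, sub_zero] at this
  let Φ (θ : Set.Icc (0 : ℝ) 1) (V : (E × A) →ᵇ ℝ) : (E × A) →ᵇ ℝ :=
    BoundedContinuousFunction.ofNormedAddCommGroup (D.discounted (D.δ + K) (G θ V))
      (hdyn.continuous_discounted hκ _) (‖G θ V‖ / (D.δ + K)) fun z => abs_discounted_le hκ _ z
  have hG : ∀ θ V z, G θ V z = D.f z + D.nonlocal C K θ V z := fun _ _ _ => rfl
  have hΦ : ∀ θ V z, Φ θ V z = D.discounted (D.δ + K) (G θ V) z := fun _ _ _ => rfl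
  have hdist : ∀ θ θ' V V', dist (Φ θ V) (Φ θ' V') ≤ ‖G θ V - G θ' V'‖ / (D.δ + K) := by
    intro θ θ' V V'
    refine (BoundedContinuousFunction.dist_le (by positivity)).2 fun z => ?_
    rw [Real.dist_eq, hΦ, hΦ, hdyn.discounted_sub hκ]
    exact abs_discounted_le hκ _ z
  let k : ℝ≥0 := ⟨K / (D.δ + K), by positivity⟩
  have hcontr : ∀ θ, ContractingWith k (Φ θ) := fun θ => by
    refine ⟨?_, LipschitzWith.of_dist_le_mul fun V V' => (hdist θ θ V V').trans ?_⟩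
    · rw [← NNReal.coe_lt_coe]
      exact (div_lt_one hκ).2 (by linarith)
    · have : ‖G θ V - G θ V'‖ ≤ K * ‖V - V'‖ := by
        refine (BoundedContinuousFunction.norm_le (by positivity)).2 fun z => ?_
        have := abs_nonlocal_sub_le hdyn hlam0 hC hK θ.2 V V' z
        rw [BoundedContinuousFunction.sub_apply, hG, hG, add_sub_add_left_eq_sub]
        exact this
      rw [dist_eq_norm]
      change _ ≤ K / (D.δ + K) * _
      rw [div_mul_eq_mul_div]
      gcongr
  let W (θ : Set.Icc (0 : ℝ) 1) : (E × A) →ᵇ ℝ := (hcontr θ).fixedPoint (Φ θ)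
  have hW : ∀ θ, Φ θ (W θ) = W θ := fun θ => (hcontr θ).fixedPoint_isFixedPt
  refine ⟨W, ?_, fun θ => ⟨?_, G θ (W θ), fun z => rfl, fun z => ?_⟩⟩
  · refine continuous_iff_continuousAt.2 fun θ' => ?_
    -- The fixed point for `θ'` is nearly fixed for `θ`, and the distance to a true fixed point is
    -- at most the displacement divided by `1 - k`.
    have hb : ∀ θ, dist (W θ) (W θ') ≤ C * dist θ θ' * (‖W θ'‖ + ‖W θ'‖) *
        D.lam0.real Set.univ / (D.δ + K) / (1 - k) := fun θ => by
      rw [dist_comm]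
      have h1k := (hcontr θ).one_sub_K_pos
      refine ((hcontr θ).dist_fixedPoint_le (W θ')).trans ?_
      gcongr
      nth_rewrite 1 [← hW θ']
      rw [dist_comm]
      refine (hdist _ _ _ _).trans ?_
      gcongr
      refine (BoundedContinuousFunction.norm_le (by positivity)).2 fun z => ?_
      rw [BoundedContinuousFunction.sub_apply, hG, hG, add_sub_add_left_eq_sub]
      exact abs_nonlocal_sub_param_le hlam0 hC θ.2 θ'.2 _ z
    refine tendsto_iff_dist_tendsto_zero.2 (squeeze_zero (fun _ => dist_nonneg) hb ?_)
    have : Continuous fun θ : Set.Icc (0 : ℝ) 1 => C * dist θ θ' * (‖W θ'‖ + ‖W θ'‖) *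
        D.lam0.real Set.univ / (D.δ + K) / (1 - k) := by fun_prop
    have := this.tendsto θ'
    simpa using this
  -- Nonnegativity passes to the limit from the Picard iterates started at zero.
  · have hit : ∀ n z, 0 ≤ ((Φ θ)^[n] 0) z := by
      intro n
      induction n with
      | zero => intro z; exact le_rfl
      | succ n ih =>
        intro z
        rw [Function.iterate_succ_apply', hΦ]
        exact discounted_nonneg (fun y => add_nonneg (hf.nonneg y)
          (nonlocal_nonneg hdyn hlam0 hC hK θ.2 ih y)) z
    intro z
    have h1 := (hcontr θ).tendsto_iterate_fixedPoint 0
    have h2 : Tendsto (fun n => ((Φ θ)^[n] 0) z) atTop (𝓝 (W θ z)) :=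
      ((BoundedContinuousFunction.lipschitz_eval_const z).continuous.tendsto _).comp h1
    exact ge_of_tendsto' h2 fun n => hit n z
  · nth_rewrite 1 [← hW θ]
    rfl

/-! ### Resolvents along the flow -/

/-- By the semigroup property and a time shift, the resolvent along the flow is a tail of one fixed
integral. -/
theorem DynamicsHyp.discounted_flowPair (hdyn : D.DynamicsHyp) {κ : ℝ} (g : (E × A) →ᵇ ℝ)
    (z : E × A) {t : ℝ} (ht : 0 ≤ t) :
    D.discounted κ g (D.flowPair (t.toNNReal : ℝ≥0) z) =
      Real.exp (κ * t) * ∫ s in Set.Ioi t,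
        Real.exp (-κ * s) * g (D.flowPair (s.toNNReal : ℝ≥0) z) := by
  have h := (measurePreserving_add_right volume t).setIntegral_preimage_emb
    (measurableEmbedding_addRight t)
    (fun s => Real.exp (-κ * s) * g (D.flowPair (s.toNNReal : ℝ≥0) z)) (Set.Ioi t)
  rw [Set.preimage_add_const_Ioi, sub_self] at h
  rw [← h, ← integral_const_mul]
  refine setIntegral_congr_fun measurableSet_Ioi fun s hs => ?_
  have hs' : 0 ≤ s := le_of_lt hs
  rw [Real.coe_toNNReal _ hs', Real.coe_toNNReal _ ht, Real.coe_toNNReal _ (add_nonneg hs' ht),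
    hdyn.flowPair_add hs' ht, ← mul_assoc, ← Real.exp_add, add_comm t s]
  congr 2
  ring

/-- Along the flow the resolvent is an exponential times a tail integral with continuous integrand,
hence differentiable. This replaces the differential equation, since the resolvent need not be
differentiable in space. -/
theorem DynamicsHyp.hasDerivAt_discounted (hdyn : D.DynamicsHyp) {δ K : ℝ} (hκ : 0 < δ + K)
    (g : (E × A) →ᵇ ℝ) (z : E × A) (r : ℝ) {t : ℝ} (ht : r < t) :
    HasDerivAt (fun t => Real.exp (-δ * t) *
        D.discounted (δ + K) g (D.flowPair ((t - r).toNNReal : ℝ≥0) z))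
      (Real.exp (-δ * t) * (K * D.discounted (δ + K) g (D.flowPair ((t - r).toNNReal : ℝ≥0) z) -
        g (D.flowPair ((t - r).toNNReal : ℝ≥0) z))) t := by
  let q : ℝ → ℝ := fun s => Real.exp (-(δ + K) * s) * g (D.flowPair (s.toNNReal : ℝ≥0) z)
  have hqc : Continuous q := (by fun_prop : Continuous fun s => Real.exp (-(δ + K) * s)).mul
    (hdyn.continuous_along_flow g z)
  have hqi : ∀ t, IntegrableOn q (Set.Ioi t) := fun t =>
    integrableOn_exp_mul hκ t (hdyn.continuous_along_flow g z) fun s => g.norm_coe_le_norm _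
  have hI : ∀ u, 0 ≤ u → ∫ s in Set.Ioi u, q s = (∫ s in Set.Ioi (0 : ℝ), q s) - ∫ s in (0:ℝ)..u, q s := by
    intro u hu
    rw [intervalIntegral.integral_of_le hu, eq_sub_iff_add_eq, add_comm,
      ← setIntegral_union Set.Ioc_disjoint_Ioi_same measurableSet_Ioi
        ((hqi 0).mono_set Set.Ioc_subset_Ioi_self) (hqi u), Set.Ioc_union_Ioi_eq_Ioi hu]
  have hder : HasDerivAt (fun u => (∫ s in Set.Ioi (0 : ℝ), q s) - ∫ s in (0:ℝ)..u, q s)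
      (-q (t - r)) (t - r) :=
    (intervalIntegral.integral_hasDerivAt_right (hqc.intervalIntegrable _ _)
      hqc.stronglyMeasurable.stronglyMeasurableAtFilter hqc.continuousAt).const_sub _
  have hder2 := hder.comp_sub_const t r
  have hexp : HasDerivAt (fun t => Real.exp (-δ * t + (δ + K) * (t - r)))
      (Real.exp (-δ * t + (δ + K) * (t - r)) * K) t := by
    have : HasDerivAt (fun t => -δ * t + (δ + K) * (t - r)) K t := by
      refine HasDerivAt.congr_deriv (((hasDerivAt_id t).const_mul (-δ)).fun_add
        (((hasDerivAt_id t).sub_const r).const_mul (δ + K))) ?_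
      ring
    exact this.exp
  have hev : (fun t => Real.exp (-δ * t) *
      D.discounted (δ + K) g (D.flowPair ((t - r).toNNReal : ℝ≥0) z)) =ᶠ[𝓝 t]
      fun t => Real.exp (-δ * t + (δ + K) * (t - r)) *
        ((∫ s in Set.Ioi (0 : ℝ), q s) - ∫ s in (0:ℝ)..(t - r), q s) := by
    filter_upwards [lt_mem_nhds ht] with u hu
    have hu' : 0 ≤ u - r := by linarith
    rw [hdyn.discounted_flowPair g z hu', ← hI _ hu', ← mul_assoc, ← Real.exp_add]
  refine HasDerivAt.congr_of_eventuallyEq ((hexp.fun_mul hder2).congr_deriv ?_) hev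
  symm
  have ht' : 0 ≤ t - r := by linarith
  rw [hdyn.discounted_flowPair g z ht', ← hI _ ht', Real.exp_add]
  simp only [q]
  have h1 : Real.exp ((δ + K) * (t - r)) * Real.exp (-(δ + K) * (t - r)) = 1 := by
    rw [← Real.exp_add, Real.exp_eq_one_iff]; ring
  linear_combination (Real.exp (-δ * t) * g (D.flowPair ((t - r).toNNReal : ℝ≥0) z)) * h1

end PDMPData

/-! ### Expectations over the intervals between jumps -/

namespace JumpPath

variable {E A : Type*} [MeasurableSpace E] [MeasurableSpace A]

theorem Compensates.lintegral_point {Γ : JumpPath E A → ℝ≥0 → Measure (E × A)} {K : ℝ≥0}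
    (hΓ : IsBoundedIntensity Γ K) {P : Measure (JumpPath E A)} [SFinite P] (h : Compensates Γ P)
    (n : ℕ) {H : (ℝ≥0 × JumpPath E A) × (E × A) → ℝ≥0∞}
    (hH : Measurable[(predictableSigma E A).prod inferInstance] H) :
    ∫⁻ ω, (ω.point n).elim 0 (fun q => H ((q.1, ω), q.2)) ∂P =
      ∫⁻ p in stochInterval E A n, ∫⁻ z, H (p, z) ∂Γ p.2 p.1 ∂(timeMeasure.prod P) := by
  have hHm := measurable_prod_of_predictable hH
  have hm : Measurable fun p : ℝ≥0 × JumpPath E A => ∫⁻ z, H (p, z) ∂Γ p.2 p.1 :=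
    hΓ.measurable_lintegral hHm
  rw [← lintegral_indicator (measurableSet_stochInterval' n),
    lintegral_prod_symm' _ (hm.indicator (measurableSet_stochInterval' n))]
  convert h.step hΓ n H hHm using 1
  · refine lintegral_congr fun ω => ?_
    cases hq : ω.point n with
    | none => rfl
    | some q => exact (predictable_trunc_section hH (mem_stochInterval_of_point hq) q.2).symm
  · refine lintegral_congr fun ω => lintegral_congr fun s => ?_
    by_cases hs : (s, ω) ∈ stochInterval E A n
    · rw [Set.indicator_of_mem hs, Set.indicator_of_mem hs, hΓ.trunc_eq hs]
      exact lintegral_congr fun z => (predictable_trunc_section hH hs z).symm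
    · rw [Set.indicator_of_notMem hs, Set.indicator_of_notMem hs]

theorem pairwise_disjoint_stochInterval (E A : Type*) :
    Pairwise (Function.onFun Disjoint (stochInterval E A)) := fun _ _ hmn =>
  Set.disjoint_left.2 fun _ hm hn => hmn (stochInterval_index_unique hm hn)

theorem tsum_setLIntegral_stochInterval_le (μ : Measure (ℝ≥0 × JumpPath E A))
    (F : ℝ≥0 × JumpPath E A → ℝ≥0∞) :
    ∑' n, ∫⁻ p in stochInterval E A n, F p ∂μ ≤ ∫⁻ p, F p ∂μ := by
  rw [← lintegral_iUnion (fun n => measurableSet_stochInterval' n)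
    (pairwise_disjoint_stochInterval E A)]
  exact setLIntegral_le_lintegral _ _

/-- The discount factor `e^{-δs}`. -/
noncomputable def discount (δ : ℝ) (s : ℝ≥0) : ℝ≥0∞ := ENNReal.ofReal (Real.exp (-δ * s))

theorem measurable_discount (δ : ℝ) : Measurable (discount δ) := by
  unfold discount; fun_prop

theorem measurable_discount_fst (δ : ℝ) :
    Measurable fun p : ℝ≥0 × JumpPath E A => discount δ p.1 :=
  (measurable_discount δ).comp measurable_fst

theorem discount_le_one {δ : ℝ} (hδ : 0 < δ) (s : ℝ≥0) : discount δ s ≤ 1 := by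
  rw [discount, ENNReal.ofReal_le_one, Real.exp_le_one_iff]
  nlinarith [s.coe_nonneg]

theorem lintegral_discount {δ : ℝ} (hδ : 0 < δ) :
    ∫⁻ s, discount δ s ∂timeMeasure = ENNReal.ofReal (1 / δ) := by
  rw [lintegral_timeMeasure (measurable_discount δ)]
  have : ∫⁻ s in Set.Ioi (0 : ℝ), discount δ s.toNNReal =
      ∫⁻ s in Set.Ioi (0 : ℝ), ENNReal.ofReal (Real.exp (-δ * s)) :=
    setLIntegral_congr_fun measurableSet_Ioi fun s hs => by
      rw [discount, Real.coe_toNNReal _ (le_of_lt hs)]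
  rw [this, ← ofReal_integral_eq_lintegral_ofReal (integrableOn_exp_mul_Ioi (neg_lt_zero.2 hδ) 0)
    (.of_forall fun s => (Real.exp_pos _).le), integral_exp_mul_Ioi (neg_lt_zero.2 hδ)]
  simp

theorem lintegral_discount_prod {δ : ℝ} (hδ : 0 < δ) (P : Measure (JumpPath E A))
    [IsProbabilityMeasure P] :
    ∫⁻ p, discount δ p.1 ∂(timeMeasure.prod P) = ENNReal.ofReal (1 / δ) := by
  rw [lintegral_prod _ (measurable_discount_fst δ).aemeasurable]
  simp [lintegral_discount hδ]

/-- The expectation of `e^{-δ T_n} F(E_n, A_n)` on `T_n < ∞`. -/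
noncomputable def markMean (δ : ℝ) (P : Measure (JumpPath E A)) (n : ℕ) (F : E × A → ℝ≥0∞) : ℝ≥0∞ :=
  ∫⁻ ω, (ω.mark n).elim 0 (fun z => discount δ (ω.T n).toNNReal * F z) ∂P

theorem markMean_zero (δ : ℝ) {P : Measure (JumpPath E A)} {z : E × A}
    (hP : P.map (fun ω => ω.init) = Measure.dirac z) {F : E × A → ℝ≥0∞} (hF : Measurable F) :
    markMean δ P 0 F = F z := by
  have : markMean δ P 0 F = ∫⁻ ω, F ω.init ∂P := by
    refine lintegral_congr fun ω => ?_
    simp [mark, T, discount]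
  rw [this, ← lintegral_map hF measurable_init, hP, lintegral_dirac' _ hF]

/-- The discount at the jump time is predictable and the new mark is integrated against the
intensity. -/
theorem markMean_succ {δ : ℝ} {Γ : JumpPath E A → ℝ≥0 → Measure (E × A)} {K : ℝ≥0}
    (hΓ : IsBoundedIntensity Γ K) {P : Measure (JumpPath E A)} [SFinite P] (h : Compensates Γ P)
    (n : ℕ) {F : E × A → ℝ≥0∞} (hF : Measurable F) :
    markMean δ P (n + 1) F = ∫⁻ p in stochInterval E A n,
      discount δ p.1 * ∫⁻ z, F z ∂Γ p.2 p.1 ∂(timeMeasure.prod P) := by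
  have hH : Measurable[(predictableSigma E A).prod inferInstance]
      fun q : (ℝ≥0 × JumpPath E A) × (E × A) => discount δ q.1.1 * F q.2 := by
    have h1 := measurable_fst_predictable (E := E) (A := A)
    let _ := predictableSigma E A
    exact ((measurable_discount δ).comp (h1.comp measurable_fst)).mul (hF.comp measurable_snd)
  have := h.lintegral_point hΓ n hH
  simp only [lintegral_const_mul _ hF] at this
  rw [← this]
  refine lintegral_congr fun ω => ?_
  cases hq : ω.point n with
  | none => simp [mark, hq]
  | some q => simp [mark, T, hq]

theorem markMean_mono (δ : ℝ) (P : Measure (JumpPath E A)) (n : ℕ) {F G : E × A → ℝ≥0∞}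
    (h : ∀ z, F z ≤ G z) : markMean δ P n F ≤ markMean δ P n G := by
  refine lintegral_mono fun ω => ?_
  cases ω.mark n with
  | none => exact le_rfl
  | some z => exact mul_le_mul_right (h z) _

/-- The expectations for `n ≥ 1` are summable: their sum is at most `c K` times the discounted
length of the time axis. No separate argument against accumulating jump times is needed. -/
theorem tendsto_markMean {δ : ℝ} (hδ : 0 < δ) {Γ : JumpPath E A → ℝ≥0 → Measure (E × A)}
    {K : ℝ≥0} (hΓ : IsBoundedIntensity Γ K) {P : Measure (JumpPath E A)} [IsProbabilityMeasure P]
    (h : Compensates Γ P) {F : E × A → ℝ≥0∞} {c : ℝ≥0} (hF : ∀ z, F z ≤ c) :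
    Tendsto (fun n => markMean δ P n F) atTop (𝓝 0) := by
  have hb : ∀ n, markMean δ P (n + 1) F ≤
      (c * K) * ∫⁻ p in stochInterval E A n, discount δ p.1 ∂(timeMeasure.prod P) := fun n => by
    refine (markMean_mono δ P _ hF).trans ?_
    rw [markMean_succ hΓ h n measurable_const,
      ← lintegral_const_mul _ (measurable_discount_fst δ)]
    refine lintegral_mono fun p => ?_
    rw [lintegral_const, mul_comm]
    exact mul_le_mul_left (mul_le_mul_right (hΓ.le _ _) _) _
  have hsum : ∑' n, markMean δ P (n + 1) F ≠ ∞ := by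
    refine ne_top_of_le_ne_top ?_ (ENNReal.tsum_le_tsum hb)
    rw [ENNReal.tsum_mul_left]
    refine ENNReal.mul_ne_top (by finiteness) (ne_top_of_le_ne_top ?_
      (tsum_setLIntegral_stochInterval_le _ _))
    rw [lintegral_discount_prod hδ]
    exact ENNReal.ofReal_ne_top
  exact (tendsto_add_atTop_iff_nat 1).1 (ENNReal.tendsto_atTop_zero_of_tsum_ne_top hsum)

end JumpPath

/-! ### Telescoping inequalities in `[0,∞]` -/

theorem ENNReal.le_tsum_of_le_add {a c : ℕ → ℝ≥0∞} {m : ℕ} (h : ∀ n ≥ m, a n ≤ c n + a (n + 1))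
    (ha : Tendsto a atTop (𝓝 0)) : a m ≤ ∑' n, c (n + m) := by
  have h1 : ∀ N, a m ≤ ∑ i ∈ Finset.range N, c (i + m) + a (N + m) := fun N => by
    induction N with
    | zero => simp
    | succ N ih =>
      rw [Finset.sum_range_succ, add_assoc]
      refine ih.trans (add_le_add le_rfl ?_)
      rw [Nat.add_right_comm]
      exact h _ (Nat.le_add_left m N)
  have h2 : ∀ N, a m ≤ ∑' n, c (n + m) + a (N + m) := fun N =>
    (h1 N).trans (add_le_add (ENNReal.sum_le_tsum _) le_rfl)
  have h3 : Tendsto (fun N => ∑' n, c (n + m) + a (N + m)) atTop (𝓝 (∑' n, c (n + m) + 0)) :=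
    tendsto_const_nhds.add ((tendsto_add_atTop_iff_nat m).2 ha)
  rw [add_zero] at h3
  exact ge_of_tendsto' h3 h2

/-- In this direction the remainder is nonnegative and is simply dropped, so no limit of `a` is
required. -/
theorem ENNReal.tsum_le_of_add_le {a c e : ℕ → ℝ≥0∞} {m : ℕ}
    (h : ∀ n ≥ m, c n + a (n + 1) ≤ a n + e n) :
    ∑' n, c (n + m) ≤ a m + ∑' n, e (n + m) := by
  have h1 : ∀ N, ∑ i ∈ Finset.range N, c (i + m) + a (N + m) ≤
      a m + ∑ i ∈ Finset.range N, e (i + m) := fun N => by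
    induction N with
    | zero => simp
    | succ N ih =>
      rw [Finset.sum_range_succ, Finset.sum_range_succ, add_assoc (∑ i ∈ Finset.range N, c (i + m)),
        ← add_assoc (a m), Nat.add_right_comm]
      refine le_trans ?_ (add_le_add ih le_rfl)
      rw [add_assoc (∑ i ∈ Finset.range N, c (i + m))]
      exact add_le_add le_rfl (h _ (Nat.le_add_left m N))
  rw [ENNReal.tsum_eq_iSup_nat]
  refine iSup_le fun N => le_self_add.trans ((h1 N).trans ?_)
  exact add_le_add le_rfl (ENNReal.sum_le_tsum _)

namespace PDMPData

open JumpPath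

/-! ### Verification -/

variable {d : ℕ} {E : Set (EuclideanSpace ℝ (Fin d))} {A : Type*} [MeasurableSpace A]
  [MetricSpace A] [SecondCountableTopology A] [BorelSpace A] {D : PDMPData E A}

/-- The process `e^{-δs} F(X_{s-}, I_{s-})`. -/
noncomputable def along (D : PDMPData E A) (F : E × A → ℝ≥0∞) (p : ℝ≥0 × JumpPath E A) : ℝ≥0∞ :=
  discount D.δ p.1 * (p.2.stateLeft D.flow p.1).elim 0 F

theorem DynamicsHyp.measurable_along_predictable (hdyn : D.DynamicsHyp) {F : E × A → ℝ≥0∞}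
    (hF : Measurable F) : Measurable[predictableSigma E A] (D.along F) := by
  have h1 := measurable_fst_predictable (E := E) (A := A)
  have h2 := hdyn.measurable_stateLeft
  have h3 : Measurable fun y : Option (E × A) => y.elim 0 F := measurable_of_comp_some hF
  let _ := predictableSigma E A
  exact ((measurable_discount D.δ).comp h1).mul (h3.comp h2)

theorem DynamicsHyp.measurable_along (hdyn : D.DynamicsHyp) {F : E × A → ℝ≥0∞}
    (hF : Measurable F) : Measurable (D.along F) :=
  (hdyn.measurable_along_predictable hF).mono predictable_le le_rfl

theorem along_le (D : PDMPData E A) {F : E × A → ℝ≥0∞} {c : ℝ≥0∞} (hF : ∀ z, F z ≤ c)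
    (p : ℝ≥0 × JumpPath E A) : D.along F p ≤ c * discount D.δ p.1 := by
  rw [along, mul_comm]
  refine mul_le_mul_left ?_ _
  cases p.2.stateLeft D.flow p.1 with
  | none => exact zero_le
  | some z => exact hF z

/-- The set `S` is the real interval from `T n` to `T (n + 1)`, kept abstract because it is bounded
or a half line depending on whether another point occurs. -/
theorem lintegral_along_interval (hδ : 0 < D.δ) (hdyn : D.DynamicsHyp) {ω : JumpPath E A} {n : ℕ}
    {r : ℝ≥0} (hr : ω.T n = r) {z : E × A} (hz : ω.mark n = some z) {u : (E × A) →ᵇ ℝ}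
    (hu : ∀ y, 0 ≤ u y) {S : Set ℝ} (hS : MeasurableSet S)
    (hSiff : ∀ s, s ∈ S ↔ (r : ℝ) < s ∧ ENNReal.ofReal s ≤ ω.T (n + 1)) :
    ∫⁻ s, (stochInterval E A n).indicator (D.along fun y => ENNReal.ofReal (u y)) (s, ω)
        ∂timeMeasure =
      ENNReal.ofReal (∫ s in S, Real.exp (-D.δ * s) *
        u (D.flowPair ((s - r).toNNReal : ℝ≥0) z)) := by
  have hum : Measurable fun y => ENNReal.ofReal (u y) := by fun_prop
  have hm : Measurable fun s : ℝ≥0 =>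
      (stochInterval E A n).indicator (D.along fun y => ENNReal.ofReal (u y)) (s, ω) :=
    ((hdyn.measurable_along hum).indicator (measurableSet_stochInterval' n)).comp
      (by fun_prop : Measurable fun s : ℝ≥0 => (s, ω))
  have hmem : ∀ s : ℝ, 0 < s → ((s.toNNReal, ω) ∈ stochInterval E A n ↔ s ∈ S) := fun s hs => by
    rw [hSiff]
    refine and_congr ?_ Iff.rfl
    rw [hr]
    simp only [ENNReal.coe_lt_coe]
    rw [← NNReal.coe_lt_coe, Real.coe_toNNReal _ hs.le]
  have hSsub : S ⊆ Set.Ioi (r : ℝ) := fun s hs => ((hSiff s).1 hs).1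
  have hcont : Continuous fun s : ℝ => u (D.flowPair ((s - r).toNNReal : ℝ≥0) z) :=
    (hdyn.continuous_along_flow u z).comp (by fun_prop : Continuous fun s : ℝ => s - r)
  rw [lintegral_timeMeasure hm, ofReal_integral_eq_lintegral_ofReal
    ((integrableOn_exp_mul hδ r hcont fun s => u.norm_coe_le_norm _).mono_set hSsub)
    (.of_forall fun s => mul_nonneg (Real.exp_pos _).le (hu _)), ← lintegral_indicator hS,
    ← lintegral_indicator measurableSet_Ioi]
  refine lintegral_congr fun s => ?_
  by_cases hs : s ∈ S
  · have hs0 : 0 < s := r.coe_nonneg.trans_lt (hSsub hs)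
    have hp := (hmem s hs0).2 hs
    rw [Set.indicator_of_mem (Set.mem_Ioi.2 hs0), Set.indicator_of_mem hp,
      Set.indicator_of_mem hs, along, stateLeft_of_mem D hp, ENNReal.ofReal_mul (Real.exp_pos _).le]
    simp only [hz, hr, discount, Real.coe_toNNReal _ hs0.le, Option.map_some, Option.elim_some,
      ENNReal.toNNReal_coe]
    rw [NNReal.sub_def, Real.coe_toNNReal _ hs0.le]
  · rw [Set.indicator_of_notMem hs]
    by_cases hs0 : 0 < s
    · rw [Set.indicator_of_mem (Set.mem_Ioi.2 hs0),
        Set.indicator_of_notMem fun h => hs ((hmem s hs0).1 h)]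
    · exact Set.indicator_of_notMem (by simpa using hs0) _

/-- Fundamental theorem of calculus for `e^{-δt} V` along the flow from the state at `T n`, whose
derivative is `e^{-δt} (K V - g)`. The negative terms are moved across so that every summand lies in
`[0,∞]`. -/
theorem discounted_pathwise (hδ : 0 < D.δ) (hdyn : D.DynamicsHyp) {K : ℝ} (hK : 0 ≤ K)
    {V g : (E × A) →ᵇ ℝ} (hV : ∀ z, V z = D.discounted (D.δ + K) g z) (hV0 : ∀ z, 0 ≤ V z)
    (hg0 : ∀ z, 0 ≤ g z) (n : ℕ) (ω : JumpPath E A) :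
    (ω.mark n).elim 0 (fun z => discount D.δ (ω.T n).toNNReal * ENNReal.ofReal (V z)) +
      ∫⁻ s, (stochInterval E A n).indicator (D.along fun y => ENNReal.ofReal (K * V y)) (s, ω)
        ∂timeMeasure =
    (ω.point n).elim 0 (fun q => D.along (fun y => ENNReal.ofReal (V y)) (q.1, ω)) +
      ∫⁻ s, (stochInterval E A n).indicator (D.along fun y => ENNReal.ofReal (g y)) (s, ω)
        ∂timeMeasure := by
  by_cases hT : ω.T n = ∞
  · have h1 : ω.mark n = none := (ω.mark_eq_none_iff n).2 hT
    have h2 : ω.point n = none := by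
      rw [← pointTime_eq_top_iff]
      exact top_unique (hT.ge.trans (ω.T_mono n.le_succ))
    have h3 : ∀ s, (s, ω) ∉ stochInterval E A n := fun s hs => by
      have := hs.1
      simp only [hT] at this
      exact not_top_lt this
    simp [h1, h2, h3]
  obtain ⟨z, hz⟩ := ω.exists_mark (lt_top_iff_ne_top.2 hT)
  obtain ⟨r, hr⟩ : ∃ r : ℝ≥0, ω.T n = r := ⟨_, (ENNReal.coe_toNNReal hT).symm⟩
  have hcont : ∀ u : (E × A) →ᵇ ℝ,
      Continuous fun s : ℝ => u (D.flowPair ((s - r).toNNReal : ℝ≥0) z) := fun u =>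
    (hdyn.continuous_along_flow u z).comp (by fun_prop : Continuous fun s : ℝ => s - r)
  have hint : ∀ u : (E × A) →ᵇ ℝ, IntegrableOn (fun s => Real.exp (-D.δ * s) *
      u (D.flowPair ((s - r).toNNReal : ℝ≥0) z)) (Set.Ioi (r : ℝ)) := fun u =>
    integrableOn_exp_mul hδ r (hcont u) fun s => u.norm_coe_le_norm _
  have hKV : ∀ y, (K • V) y = K * V y := fun y => rfl
  have hKV0 : ∀ y, 0 ≤ (K • V) y := fun y => mul_nonneg hK (hV0 y)
  let w : ℝ → ℝ := fun t => Real.exp (-D.δ * t) * V (D.flowPair ((t - r).toNNReal : ℝ≥0) z)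
  let w' : ℝ → ℝ := fun t => Real.exp (-D.δ * t) * (K • V) (D.flowPair ((t - r).toNNReal : ℝ≥0) z) -
    Real.exp (-D.δ * t) * g (D.flowPair ((t - r).toNNReal : ℝ≥0) z)
  have hwc : Continuous w := (by fun_prop : Continuous fun t => Real.exp (-D.δ * t)).mul (hcont V)
  have hw : ∀ t, (r : ℝ) < t → HasDerivAt w (w' t) t := fun t ht => by
    have := hdyn.hasDerivAt_discounted (by linarith : 0 < D.δ + K) g z r ht
    simp only [← hV] at this
    refine this.congr_deriv ?_
    simp only [w', hKV]
    ring
  have hw'i : IntegrableOn w' (Set.Ioi (r : ℝ)) := (hint (K • V)).sub (hint g)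
  have hwr : w r = Real.exp (-D.δ * r) * V z := by
    simp only [w, sub_self, Real.toNNReal_zero, NNReal.coe_zero, hdyn.flowPair_zero]
  have hmark : (ω.mark n).elim 0 (fun z => discount D.δ (ω.T n).toNNReal * ENNReal.ofReal (V z)) =
      ENNReal.ofReal (w r) := by
    rw [hwr, ENNReal.ofReal_mul (Real.exp_pos _).le, hz, hr]
    rfl
  have hw0 : ∀ t, 0 ≤ w t := fun t => mul_nonneg (Real.exp_pos _).le (hV0 _)
  have hpos : ∀ (S : Set ℝ) (u : (E × A) →ᵇ ℝ), (∀ y, 0 ≤ u y) →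
      0 ≤ ∫ s in S, Real.exp (-D.δ * s) * u (D.flowPair ((s - r).toNNReal : ℝ≥0) z) :=
    fun S u hu => integral_nonneg fun s => mul_nonneg (Real.exp_pos _).le (hu _)
  cases hq : ω.point n with
  | none =>
    have hT1 : ω.T (n + 1) = ∞ := by simp [T, hq]
    have hSiff : ∀ s, s ∈ Set.Ioi (r : ℝ) ↔ (r : ℝ) < s ∧ ENNReal.ofReal s ≤ ω.T (n + 1) :=
      fun s => by simp [hT1]
    -- Without a further point the interval is a half line, and the boundary term at infinity
    -- vanishes because `V` is bounded and `δ > 0`.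
    have hlim : Tendsto w atTop (𝓝 0) := by
      have h1 : Tendsto (fun t : ℝ => Real.exp (-D.δ * t) * ‖V‖) atTop (𝓝 0) := by
        have : Tendsto (fun t : ℝ => -D.δ * t) atTop atBot :=
          tendsto_id.const_mul_atTop_of_neg (neg_lt_zero.2 hδ)
        simpa using (Real.tendsto_exp_atBot.comp this).mul_const ‖V‖
      refine squeeze_zero hw0 (fun t => ?_) h1
      exact mul_le_mul_of_nonneg_left ((le_abs_self _).trans (V.norm_coe_le_norm _))
        (Real.exp_pos _).le
    have key := integral_Ioi_of_hasDerivAt_of_tendsto hwc.continuousWithinAt (fun t ht => hw t ht)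
      hw'i hlim
    rw [integral_sub (hint (K • V)) (hint g)] at key
    have e1 := lintegral_along_interval hδ hdyn hr hz hKV0 measurableSet_Ioi hSiff
    have e2 := lintegral_along_interval hδ hdyn hr hz hg0 measurableSet_Ioi hSiff
    simp only [hKV] at e1
    rw [hmark, e1, e2, ← ENNReal.ofReal_add (hw0 _) (by
      have := hpos (Set.Ioi r) (K • V) hKV0; simpa only [hKV] using this)]
    simp only [Option.elim_none, zero_add]
    simp only [hKV] at key
    congr 1
    linarith
  | some q =>
    have hT1 : ω.T (n + 1) = q.1 := by simp [T, hq]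
    have hrq : (r : ℝ) < q.1 := by
      have := ω.T_lt_succ n (lt_top_iff_ne_top.2 hT)
      rw [hT1, hr] at this
      exact_mod_cast this
    have hSiff : ∀ s, s ∈ Set.Ioc (r : ℝ) q.1 ↔ (r : ℝ) < s ∧ ENNReal.ofReal s ≤ ω.T (n + 1) :=
      fun s => by
        rw [hT1, ENNReal.ofReal, ENNReal.coe_le_coe, Real.toNNReal_le_iff_le_coe]
        rfl
    have hint' : ∀ u : (E × A) →ᵇ ℝ, IntegrableOn (fun s => Real.exp (-D.δ * s) *
        u (D.flowPair ((s - r).toNNReal : ℝ≥0) z)) (Set.Ioc (r : ℝ) q.1) := fun u =>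
      (hint u).mono_set Set.Ioc_subset_Ioi_self
    have key := intervalIntegral.integral_eq_sub_of_hasDerivAt_of_le hrq.le hwc.continuousOn
      (fun t ht => hw t ht.1) ((intervalIntegrable_iff_integrableOn_Ioc_of_le hrq.le).2
        (hw'i.mono_set Set.Ioc_subset_Ioi_self))
    rw [intervalIntegral.integral_of_le hrq.le, integral_sub (hint' (K • V)) (hint' g)] at key
    have e1 := lintegral_along_interval hδ hdyn hr hz hKV0 measurableSet_Ioc hSiff
    have e2 := lintegral_along_interval hδ hdyn hr hz hg0 measurableSet_Ioc hSiff
    have hend : D.along (fun y => ENNReal.ofReal (V y)) (q.1, ω) = ENNReal.ofReal (w q.1) := by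
      have hp := mem_stochInterval_of_point hq
      rw [along, stateLeft_of_mem D hp, ENNReal.ofReal_mul (Real.exp_pos _).le]
      simp only [hz, hr, discount, Option.map_some, Option.elim_some, ENNReal.toNNReal_coe]
      rw [NNReal.sub_def]
    simp only [hKV] at e1
    have hp1 := hpos (Set.Ioc r q.1) (K • V) hKV0
    simp only [hKV] at key hp1
    rw [hmark, e1, e2, ← ENNReal.ofReal_add (hw0 _) hp1]
    simp only [Option.elim_some]
    rw [hend, ← ENNReal.ofReal_add (hw0 _) (hpos _ g hg0)]
    congr 1
    linarith

end PDMPData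

/-! ### The verification inequality between two consecutive jumps -/

namespace PDMPData

open JumpPath

variable {d : ℕ} {E : Set (EuclideanSpace ℝ (Fin d))} {A : Type*} [MeasurableSpace A]
  [MetricSpace A] [SecondCountableTopology A] [BorelSpace A] {D : PDMPData E A}

theorem setLIntegral_stochInterval {P : Measure (JumpPath E A)} [SFinite P] (n : ℕ)
    {F : ℝ≥0 × JumpPath E A → ℝ≥0∞} (hF : Measurable F) :
    ∫⁻ p in stochInterval E A n, F p ∂(timeMeasure.prod P) =
      ∫⁻ ω, ∫⁻ s, (stochInterval E A n).indicator F (s, ω) ∂timeMeasure ∂P := by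
  rw [← lintegral_indicator (measurableSet_stochInterval' n),
    lintegral_prod_symm' _ (hF.indicator (measurableSet_stochInterval' n))]

section Step

variable {ν : JumpPath E A → ℝ≥0 → A → ℝ} {K' : ℝ≥0} {P : Measure (JumpPath E A)} {K : ℝ}
  {V g : (E × A) →ᵇ ℝ}

/-- Expectation of the pathwise identity. The value of `V` just before the jump is predictable, so
at `T (n + 1)` it is compensated by the total mass of the intensity. -/
theorem markMean_add_eq (hδ : 0 < D.δ) (hdyn : D.DynamicsHyp)
    (hΓ : IsBoundedIntensity (D.intensity ν) K') [IsProbabilityMeasure P]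
    (hP : Compensates (D.intensity ν) P) (hK : 0 ≤ K)
    (hV : ∀ z, V z = D.discounted (D.δ + K) g z) (hV0 : ∀ z, 0 ≤ V z) (hg0 : ∀ z, 0 ≤ g z)
    (n : ℕ) :
    markMean D.δ P n (fun z => ENNReal.ofReal (V z)) +
      ∫⁻ p in stochInterval E A n, D.along (fun y => ENNReal.ofReal (K * V y)) p
        ∂(timeMeasure.prod P) =
    ∫⁻ p in stochInterval E A n, D.along (fun y => ENNReal.ofReal (V y)) p *
        D.intensity ν p.2 p.1 Set.univ ∂(timeMeasure.prod P) +
      ∫⁻ p in stochInterval E A n, D.along (fun y => ENNReal.ofReal (g y)) p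
        ∂(timeMeasure.prod P) := by
  have hm : ∀ F : E × A → ℝ≥0∞, Measurable F → Measurable fun ω : JumpPath E A =>
      ∫⁻ s, (stochInterval E A n).indicator (D.along F) (s, ω) ∂timeMeasure := fun F hF =>
    ((hdyn.measurable_along hF).indicator (measurableSet_stochInterval' n)).lintegral_prod_left'
  have hmV : Measurable fun y => ENNReal.ofReal (V y) := by fun_prop
  have hmg : Measurable fun y => ENNReal.ofReal (g y) := by fun_prop
  have hmKV : Measurable fun y => ENNReal.ofReal (K * V y) := by fun_prop
  have hH : Measurable[(predictableSigma E A).prod inferInstance]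
      fun q : (ℝ≥0 × JumpPath E A) × (E × A) => D.along (fun y => ENNReal.ofReal (V y)) q.1 := by
    have h1 := hdyn.measurable_along_predictable hmV
    let _ := predictableSigma E A
    exact h1.comp measurable_fst
  have hpt := hP.lintegral_point hΓ n hH
  simp only [lintegral_const] at hpt
  rw [← hpt, setLIntegral_stochInterval n (hdyn.measurable_along hmKV),
    setLIntegral_stochInterval n (hdyn.measurable_along hmg), markMean,
    ← lintegral_add_right _ (hm _ hmKV), ← lintegral_add_right _ (hm _ hmg)]
  exact lintegral_congr (discounted_pathwise hδ hdyn hK hV hV0 hg0 n)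

theorem setLIntegral_along_lt_top (hδ : 0 < D.δ) [IsProbabilityMeasure P] (n : ℕ)
    {F : E × A → ℝ≥0∞} {c : ℝ≥0∞} (hc : c ≠ ∞) (hF : ∀ z, F z ≤ c) :
    ∫⁻ p in stochInterval E A n, D.along F p ∂(timeMeasure.prod P) ≠ ∞ := by
  refine ne_top_of_le_ne_top ?_ ((setLIntegral_le_lintegral _ _).trans
    (lintegral_mono (along_le D hF)))
  rw [lintegral_const_mul _ (measurable_discount_fst _), lintegral_discount_prod hδ]
  finiteness

theorem along_eq_of_some {F : E × A → ℝ≥0∞} {p : ℝ≥0 × JumpPath E A} {z : E × A}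
    (h : p.2.stateLeft D.flow p.1 = some z) : D.along F p = discount D.δ p.1 * F z := by
  rw [along, h]
  rfl

/-- The hypothesis is the inequality for the generator at the current state, up to an error `e`. The
integral of `K V` is added to both sides to avoid subtraction, and it cancels because it is finite.
-/
theorem markMean_le_step (hδ : 0 < D.δ) (hdyn : D.DynamicsHyp) (hf : D.CostHyp)
    (hΓ : IsBoundedIntensity (D.intensity ν) K') [IsProbabilityMeasure P]
    (hP : Compensates (D.intensity ν) P) (hK : 0 ≤ K)
    (hV : ∀ z, V z = D.discounted (D.δ + K) g z) (hV0 : ∀ z, 0 ≤ V z) (hg0 : ∀ z, 0 ≤ g z)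
    {n : ℕ} {e : ℝ≥0∞}
    (h : ∀ p ∈ stochInterval E A n, ∀ z, p.2.stateLeft D.flow p.1 = some z →
      ENNReal.ofReal (V z) * D.intensity ν p.2 p.1 Set.univ + ENNReal.ofReal (g z) ≤
        ENNReal.ofReal (D.f z) + ∫⁻ y, ENNReal.ofReal (V y) ∂D.intensity ν p.2 p.1 +
          ENNReal.ofReal (K * V z) + e) :
    markMean D.δ P n (fun z => ENNReal.ofReal (V z)) ≤
      ∫⁻ p in stochInterval E A n, D.along (fun y => ENNReal.ofReal (D.f y)) p
          ∂(timeMeasure.prod P) +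
        e * ∫⁻ p in stochInterval E A n, discount D.δ p.1 ∂(timeMeasure.prod P) +
        markMean D.δ P (n + 1) (fun z => ENNReal.ofReal (V z)) := by
  have hmV : Measurable fun y => ENNReal.ofReal (V y) := by fun_prop
  have hmg : Measurable fun y => ENNReal.ofReal (g y) := by fun_prop
  have hmKV : Measurable fun y => ENNReal.ofReal (K * V y) := by fun_prop
  have hmf : Measurable fun y => ENNReal.ofReal (D.f y) :=
    hf.unifCont.continuous.measurable.ennreal_ofReal
  have hB := setLIntegral_along_lt_top (D := D) (P := P) hδ n (c := ENNReal.ofReal (K * ‖V‖))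
    (F := fun y => ENNReal.ofReal (K * V y)) ENNReal.ofReal_ne_top fun z =>
      ENNReal.ofReal_le_ofReal (mul_le_mul_of_nonneg_left
        ((le_abs_self _).trans (V.norm_coe_le_norm z)) hK)
  have hmfe : Measurable fun p : ℝ≥0 × JumpPath E A =>
      D.along (fun y => ENNReal.ofReal (D.f y)) p + e * discount D.δ p.1 :=
    (hdyn.measurable_along hmf).add ((measurable_discount_fst D.δ).const_mul e)
  rw [← ENNReal.add_le_add_iff_right hB, markMean_add_eq hδ hdyn hΓ hP hK hV hV0 hg0 n,
    markMean_succ hΓ hP n hmV, ← lintegral_const_mul _ (measurable_discount_fst D.δ),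
    ← lintegral_add_right _ (hdyn.measurable_along hmg),
    ← lintegral_add_left (hdyn.measurable_along hmf),
    ← lintegral_add_left hmfe,
    ← lintegral_add_right _ (hdyn.measurable_along hmKV)]
  refine setLIntegral_mono' (measurableSet_stochInterval' n) fun p hp => ?_
  obtain ⟨y, -, hy⟩ := exists_stateLeft D hp
  have := mul_le_mul_right (h p hp _ hy) (discount D.δ p.1)
  simp only [along_eq_of_some hy]
  convert this using 1 <;> ring

theorem step_le_markMean (hδ : 0 < D.δ) (hdyn : D.DynamicsHyp) (hf : D.CostHyp)
    (hΓ : IsBoundedIntensity (D.intensity ν) K') [IsProbabilityMeasure P]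
    (hP : Compensates (D.intensity ν) P) (hK : 0 ≤ K)
    (hV : ∀ z, V z = D.discounted (D.δ + K) g z) (hV0 : ∀ z, 0 ≤ V z) (hg0 : ∀ z, 0 ≤ g z)
    {n : ℕ} {e : ℝ≥0∞}
    (h : ∀ p ∈ stochInterval E A n, ∀ z, p.2.stateLeft D.flow p.1 = some z →
      ENNReal.ofReal (D.f z) + ∫⁻ y, ENNReal.ofReal (V y) ∂D.intensity ν p.2 p.1 +
          ENNReal.ofReal (K * V z) ≤
        ENNReal.ofReal (V z) * D.intensity ν p.2 p.1 Set.univ + ENNReal.ofReal (g z) + e) :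
    ∫⁻ p in stochInterval E A n, D.along (fun y => ENNReal.ofReal (D.f y)) p
          ∂(timeMeasure.prod P) + markMean D.δ P (n + 1) (fun z => ENNReal.ofReal (V z)) ≤
      markMean D.δ P n (fun z => ENNReal.ofReal (V z)) +
        e * ∫⁻ p in stochInterval E A n, discount D.δ p.1 ∂(timeMeasure.prod P) := by
  have hmV : Measurable fun y => ENNReal.ofReal (V y) := by fun_prop
  have hmg : Measurable fun y => ENNReal.ofReal (g y) := by fun_prop
  have hmKV : Measurable fun y => ENNReal.ofReal (K * V y) := by fun_prop
  have hmf : Measurable fun y => ENNReal.ofReal (D.f y) :=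
    hf.unifCont.continuous.measurable.ennreal_ofReal
  have hB := setLIntegral_along_lt_top (D := D) (P := P) hδ n (c := ENNReal.ofReal (K * ‖V‖))
    (F := fun y => ENNReal.ofReal (K * V y)) ENNReal.ofReal_ne_top fun z =>
      ENNReal.ofReal_le_ofReal (mul_le_mul_of_nonneg_left
        ((le_abs_self _).trans (V.norm_coe_le_norm z)) hK)
  rw [← ENNReal.add_le_add_iff_right hB, add_right_comm (markMean _ _ _ _),
    markMean_add_eq hδ hdyn hΓ hP hK hV hV0 hg0 n,
    markMean_succ hΓ hP n hmV, ← lintegral_const_mul _ (measurable_discount_fst D.δ),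
    ← lintegral_add_right _ (hdyn.measurable_along hmg),
    ← lintegral_add_left (hdyn.measurable_along hmf),
    ← lintegral_add_right _ ((measurable_discount_fst D.δ).const_mul e),
    ← lintegral_add_right _ (hdyn.measurable_along hmKV)]
  refine setLIntegral_mono' (measurableSet_stochInterval' n) fun p hp => ?_
  obtain ⟨y, -, hy⟩ := exists_stateLeft D hp
  have := mul_le_mul_right (h p hp _ hy) (discount D.δ p.1)
  simp only [along_eq_of_some hy]
  convert this using 1 <;> ring

end Step

/-! ### The cost as a sum over the intervals between jumps -/

/-- The process and its left limits differ at jump times only, which are countably many and hence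
invisible to the cost. -/
theorem state_eq_stateLeft (D : PDMPData E A) {ω : JumpPath E A} {t : ℝ≥0}
    (h : ∀ n, ω.T n ≠ t) : ω.state D.flow t = ω.stateLeft D.flow t := by
  by_cases hn : ∃ n, (t, ω) ∈ stochInterval E A n
  · obtain ⟨n, h1, h2⟩ := hn
    rw [stateLeft_eq D.flow ω h1 h2, state_eq D.flow ω h1.le (lt_of_le_of_ne h2 (h _).symm)]
  · rw [stateLeft_of_notMem D (p := (t, ω)) (not_exists.1 hn)]
    exact dif_neg fun ⟨n, h1, h2⟩ => hn ⟨n, lt_of_le_of_ne h1 (h n), h2.le⟩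

/-- Outside the stochastic intervals the left state is `none` and the integrand vanishes, in
accordance with zero cost in the cemetery. -/
theorem lintegral_along_eq_tsum {P : Measure (JumpPath E A)} {F : E × A → ℝ≥0∞} :
    ∫⁻ p, D.along F p ∂(timeMeasure.prod P) =
      ∑' n, ∫⁻ p in stochInterval E A n, D.along F p ∂(timeMeasure.prod P) := by
  rw [← lintegral_iUnion (fun n => measurableSet_stochInterval' n)
    (pairwise_disjoint_stochInterval E A), eq_comm]
  refine setLIntegral_eq_of_support_subset fun p hp => ?_
  by_contra hn
  refine hp ?_
  rw [along, stateLeft_of_notMem D (by simpa using hn)]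
  simp

theorem J_eq (hδ : 0 < D.δ) (hdyn : D.DynamicsHyp) (hf : D.CostHyp) {x : E} {a : A}
    {ν : JumpPath E A → ℝ≥0 → A → ℝ} [IsProbabilityMeasure (D.dualLaw x a ν)] :
    D.J x a ν = (∑' n, ∫⁻ p in stochInterval E A n, D.along (fun y => ENNReal.ofReal (D.f y)) p
      ∂(timeMeasure.prod (D.dualLaw x a ν))).toReal := by
  have hmf : Measurable fun y => ENNReal.ofReal (D.f y) :=
    hf.unifCont.continuous.measurable.ennreal_ofReal
  have hma := hdyn.measurable_along hmf
  obtain ⟨F, hF⟩ := hf.bounded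
  have hin : ∀ ω : JumpPath E A, ∫ t in Set.Ioi (0 : ℝ),
      Real.exp (-D.δ * t) * (ω.state D.flow t.toNNReal).elim 0 D.f =
      (∫⁻ s, D.along (fun y => ENNReal.ofReal (D.f y)) (s, ω) ∂timeMeasure).toReal := by
    intro ω
    have hsec : Measurable fun s : ℝ≥0 => D.along (fun y => ENNReal.ofReal (D.f y)) (s, ω) :=
      hma.comp (by fun_prop)
    have hae : ∀ᵐ t : ℝ ∂(volume.restrict (Set.Ioi (0 : ℝ))),
        Real.exp (-D.δ * t) * (ω.state D.flow t.toNNReal).elim 0 D.f =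
        (D.along (fun y => ENNReal.ofReal (D.f y)) (t.toNNReal, ω)).toReal := by
      have hcount : (Set.range fun n => (ω.T n).toReal).Countable := Set.countable_range _
      have h0 : ∀ᵐ t : ℝ, t ∉ Set.range fun n => (ω.T n).toReal :=
        (hcount.ae_notMem volume)
      filter_upwards [ae_restrict_of_ae h0, ae_restrict_mem measurableSet_Ioi] with t ht ht0
      rw [state_eq_stateLeft D fun n hn => ht ⟨n, ?_⟩, along,
        ENNReal.toReal_mul, discount, ENNReal.toReal_ofReal (Real.exp_pos _).le,
        Real.coe_toNNReal _ (le_of_lt ht0)]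
      · cases ω.stateLeft D.flow t.toNNReal with
        | none => rfl
        | some z => simp [hf.nonneg z]
      · simp only [hn]
        exact Real.coe_toNNReal _ (le_of_lt ht0)
    rw [integral_congr_ae hae, integral_toReal, lintegral_timeMeasure hsec]
    · exact (hsec.comp measurable_real_toNNReal).aemeasurable
    · refine .of_forall fun t => (along_le D (c := ENNReal.ofReal F)
        (fun z => ENNReal.ofReal_le_ofReal (hF z)) _).trans_lt ?_
      exact ENNReal.mul_lt_top ENNReal.ofReal_lt_top ENNReal.ofReal_lt_top
  rw [J]
  simp only [hin]
  rw [integral_toReal, ← lintegral_along_eq_tsum, lintegral_prod_symm' _ hma]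
  · exact hma.lintegral_prod_left'.aemeasurable
  · refine .of_forall fun ω => (lintegral_mono fun s => along_le D (c := ENNReal.ofReal F)
        (fun z => ENNReal.ofReal_le_ofReal (hF z)) (s, ω)).trans_lt ?_
    simp only
    rw [lintegral_const_mul _ (measurable_discount _), lintegral_discount hδ]
    finiteness

end PDMPData

/-! ### Generator inequalities and their summation over all jumps -/

namespace PDMPData

open JumpPath

variable {d : ℕ} {E : Set (EuclideanSpace ℝ (Fin d))} {A : Type*} [MeasurableSpace A]
  [MetricSpace A] [SecondCountableTopology A] [BorelSpace A] {D : PDMPData E A}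

section Pointwise

variable {ν : JumpPath E A → ℝ≥0 → A → ℝ} {p : ℝ≥0 × JumpPath E A} {z : E × A}
  {V : (E × A) →ᵇ ℝ}

theorem integrable_control (hlam0 : D.ActionMeasureHyp) (hν : ν ∈ controls E A)
    (p : ℝ≥0 × JumpPath E A) : Integrable (ν p.2 p.1) D.lam0 := by
  have := hlam0.finite
  obtain ⟨c, hc⟩ := hν.2.1
  refine Integrable.of_bound (measurable_control hν p.2 p.1).aestronglyMeasurable c
    (.of_forall fun b => ?_)
  rw [Real.norm_of_nonneg (hν.1 _ _ _).le]
  exact hc _ _ _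

theorem integrable_control_mul (hlam0 : D.ActionMeasureHyp) (hν : ν ∈ controls E A)
    (V : (E × A) →ᵇ ℝ) (p : ℝ≥0 × JumpPath E A) (x : E) :
    Integrable (fun b => ν p.2 p.1 b * V (x, b)) D.lam0 :=
  (integrable_control hlam0 hν p).mul_bdd
    (by fun_prop : Measurable fun b => V (x, b)).aestronglyMeasurable
    (.of_forall fun b => V.norm_coe_le_norm (x, b))

theorem intensity_univ_eq_ofReal (hdyn : D.DynamicsHyp) (hlam0 : D.ActionMeasureHyp)
    (hν : ν ∈ controls E A) (hz : p.2.stateLeft D.flow p.1 = some z) :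
    D.intensity ν p.2 p.1 Set.univ =
      ENNReal.ofReal (∫ b, ν p.2 p.1 b ∂D.lam0 + D.rate z) := by
  have := hdyn.markov
  rw [intensity_univ D hz (measurable_control hν _ _), ENNReal.ofReal_add
    (integral_nonneg fun b => (hν.1 _ _ _).le) (hdyn.rate_nonneg z),
    ofReal_integral_eq_lintegral_ofReal (integrable_control hlam0 hν p)
      (.of_forall fun b => (hν.1 _ _ _).le)]

theorem lintegral_intensity_eq_ofReal (hdyn : D.DynamicsHyp) (hlam0 : D.ActionMeasureHyp)
    (hν : ν ∈ controls E A) (hz : p.2.stateLeft D.flow p.1 = some z) (hV0 : ∀ y, 0 ≤ V y) :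
    ∫⁻ y, ENNReal.ofReal (V y) ∂D.intensity ν p.2 p.1 =
      ENNReal.ofReal (∫ b, ν p.2 p.1 b * V (z.1, b) ∂D.lam0 +
        D.rate z * ∫ y, V (y, z.2) ∂D.Q z) := by
  have := hdyn.markov
  have hν0 : ∀ b, 0 ≤ ν p.2 p.1 b := fun b => (hν.1 _ _ _).le
  rw [lintegral_intensity D hz (measurable_control hν _ _)
      (by fun_prop : Measurable fun y => ENNReal.ofReal (V y)),
    ENNReal.ofReal_add (integral_nonneg fun b => mul_nonneg (hν0 b) (hV0 _))
      (mul_nonneg (hdyn.rate_nonneg z) (integral_nonneg fun y => hV0 _)),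
    ENNReal.ofReal_mul (hdyn.rate_nonneg z),
    ofReal_integral_eq_lintegral_ofReal (integrable_control_mul hlam0 hν V p z.1)
      (.of_forall fun b => mul_nonneg (hν0 b) (hV0 _)),
    ofReal_integral_eq_lintegral_ofReal
      (integrable_of_bounded (by fun_prop) fun y => V.norm_coe_le_norm (y, z.2))
      (.of_forall fun y => hV0 _)]
  simp only [ENNReal.ofReal_mul (hν0 _)]

theorem integral_control_mul_sub (hlam0 : D.ActionMeasureHyp) (hν : ν ∈ controls E A)
    (V : (E × A) →ᵇ ℝ) (p : ℝ≥0 × JumpPath E A) (z : E × A) :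
    Integrable (fun b => ν p.2 p.1 b * (V (z.1, b) - V z)) D.lam0 ∧
    ∫ b, ν p.2 p.1 b * (V (z.1, b) - V z) ∂D.lam0 =
      ∫ b, ν p.2 p.1 b * V (z.1, b) ∂D.lam0 - (∫ b, ν p.2 p.1 b ∂D.lam0) * V z := by
  have h1 := integrable_control_mul hlam0 hν V p z.1
  have h2 := (integrable_control hlam0 hν p).mul_const (V z)
  simp only [mul_sub]
  exact ⟨h1.sub h2, by rw [integral_sub h1 h2, integral_mul_const]⟩

variable {C K θ e : ℝ}

/-- All quantities are nonnegative and finite, so this is an inequality between real numbers. There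
`f`, `λ` and `K` cancel, and the integral over `λ₀` of the hypothesis on `tilt` remains. -/
theorem generator_le (hdyn : D.DynamicsHyp) (hlam0 : D.ActionMeasureHyp) (hf : D.CostHyp)
    (hν : ν ∈ controls E A) (hz : p.2.stateLeft D.flow p.1 = some z) (hC : 0 ≤ C)
    (hK0 : 0 ≤ K) (hK : ∀ z, C * D.lam0.real Set.univ + D.rate z ≤ K)
    (hθ : θ ∈ Set.Icc (0 : ℝ) 1) (hV0 : ∀ y, 0 ≤ V y) (he : 0 ≤ e)
    (h : ∀ b, tilt C θ (V (z.1, b) - V z) ≤ ν p.2 p.1 b * (V (z.1, b) - V z) + e) :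
    ENNReal.ofReal (V z) * D.intensity ν p.2 p.1 Set.univ +
        ENNReal.ofReal (D.f z + D.nonlocal C K θ V z) ≤
      ENNReal.ofReal (D.f z) + ∫⁻ y, ENNReal.ofReal (V y) ∂D.intensity ν p.2 p.1 +
        ENNReal.ofReal (K * V z) + ENNReal.ofReal (D.lam0.real Set.univ * e) := by
  have := hlam0.finite
  have hr := hdyn.rate_nonneg z
  have hν0 : ∀ b, 0 ≤ ν p.2 p.1 b := fun b => (hν.1 _ _ _).le
  have hn := nonlocal_nonneg hdyn hlam0 hC hK hθ hV0 z
  have i1 : 0 ≤ ∫ b, ν p.2 p.1 b * V (z.1, b) ∂D.lam0 :=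
    integral_nonneg fun b => mul_nonneg (hν0 b) (hV0 _)
  have i2 : 0 ≤ ∫ y, V (y, z.2) ∂D.Q z := integral_nonneg fun y => hV0 _
  have i3 : 0 ≤ ∫ b, ν p.2 p.1 b ∂D.lam0 := integral_nonneg hν0
  obtain ⟨j1, j2⟩ := integral_control_mul_sub hlam0 hν V p z
  have key : ∫ b, tilt C θ (V (z.1, b) - V z) ∂D.lam0 ≤
      ∫ b, ν p.2 p.1 b * (V (z.1, b) - V z) ∂D.lam0 + D.lam0.real Set.univ * e := by
    have : ∫ b, (ν p.2 p.1 b * (V (z.1, b) - V z) + e) ∂D.lam0 =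
        ∫ b, ν p.2 p.1 b * (V (z.1, b) - V z) ∂D.lam0 + D.lam0.real Set.univ * e := by
      rw [integral_add j1 (integrable_const e)]; simp
    rw [← this]
    exact integral_mono (integrable_tilt hlam0 hC hθ V z) (j1.add (integrable_const e)) h
  rw [intensity_univ_eq_ofReal hdyn hlam0 hν hz,
    lintegral_intensity_eq_ofReal hdyn hlam0 hν hz hV0, ← ENNReal.ofReal_mul (hV0 z),
    ← ENNReal.ofReal_add (mul_nonneg (hV0 z) (add_nonneg i3 hr)) (add_nonneg (hf.nonneg z) hn),
    ← ENNReal.ofReal_add (hf.nonneg z) (add_nonneg i1 (mul_nonneg hr i2)),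
    ← ENNReal.ofReal_add (add_nonneg (hf.nonneg z) (add_nonneg i1 (mul_nonneg hr i2)))
      (mul_nonneg hK0 (hV0 z)),
    ← ENNReal.ofReal_add (add_nonneg (add_nonneg (hf.nonneg z)
      (add_nonneg i1 (mul_nonneg hr i2))) (mul_nonneg hK0 (hV0 z))) (by positivity)]
  refine ENNReal.ofReal_le_ofReal ?_
  rw [j2] at key
  unfold nonlocal
  linarith

theorem le_generator (hdyn : D.DynamicsHyp) (hlam0 : D.ActionMeasureHyp) (hf : D.CostHyp)
    (hν : ν ∈ controls E A) (hz : p.2.stateLeft D.flow p.1 = some z) (hC : 0 ≤ C)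
    (hK0 : 0 ≤ K) (hK : ∀ z, C * D.lam0.real Set.univ + D.rate z ≤ K)
    (hθ : θ ∈ Set.Icc (0 : ℝ) 1) (hV0 : ∀ y, 0 ≤ V y) (he : 0 ≤ e)
    (h : ∀ b, ν p.2 p.1 b * (V (z.1, b) - V z) ≤ tilt C θ (V (z.1, b) - V z) + e) :
    ENNReal.ofReal (D.f z) + ∫⁻ y, ENNReal.ofReal (V y) ∂D.intensity ν p.2 p.1 +
        ENNReal.ofReal (K * V z) ≤
      ENNReal.ofReal (V z) * D.intensity ν p.2 p.1 Set.univ +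
        ENNReal.ofReal (D.f z + D.nonlocal C K θ V z) +
        ENNReal.ofReal (D.lam0.real Set.univ * e) := by
  have := hlam0.finite
  have hr := hdyn.rate_nonneg z
  have hν0 : ∀ b, 0 ≤ ν p.2 p.1 b := fun b => (hν.1 _ _ _).le
  have hn := nonlocal_nonneg hdyn hlam0 hC hK hθ hV0 z
  have i1 : 0 ≤ ∫ b, ν p.2 p.1 b * V (z.1, b) ∂D.lam0 :=
    integral_nonneg fun b => mul_nonneg (hν0 b) (hV0 _)
  have i2 : 0 ≤ ∫ y, V (y, z.2) ∂D.Q z := integral_nonneg fun y => hV0 _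
  have i3 : 0 ≤ ∫ b, ν p.2 p.1 b ∂D.lam0 := integral_nonneg hν0
  obtain ⟨j1, j2⟩ := integral_control_mul_sub hlam0 hν V p z
  have key : ∫ b, ν p.2 p.1 b * (V (z.1, b) - V z) ∂D.lam0 ≤
      ∫ b, tilt C θ (V (z.1, b) - V z) ∂D.lam0 + D.lam0.real Set.univ * e := by
    have hi := integrable_tilt hlam0 hC hθ V z
    have : ∫ b, (tilt C θ (V (z.1, b) - V z) + e) ∂D.lam0 =
        ∫ b, tilt C θ (V (z.1, b) - V z) ∂D.lam0 + D.lam0.real Set.univ * e := by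
      rw [integral_add hi (integrable_const e)]; simp
    rw [← this]
    exact integral_mono j1 (hi.add (integrable_const e)) h
  rw [intensity_univ_eq_ofReal hdyn hlam0 hν hz,
    lintegral_intensity_eq_ofReal hdyn hlam0 hν hz hV0, ← ENNReal.ofReal_mul (hV0 z),
    ← ENNReal.ofReal_add (mul_nonneg (hV0 z) (add_nonneg i3 hr)) (add_nonneg (hf.nonneg z) hn),
    ← ENNReal.ofReal_add (hf.nonneg z) (add_nonneg i1 (mul_nonneg hr i2)),
    ← ENNReal.ofReal_add (add_nonneg (hf.nonneg z) (add_nonneg i1 (mul_nonneg hr i2)))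
      (mul_nonneg hK0 (hV0 z)),
    ← ENNReal.ofReal_add (add_nonneg (mul_nonneg (hV0 z) (add_nonneg i3 hr))
      (add_nonneg (hf.nonneg z) hn)) (by positivity)]
  refine ENNReal.ofReal_le_ofReal ?_
  rw [j2] at key
  unfold nonlocal
  linarith

end Pointwise

section Verification

variable {ν : JumpPath E A → ℝ≥0 → A → ℝ} {V g : (E × A) →ᵇ ℝ} {P : Measure (JumpPath E A)}
  {C K θ e : ℝ}

theorem tsum_error_le (hδ : 0 < D.δ) [IsProbabilityMeasure P] (c : ℝ≥0∞) (m : ℕ) :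
    ∑' n, c * ∫⁻ p in stochInterval E A (n + m), discount D.δ p.1 ∂(timeMeasure.prod P) ≤
      c * ENNReal.ofReal (1 / D.δ) := by
  rw [ENNReal.tsum_mul_left]
  refine mul_le_mul_right ?_ _
  rw [← lintegral_discount_prod hδ P]
  refine le_trans ?_ (tsum_setLIntegral_stochInterval_le _ _)
  exact ENNReal.tsum_comp_le_tsum_of_injective (add_left_injective m) _

/-- The starting index `m` is 0 when the control is compared with the extreme parameters, and 1 when
the control before the first jump serves another purpose. The errors sum to at most `λ₀(A) e / δ`.
-/
theorem markMean_le_tsum (hδ : 0 < D.δ) (hdyn : D.DynamicsHyp) (hlam0 : D.ActionMeasureHyp)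
    (hf : D.CostHyp) (hν : ν ∈ controls E A) [IsProbabilityMeasure P]
    (hP : Compensates (D.intensity ν) P) (hC : 0 ≤ C)
    (hK0 : 0 ≤ K) (hK : ∀ z, C * D.lam0.real Set.univ + D.rate z ≤ K)
    (hθ : θ ∈ Set.Icc (0 : ℝ) 1) (hV0 : ∀ y, 0 ≤ V y)
    (hg : ∀ z, g z = D.f z + D.nonlocal C K θ V z)
    (hV : ∀ z, V z = D.discounted (D.δ + K) g z) (he : 0 ≤ e) {m : ℕ}
    (h : ∀ n ≥ m, ∀ p ∈ stochInterval E A n, ∀ z, p.2.stateLeft D.flow p.1 = some z → ∀ b,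
      tilt C θ (V (z.1, b) - V z) ≤ ν p.2 p.1 b * (V (z.1, b) - V z) + e) :
    markMean D.δ P m (fun z => ENNReal.ofReal (V z)) ≤
      ∑' n, ∫⁻ p in stochInterval E A (n + m), D.along (fun y => ENNReal.ofReal (D.f y)) p
          ∂(timeMeasure.prod P) +
        ENNReal.ofReal (D.lam0.real Set.univ * e) * ENNReal.ofReal (1 / D.δ) := by
  obtain ⟨K', hΓ⟩ := isBoundedIntensity hdyn hlam0 hν
  have hg0 : ∀ z, 0 ≤ g z := fun z => by
    rw [hg]; exact add_nonneg (hf.nonneg z) (nonlocal_nonneg hdyn hlam0 hC hK hθ hV0 z)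
  refine (ENNReal.le_tsum_of_le_add (c := fun n =>
    ∫⁻ p in stochInterval E A n, D.along (fun y => ENNReal.ofReal (D.f y)) p
          ∂(timeMeasure.prod P) + ENNReal.ofReal (D.lam0.real Set.univ * e) *
      ∫⁻ p in stochInterval E A n, discount D.δ p.1 ∂(timeMeasure.prod P))
    (fun n hn => markMean_le_step hδ hdyn hf hΓ hP hK0 hV hV0 hg0 fun p hp z hz => ?_)
    (tendsto_markMean hδ hΓ hP (c := ‖V‖.toNNReal) fun z =>
      ENNReal.ofReal_le_ofReal ((le_abs_self _).trans (V.norm_coe_le_norm z)))).trans ?_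
  · rw [hg]
    exact generator_le hdyn hlam0 hf hν hz hC hK0 hK hθ hV0 he (h n hn p hp z hz)
  · rw [ENNReal.tsum_add]
    exact add_le_add le_rfl (tsum_error_le hδ _ m)

theorem tsum_le_markMean (hδ : 0 < D.δ) (hdyn : D.DynamicsHyp) (hlam0 : D.ActionMeasureHyp)
    (hf : D.CostHyp) (hν : ν ∈ controls E A) [IsProbabilityMeasure P]
    (hP : Compensates (D.intensity ν) P) (hC : 0 ≤ C)
    (hK0 : 0 ≤ K) (hK : ∀ z, C * D.lam0.real Set.univ + D.rate z ≤ K)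
    (hθ : θ ∈ Set.Icc (0 : ℝ) 1) (hV0 : ∀ y, 0 ≤ V y)
    (hg : ∀ z, g z = D.f z + D.nonlocal C K θ V z)
    (hV : ∀ z, V z = D.discounted (D.δ + K) g z) (he : 0 ≤ e) {m : ℕ}
    (h : ∀ n ≥ m, ∀ p ∈ stochInterval E A n, ∀ z, p.2.stateLeft D.flow p.1 = some z → ∀ b,
      ν p.2 p.1 b * (V (z.1, b) - V z) ≤ tilt C θ (V (z.1, b) - V z) + e) :
    ∑' n, ∫⁻ p in stochInterval E A (n + m), D.along (fun y => ENNReal.ofReal (D.f y)) p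
          ∂(timeMeasure.prod P) ≤
      markMean D.δ P m (fun z => ENNReal.ofReal (V z)) +
        ENNReal.ofReal (D.lam0.real Set.univ * e) * ENNReal.ofReal (1 / D.δ) := by
  obtain ⟨K', hΓ⟩ := isBoundedIntensity hdyn hlam0 hν
  have hg0 : ∀ z, 0 ≤ g z := fun z => by
    rw [hg]; exact add_nonneg (hf.nonneg z) (nonlocal_nonneg hdyn hlam0 hC hK hθ hV0 z)
  refine (ENNReal.tsum_le_of_add_le (a := fun n =>
      markMean D.δ P n (fun z => ENNReal.ofReal (V z)))
    (c := fun n => ∫⁻ p in stochInterval E A n, D.along (fun y => ENNReal.ofReal (D.f y)) p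
          ∂(timeMeasure.prod P))
    (e := fun n => ENNReal.ofReal (D.lam0.real Set.univ * e) *
      ∫⁻ p in stochInterval E A n, discount D.δ p.1 ∂(timeMeasure.prod P))
    (fun n hn => step_le_markMean hδ hdyn hf hΓ hP hK0 hV hV0 hg0 fun p hp z hz => ?_)).trans ?_
  · rw [hg]
    exact le_generator hdyn hlam0 hf hν hz hC hK0 hK hθ hV0 he (h n hn p hp z hz)
  · exact add_le_add le_rfl (tsum_error_le hδ _ m)

theorem tsum_along_ne_top (hδ : 0 < D.δ) (hf : D.CostHyp) [IsProbabilityMeasure P] (m : ℕ) :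
    ∑' n, ∫⁻ p in stochInterval E A (n + m), D.along (fun y => ENNReal.ofReal (D.f y)) p
          ∂(timeMeasure.prod P) ≠ ∞ := by
  obtain ⟨F, hF⟩ := hf.bounded
  refine ne_top_of_le_ne_top ?_ ((ENNReal.tsum_comp_le_tsum_of_injective (add_left_injective m)
    fun n => ∫⁻ p in stochInterval E A n, D.along (fun y => ENNReal.ofReal (D.f y)) p
      ∂(timeMeasure.prod P)).trans ((tsum_setLIntegral_stochInterval_le _ _).trans
    (lintegral_mono (along_le D (c := ENNReal.ofReal F) fun z =>
      ENNReal.ofReal_le_ofReal (hF z)))))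
  rw [lintegral_const_mul _ (measurable_discount_fst _), lintegral_discount_prod hδ]
  finiteness

/-- The cost of a control bounded by `C` lies between the fixed points for `θ = 0` and
`θ = 1`. -/
theorem le_J (hδ : 0 < D.δ) (hdyn : D.DynamicsHyp) (hlam0 : D.ActionMeasureHyp)
    (hf : D.CostHyp) (hν : ν ∈ controls E A) (hνC : ∀ ω s b, ν ω s b ≤ C) (hC : 0 ≤ C)
    (hK0 : 0 ≤ K) (hK : ∀ z, C * D.lam0.real Set.univ + D.rate z ≤ K) (hV0 : ∀ y, 0 ≤ V y)
    (hg : ∀ z, g z = D.f z + D.nonlocal C K 0 V z)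
    (hV : ∀ z, V z = D.discounted (D.δ + K) g z) (x : E) (a : A) : V (x, a) ≤ D.J x a ν := by
  have hlaw := isDualLaw_dualLaw hdyn hlam0 hν x a
  have := hlaw.prob
  have key := markMean_le_tsum hδ hdyn hlam0 hf hν (P := D.dualLaw x a ν) hlaw.compensated hC hK0
    hK (by simp) hV0 hg hV le_rfl (m := 0) fun n _ p _ z _ b => by
      -- For `θ = 0` the claim is `C min(u, 0) ≤ c u` for `0 ≤ c ≤ C`.
      simp only [tilt, sub_zero, mul_one, mul_zero, zero_mul, add_zero]
      have h1 := hνC p.2 p.1 b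
      have h2 := (hν.1 p.2 p.1 b).le
      rcases le_total (V (z.1, b) - V z) 0 with h | h
      · rw [min_eq_left h]; nlinarith
      · rw [min_eq_right h]; nlinarith
  rw [markMean_zero D.δ hlaw.initial (by fun_prop), mul_zero, ENNReal.ofReal_zero, zero_mul,
    add_zero] at key
  rw [J_eq hδ hdyn hf]
  exact (ENNReal.ofReal_le_iff_le_toReal (tsum_along_ne_top hδ hf 0)).1 key

theorem J_le (hδ : 0 < D.δ) (hdyn : D.DynamicsHyp) (hlam0 : D.ActionMeasureHyp)
    (hf : D.CostHyp) (hν : ν ∈ controls E A) (hνC : ∀ ω s b, ν ω s b ≤ C) (hC : 0 ≤ C)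
    (hK0 : 0 ≤ K) (hK : ∀ z, C * D.lam0.real Set.univ + D.rate z ≤ K) (hV0 : ∀ y, 0 ≤ V y)
    (hg : ∀ z, g z = D.f z + D.nonlocal C K 1 V z)
    (hV : ∀ z, V z = D.discounted (D.δ + K) g z) (x : E) (a : A) : D.J x a ν ≤ V (x, a) := by
  have hlaw := isDualLaw_dualLaw hdyn hlam0 hν x a
  have := hlaw.prob
  have key := tsum_le_markMean hδ hdyn hlam0 hf hν (P := D.dualLaw x a ν) hlaw.compensated hC hK0
    hK (by simp) hV0 hg hV le_rfl (m := 0) fun n _ p _ z _ b => by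
      -- For `θ = 1` the claim is `c u ≤ C max(u, 0)` for `0 ≤ c ≤ C`.
      simp only [tilt, sub_self, mul_one, mul_zero, zero_mul, add_zero, zero_add]
      have h1 := hνC p.2 p.1 b
      have h2 := (hν.1 p.2 p.1 b).le
      rcases le_total (V (z.1, b) - V z) 0 with h | h
      · rw [max_eq_right h]; nlinarith
      · rw [max_eq_left h]; nlinarith
  rw [markMean_zero D.δ hlaw.initial (by fun_prop), mul_zero, ENNReal.ofReal_zero, zero_mul,
    add_zero] at key
  rw [J_eq hδ hdyn hf]
  exact ENNReal.toReal_le_of_le_ofReal (hV0 _) key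

end Verification

end PDMPData

namespace PDMPData

open JumpPath

/-! ### The first jump under a control concentrated near an action -/

variable {d : ℕ} {E : Set (EuclideanSpace ℝ (Fin d))} {A : Type*} [MeasurableSpace A]
  [MetricSpace A] [SecondCountableTopology A] [BorelSpace A] {D : PDMPData E A}

/-- Up to the first jump the control is `1 / (ε λ₀(B))` on the closed ball `B` with centre `a`
and radius `ε`, and at most `ε` elsewhere. -/
def Concentrated (D : PDMPData E A) (ν : JumpPath E A → ℝ≥0 → A → ℝ) (a : A) (ε : ℝ) : Prop :=
  ∀ (ω : JumpPath E A) (t : ℝ≥0), (t : ℝ≥0∞) ≤ ω.T 1 → ∀ b,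
    (b ∈ Metric.closedBall a ε → ν ω t b = 1 / (ε * D.lam0.real (Metric.closedBall a ε))) ∧
    (b ∉ Metric.closedBall a ε → ν ω t b ≤ ε)

theorem ActionMeasureHyp.closedBall_pos (hlam0 : D.ActionMeasureHyp) (a : A) {ε : ℝ}
    (hε : 0 < ε) : 0 < D.lam0.real (Metric.closedBall a ε) := by
  have := hlam0.finite
  have := hlam0.fullSupport
  exact ENNReal.toReal_pos (Metric.measure_closedBall_pos _ _ hε).ne' (measure_ne_top _ _)

section FirstJump

variable {ν : JumpPath E A → ℝ≥0 → A → ℝ} {a : A} {ε : ℝ} {P : Measure (JumpPath E A)}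

theorem lintegral_closedBall_weight (hlam0 : D.ActionMeasureHyp) (hε : 0 < ε) (c : ℝ≥0∞) :
    ∫⁻ _ in Metric.closedBall a ε,
      ENNReal.ofReal (1 / (ε * D.lam0.real (Metric.closedBall a ε))) * c ∂D.lam0 =
      ENNReal.ofReal (1 / ε) * c := by
  have := hlam0.finite
  have hB := hlam0.closedBall_pos a hε
  rw [setLIntegral_const, ← ENNReal.ofReal_toReal (measure_ne_top D.lam0 (Metric.closedBall a ε)),
    mul_right_comm, ← ENNReal.ofReal_mul (by positivity)]
  congr 2
  change 1 / (ε * D.lam0.real (Metric.closedBall a ε)) * D.lam0.real (Metric.closedBall a ε) = _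
  field_simp

theorem Concentrated.le_intensity_univ (hdyn : D.DynamicsHyp) (hlam0 : D.ActionMeasureHyp)
    (hν : ν ∈ controls E A) (hc : D.Concentrated ν a ε) (hε : 0 < ε)
    {p : ℝ≥0 × JumpPath E A} (hp : p ∈ stochInterval E A 0) :
    ENNReal.ofReal (1 / ε) ≤ D.intensity ν p.2 p.1 Set.univ := by
  have := hdyn.markov
  obtain ⟨y, -, hy⟩ := exists_stateLeft D hp
  rw [intensity_univ D hy (measurable_control hν _ _)]
  refine le_trans ?_ (le_self_add.trans (add_le_add (setLIntegral_le_lintegral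
    (Metric.closedBall a ε) _) le_rfl))
  have h1 := lintegral_closedBall_weight (a := a) hlam0 hε 1
  simp only [mul_one] at h1
  rw [← h1]
  refine le_of_eq (setLIntegral_congr_fun Metric.isClosed_closedBall.measurableSet fun b hb => ?_)
  simp only [((hc p.2 p.1 hp.2 b).1 hb)]

/-- Three contributions: the ball, of mass `1 / ε`, where `W` is at most `w`; the actions outside
the ball, of mass at most `ε λ₀(A)`; the jumps of the first component, at rate at most `M`. In the
last two only the global bound `k` is used. -/
theorem Concentrated.lintegral_intensity_le (hdyn : D.DynamicsHyp) (hlam0 : D.ActionMeasureHyp)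
    (hν : ν ∈ controls E A) (hc : D.Concentrated ν a ε) (hε : 0 < ε)
    {p : ℝ≥0 × JumpPath E A} (hp : p ∈ stochInterval E A 0) {z : E × A}
    (hz : p.2.stateLeft D.flow p.1 = some z) {W : E × A → ℝ≥0∞} (hW : Measurable W) {w k : ℝ≥0∞}
    (hWk : ∀ y, W y ≤ k) (hWw : ∀ b ∈ Metric.closedBall a ε, W (z.1, b) ≤ w) {M : ℝ}
    (hM : ∀ y, D.rate y ≤ M) :
    ∫⁻ y, W y ∂D.intensity ν p.2 p.1 ≤ ENNReal.ofReal (1 / ε) * w +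
      (ENNReal.ofReal ε * D.lam0 Set.univ + ENNReal.ofReal M) * k := by
  have := hdyn.markov
  rw [lintegral_intensity D hz (measurable_control hν _ _) hW,
    ← lintegral_add_compl _ (Metric.isClosed_closedBall (x := a) (ε := ε)).measurableSet,
    add_mul, add_assoc]
  refine add_le_add ?_ (add_le_add ?_ ?_)
  · rw [← lintegral_closedBall_weight (a := a) hlam0 hε w]
    refine setLIntegral_mono' Metric.isClosed_closedBall.measurableSet fun b hb => ?_
    rw [(hc p.2 p.1 hp.2 b).1 hb]
    exact mul_le_mul_right (hWw b hb) _
  · calc ∫⁻ b in (Metric.closedBall a ε)ᶜ, ENNReal.ofReal (ν p.2 p.1 b) * W (z.1, b) ∂D.lam0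
        ≤ ∫⁻ b in (Metric.closedBall a ε)ᶜ, ENNReal.ofReal ε * k ∂D.lam0 :=
          setLIntegral_mono' Metric.isClosed_closedBall.measurableSet.compl fun b hb =>
            mul_le_mul' (ENNReal.ofReal_le_ofReal ((hc p.2 p.1 hp.2 b).2 hb)) (hWk _)
      _ ≤ ENNReal.ofReal ε * D.lam0 Set.univ * k := by
          rw [setLIntegral_const, mul_right_comm]
          exact mul_le_mul_left (mul_le_mul_right (measure_mono (Set.subset_univ _)) _) _
  · refine mul_le_mul' (ENNReal.ofReal_le_ofReal (hM z)) ?_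
    refine (lintegral_mono fun y => hWk _).trans ?_
    simp

theorem measurable_time_predictable :
    Measurable[(predictableSigma E A).prod inferInstance]
      fun q : (ℝ≥0 × JumpPath E A) × (E × A) => (q.1.1 : ℝ≥0∞) := by
  have h1 := measurable_fst_predictable (E := E) (A := A)
  let _ := predictableSigma E A
  exact (h1.comp measurable_fst).coe_nnreal_ennreal

/-- The left side is the mean of `T 1`. Before `T 1` the intensity is at least `1 / ε`, while its
integral is the expected number of first jumps, at most one. -/
theorem Concentrated.measure_firstInterval_le (hdyn : D.DynamicsHyp)
    (hlam0 : D.ActionMeasureHyp) (hν : ν ∈ controls E A) (hc : D.Concentrated ν a ε)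
    (hε : 0 < ε) [IsProbabilityMeasure P] (hP : Compensates (D.intensity ν) P) :
    (timeMeasure.prod P) (stochInterval E A 0) ≤ ENNReal.ofReal ε := by
  obtain ⟨K, hΓ⟩ := isBoundedIntensity hdyn hlam0 hν
  have h1 := hP.lintegral_point hΓ 0 (H := fun _ => 1) measurable_const
  simp only [lintegral_const, one_mul] at h1
  have h2 : ENNReal.ofReal (1 / ε) * (timeMeasure.prod P) (stochInterval E A 0) ≤ 1 := by
    rw [← setLIntegral_const]
    refine (setLIntegral_mono' (measurableSet_stochInterval' 0) fun p hp =>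
      hc.le_intensity_univ hdyn hlam0 hν hε hp).trans ?_
    rw [← h1]
    refine (lintegral_mono (g := fun _ => 1) fun ω => ?_).trans (by simp)
    cases ω.point 0 with
    | none => exact zero_le
    | some q => exact le_rfl
  rw [one_div, ENNReal.ofReal_inv_of_pos hε] at h2
  have := mul_le_mul_right h2 (ENNReal.ofReal ε)
  rwa [← mul_assoc, ENNReal.mul_inv_cancel (ENNReal.ofReal_pos.2 hε).ne' ENNReal.ofReal_ne_top,
    one_mul, mul_one] at this

theorem firstTime_le_lintegral (ω : JumpPath E A) {q : ℝ≥0 × E × A} (hq : ω.point 0 = some q) :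
    (q.1 : ℝ≥0∞) ≤ ∫⁻ s, (stochInterval E A 0).indicator (fun _ => 1) (s, ω) ∂timeMeasure := by
  have hT : ω.T 1 = q.1 := by simp [T, hq]
  have hm : Measurable fun s : ℝ≥0 =>
      (stochInterval E A 0).indicator (fun _ => (1 : ℝ≥0∞)) (s, ω) :=
    (measurable_const.indicator (measurableSet_stochInterval' 0)).comp
      (by fun_prop : Measurable fun s : ℝ≥0 => (s, ω))
  rw [lintegral_timeMeasure hm]
  have hvol : (q.1 : ℝ≥0∞) = ∫⁻ _ in Set.Ioc (0 : ℝ) q.1, (1 : ℝ≥0∞) := by simp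
  rw [hvol, ← lintegral_indicator measurableSet_Ioc, ← lintegral_indicator measurableSet_Ioi]
  refine lintegral_mono fun s => ?_
  by_cases hs : s ∈ Set.Ioc (0 : ℝ) q.1
  · have hmem : (s.toNNReal, ω) ∈ stochInterval E A 0 := by
      refine ⟨?_, ?_⟩
      · change (0 : ℝ≥0∞) < _
        exact ENNReal.coe_pos.2 (Real.toNNReal_pos.2 hs.1)
      · rw [hT]
        exact ENNReal.coe_le_coe.2 (Real.toNNReal_le_iff_le_coe.2 hs.2)
    rw [Set.indicator_of_mem hs, Set.indicator_of_mem (Set.mem_Ioi.2 hs.1),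
      Set.indicator_of_mem hmem]
  · rw [Set.indicator_of_notMem hs]
    exact zero_le

/-- The integral of `s` against the intensity over the first interval is the mean of `T 1` on `{T 1
< ∞}`, at most `ε`; the lower bound `1 / ε` on the intensity gains a second factor `ε`. -/
theorem Concentrated.lintegral_time_le (hdyn : D.DynamicsHyp)
    (hlam0 : D.ActionMeasureHyp) (hν : ν ∈ controls E A) (hc : D.Concentrated ν a ε)
    (hε : 0 < ε) [IsProbabilityMeasure P] (hP : Compensates (D.intensity ν) P) :
    ∫⁻ p in stochInterval E A 0, p.1 ∂(timeMeasure.prod P) ≤ ENNReal.ofReal (ε * ε) := by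
  obtain ⟨K, hΓ⟩ := isBoundedIntensity hdyn hlam0 hν
  have h1 := hP.lintegral_point hΓ 0 measurable_time_predictable
  simp only [lintegral_const] at h1
  have hm1 : Measurable fun p : ℝ≥0 × JumpPath E A => (p.1 : ℝ≥0∞) := by fun_prop
  have h2 : ENNReal.ofReal (1 / ε) * ∫⁻ p in stochInterval E A 0, p.1 ∂(timeMeasure.prod P) ≤
      ENNReal.ofReal ε := by
    refine le_trans ?_ (hc.measure_firstInterval_le hdyn hlam0 hν hε hP)
    rw [← lintegral_const_mul _ hm1]
    refine (setLIntegral_mono' (measurableSet_stochInterval' 0) fun p hp =>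
      (mul_le_mul_left (hc.le_intensity_univ hdyn hlam0 hν hε hp) _).trans_eq
        (mul_comm _ _)).trans ?_
    rw [← h1, ← setLIntegral_one, setLIntegral_stochInterval 0 measurable_const]
    refine lintegral_mono fun ω => ?_
    cases hq : ω.point 0 with
    | none => exact zero_le
    | some q => exact firstTime_le_lintegral ω hq
  rw [one_div, ENNReal.ofReal_inv_of_pos hε] at h2
  have := mul_le_mul_right h2 (ENNReal.ofReal ε)
  rwa [← mul_assoc, ENNReal.mul_inv_cancel (ENNReal.ofReal_pos.2 hε).ne' ENNReal.ofReal_ne_top,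
    one_mul, ← ENNReal.ofReal_mul hε.le] at this

theorem ae_init_eq {z : E × A} [SFinite P] (hP : P.map (fun ω => ω.init) = Measure.dirac z) :
    ∀ᵐ p ∂(timeMeasure.prod P), p.2.init = z := by
  have h1 : ∀ᵐ ω ∂P, ω.init = z := by
    refine ae_of_ae_map (p := fun y => y = z) measurable_init.aemeasurable ?_
    rw [hP, ae_dirac_eq]
    exact rfl
  exact Measure.quasiMeasurePreserving_snd.ae h1

theorem stateLeft_firstInterval {p : ℝ≥0 × JumpPath E A} (hp : p ∈ stochInterval E A 0) :
    p.2.stateLeft D.flow p.1 = some (D.flowPair p.1 p.2.init) := by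
  rw [stateLeft_of_mem D hp]
  simp [T, mark]

/-- The bound on `W` over the ball may grow linearly in the time `s` of the jump, because `s` is
small only on average: against the rate `1 / ε`, the constant `η` meets a mean length at most `ε`
and the slope `κ` a first moment at most `ε²`. -/
theorem Concentrated.markMean_one_le (hδ : 0 < D.δ) (hdyn : D.DynamicsHyp)
    (hlam0 : D.ActionMeasureHyp) (hν : ν ∈ controls E A) (hc : D.Concentrated ν a ε)
    (hε : 0 < ε) [IsProbabilityMeasure P] (hP : Compensates (D.intensity ν) P) {z : E × A}
    (hP0 : P.map (fun ω => ω.init) = Measure.dirac z) {W : E × A → ℝ≥0∞} (hW : Measurable W)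
    {η κ k M : ℝ} (hη : 0 ≤ η) (hκ : 0 ≤ κ) (hk : 0 ≤ k) (hM0 : 0 ≤ M)
    (hWk : ∀ y, W y ≤ ENNReal.ofReal k)
    (hWw : ∀ (s : ℝ≥0), ∀ b ∈ Metric.closedBall a ε,
      W (D.flow s z.1 z.2, b) ≤ ENNReal.ofReal (η + κ * s))
    (hM : ∀ y, D.rate y ≤ M) :
    markMean D.δ P 1 W ≤
      ENNReal.ofReal (η + κ * ε + (ε * D.lam0.real Set.univ + M) * k * ε) := by
  have := hlam0.finite
  obtain ⟨K, hΓ⟩ := isBoundedIntensity hdyn hlam0 hν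
  rw [markMean_succ hΓ hP 0 hW]
  have hm1 : Measurable fun p : ℝ≥0 × JumpPath E A => (p.1 : ℝ≥0∞) := by fun_prop
  have hpt : ∀ᵐ p ∂(timeMeasure.prod P).restrict (stochInterval E A 0),
      discount D.δ p.1 * ∫⁻ y, W y ∂D.intensity ν p.2 p.1 ≤
      ENNReal.ofReal (1 / ε * η + (ε * D.lam0.real Set.univ + M) * k) +
        ENNReal.ofReal (1 / ε * κ) * p.1 := by
    filter_upwards [ae_restrict_of_ae (ae_init_eq hP0),
      ae_restrict_mem (measurableSet_stochInterval' 0)] with p hp0 hp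
    have hz := stateLeft_firstInterval (D := D) hp
    rw [hp0] at hz
    refine (mul_le_of_le_one_left zero_le (discount_le_one hδ p.1)).trans
      ((hc.lintegral_intensity_le hdyn hlam0 hν hε hp hz hW hWk (hWw p.1) hM).trans
        (le_of_eq ?_))
    rw [← ENNReal.ofReal_toReal (measure_ne_top D.lam0 Set.univ),
      ← ENNReal.ofReal_mul hε.le, ← ENNReal.ofReal_add (by positivity) hM0,
      ← ENNReal.ofReal_mul (by positivity), ← ENNReal.ofReal_mul (by positivity),
      ← ENNReal.ofReal_add (by positivity) (by positivity),
      ← ENNReal.ofReal_coe_nnreal (p := p.1), ← ENNReal.ofReal_mul (by positivity),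
      ← ENNReal.ofReal_add (by positivity) (by positivity)]
    congr 1
    simp only [Measure.real]
    ring
  refine (lintegral_mono_ae hpt).trans ?_
  rw [lintegral_add_left measurable_const, setLIntegral_const, lintegral_const_mul _ hm1]
  refine (add_le_add (mul_le_mul_right (hc.measure_firstInterval_le hdyn hlam0 hν hε hP) _)
    (mul_le_mul_right (hc.lintegral_time_le hdyn hlam0 hν hε hP) _)).trans (le_of_eq ?_)
  rw [← ENNReal.ofReal_mul (by positivity), ← ENNReal.ofReal_mul (by positivity),
    ← ENNReal.ofReal_add (by positivity) (by positivity)]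
  congr 1
  field_simp
  ring

/-- The constant function 1 is the resolvent of order `δ` of the constant `δ`, so the step identity
with `K = 0` expresses `1 - E[e^{-δ T₁}]` as a discounted length of the first interval, times `δ`.
-/
theorem Concentrated.one_le_markMean (hδ : 0 < D.δ) (hdyn : D.DynamicsHyp)
    (hlam0 : D.ActionMeasureHyp) (hν : ν ∈ controls E A) (hc : D.Concentrated ν a ε)
    (hε : 0 < ε) [IsProbabilityMeasure P] (hP : Compensates (D.intensity ν) P) {z : E × A}
    (hP0 : P.map (fun ω => ω.init) = Measure.dirac z) :
    1 ≤ markMean D.δ P 1 (fun _ => 1) + ENNReal.ofReal (D.δ * ε) := by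
  obtain ⟨K, hΓ⟩ := isBoundedIntensity hdyn hlam0 hν
  let V : (E × A) →ᵇ ℝ := BoundedContinuousFunction.const _ 1
  let g : (E × A) →ᵇ ℝ := BoundedContinuousFunction.const _ D.δ
  have hV : ∀ z, V z = D.discounted (D.δ + 0) g z := fun z => by
    change 1 = ∫ t in Set.Ioi (0 : ℝ), Real.exp (-(D.δ + 0) * t) * D.δ
    rw [integral_mul_const, add_zero, integral_exp_mul_Ioi (neg_lt_zero.2 hδ)]
    simp [hδ.ne']
  have h := markMean_add_eq hδ hdyn hΓ hP le_rfl hV (fun _ => zero_le_one) (fun _ => hδ.le) 0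
  have hV1 : (fun z => ENNReal.ofReal (V z)) = fun _ => 1 := funext fun z => ENNReal.ofReal_one
  rw [hV1, markMean_zero D.δ hP0 measurable_const] at h
  refine (le_self_add.trans_eq h).trans (add_le_add (le_of_eq ?_) ?_)
  · rw [markMean_succ hΓ hP 0 measurable_const]
    refine setLIntegral_congr_fun (measurableSet_stochInterval' 0) fun p hp => ?_
    simp only [along_eq_of_some (stateLeft_firstInterval (D := D) hp), lintegral_const, mul_one,
      one_mul]
  · refine (lintegral_mono (g := fun _ => ENNReal.ofReal D.δ) fun p => ?_).trans ?_
    · refine (along_le D (c := ENNReal.ofReal D.δ) (fun z => le_rfl) p).trans ?_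
      exact mul_le_of_le_one_right zero_le (discount_le_one hδ p.1)
    · rw [setLIntegral_const, ENNReal.ofReal_mul hδ.le]
      exact mul_le_mul_right (hc.measure_firstInterval_le hdyn hlam0 hν hε hP) _

end FirstJump

end PDMPData

/-! ### Linearity and bounds for discounted means at jump times -/

namespace JumpPath

variable {E A : Type*} [MeasurableSpace E] [MeasurableSpace A] {P : Measure (JumpPath E A)}

theorem measurable_discount_mark (δ : ℝ) (n : ℕ) {F : E × A → ℝ≥0∞} (hF : Measurable F) :
    Measurable fun ω : JumpPath E A =>
      (ω.mark n).elim 0 fun z => discount δ (ω.T n).toNNReal * F z := by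
  have h : Measurable fun q : JumpPath E A × Option (E × A) =>
      q.2.elim 0 fun z => discount δ (q.1.T n).toNNReal * F z :=
    measurable_prod_option measurable_const
      (((measurable_discount δ).comp
        ((measurable_T n).comp measurable_fst).ennreal_toNNReal).mul (hF.comp measurable_snd))
  exact h.comp (measurable_id.prodMk (measurable_mark n))

theorem markMean_add (δ : ℝ) (n : ℕ) {F : E × A → ℝ≥0∞} (hF : Measurable F)
    (G : E × A → ℝ≥0∞) :
    markMean δ P n (fun z => F z + G z) = markMean δ P n F + markMean δ P n G := by
  unfold markMean
  rw [← lintegral_add_left (measurable_discount_mark δ n hF)]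
  refine lintegral_congr fun ω => ?_
  cases ω.mark n with
  | none => simp
  | some z => simp [mul_add]

theorem markMean_const (δ : ℝ) (n : ℕ) (c : ℝ≥0∞) :
    markMean δ P n (fun _ => c) = c * markMean δ P n fun _ => 1 := by
  unfold markMean
  rw [← lintegral_const_mul c (measurable_discount_mark δ n measurable_const)]
  refine lintegral_congr fun ω => ?_
  cases ω.mark n with
  | none => simp
  | some z => simp [mul_comm]

theorem markMean_one_le_one {δ : ℝ} (hδ : 0 < δ) [IsProbabilityMeasure P] (n : ℕ) :
    markMean δ P n (fun _ => 1) ≤ 1 := by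
  refine (lintegral_mono (g := fun _ => 1) fun ω => ?_).trans (by simp)
  cases ω.mark n with
  | none => exact zero_le
  | some z => simpa using discount_le_one hδ _

end JumpPath

namespace PDMPData

open JumpPath

variable {d : ℕ} {E : Set (EuclideanSpace ℝ (Fin d))} {A : Type*} [MeasurableSpace A]
  [MetricSpace A] [SecondCountableTopology A] [BorelSpace A] {D : PDMPData E A}

/-! ### Steering to a given action -/

/-- The cost is split at `T 1`. The first part is at most `F ε`; by verification from index 1 on,
the second is the discounted mean of `V` at the first mark up to the error from `e`; and this mean
is close to `V (x, a)` since the first jump comes early and mostly lands nearby. -/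
theorem Concentrated.abs_J_sub_le {ν : JumpPath E A → ℝ≥0 → A → ℝ} {a a' : A} {x : E}
    {V g : (E × A) →ᵇ ℝ} {C K θ e ε η κ F M : ℝ} (hδ : 0 < D.δ) (hdyn : D.DynamicsHyp)
    (hlam0 : D.ActionMeasureHyp) (hf : D.CostHyp) (hν : ν ∈ controls E A)
    (hc : D.Concentrated ν a ε) (hε : 0 < ε) (hC : 0 ≤ C) (hK0 : 0 ≤ K)
    (hK : ∀ z, C * D.lam0.real Set.univ + D.rate z ≤ K) (hθ : θ ∈ Set.Icc (0 : ℝ) 1)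
    (hV0 : ∀ y, 0 ≤ V y) (hg : ∀ z, g z = D.f z + D.nonlocal C K θ V z)
    (hV : ∀ z, V z = D.discounted (D.δ + K) g z) (he : 0 ≤ e)
    (h : ∀ n ≥ 1, ∀ p ∈ stochInterval E A n, ∀ z, p.2.stateLeft D.flow p.1 = some z → ∀ b,
      |ν p.2 p.1 b * (V (z.1, b) - V z) - tilt C θ (V (z.1, b) - V z)| ≤ e)
    (hη : 0 ≤ η) (hκ : 0 ≤ κ) (hF0 : 0 ≤ F) (hF : ∀ z, D.f z ≤ F) (hM0 : 0 ≤ M)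
    (hM : ∀ z, D.rate z ≤ M)
    (hVw : ∀ (s : ℝ≥0), ∀ b ∈ Metric.closedBall a ε,
      |V (D.flow s x a', b) - V (x, a)| ≤ η + κ * s) :
    |D.J x a' ν - V (x, a)| ≤ F * ε +
      (η + κ * ε + (ε * D.lam0.real Set.univ + M) * (2 * ‖V‖) * ε) +
      D.lam0.real Set.univ * e * (1 / D.δ) + V (x, a) * (D.δ * ε) := by
  have := hlam0.finite
  have hlaw := isDualLaw_dualLaw hdyn hlam0 hν x a'
  have := hlaw.prob
  have hP : Compensates (D.intensity ν) (D.dualLaw x a' ν) := hlaw.compensated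
  set P := D.dualLaw x a' ν with hPdef
  have hmV : Measurable fun y => ENNReal.ofReal (V y) := by fun_prop
  let c : ℕ → ℝ≥0∞ := fun n =>
    ∫⁻ p in stochInterval E A n, D.along (fun y => ENNReal.ofReal (D.f y)) p ∂(timeMeasure.prod P)
  let W : E × A → ℝ≥0∞ := fun y => ENNReal.ofReal |V y - V (x, a)|
  have hmW : Measurable W := by
    have : Measurable fun y => V y - V (x, a) := by fun_prop
    exact this.abs.ennreal_ofReal
  have hsplit : ∑' n, c n = c 0 + ∑' n, c (n + 1) := tsum_eq_zero_add' ENNReal.summable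
  have hc0 : c 0 ≤ ENNReal.ofReal (F * ε) := by
    refine (lintegral_mono (g := fun _ => ENNReal.ofReal F) fun p => ?_).trans ?_
    · refine (along_le D (c := ENNReal.ofReal F)
        (fun z => ENNReal.ofReal_le_ofReal (hF z)) p).trans ?_
      exact mul_le_of_le_one_right zero_le (discount_le_one hδ p.1)
    · rw [setLIntegral_const, ENNReal.ofReal_mul hF0]
      exact mul_le_mul_right (hc.measure_firstInterval_le hdyn hlam0 hν hε hP) _
  have h1 := markMean_le_tsum hδ hdyn hlam0 hf hν hP hC hK0 hK hθ hV0 hg hV he (m := 1)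
    fun n hn p hp z hz b => by linarith [(abs_le.1 (h n hn p hp z hz b)).1]
  have h2 := tsum_le_markMean hδ hdyn hlam0 hf hν hP hC hK0 hK hθ hV0 hg hV he (m := 1)
    fun n hn p hp z hz b => by linarith [(abs_le.1 (h n hn p hp z hz b)).2]
  rw [← ENNReal.ofReal_mul (by positivity)] at h1 h2
  have hW := hc.markMean_one_le hδ hdyn hlam0 hν hε hP hlaw.initial hmW hη hκ
    (k := 2 * ‖V‖) (by positivity) hM0 (fun y => ENNReal.ofReal_le_ofReal (by
      have h1 := V.norm_coe_le_norm y
      have h2 := V.norm_coe_le_norm (x, a)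
      exact (abs_sub _ _).trans (by rw [two_mul]; exact add_le_add h1 h2)))
    (fun s b hb => ENNReal.ofReal_le_ofReal (hVw s b hb)) hM
  have hup : markMean D.δ P 1 (fun z => ENNReal.ofReal (V z)) ≤
      ENNReal.ofReal (V (x, a)) + markMean D.δ P 1 W := by
    refine (markMean_mono D.δ P 1 (G := fun y => ENNReal.ofReal (V (x, a)) + W y)
      fun y => ?_).trans ?_
    · rw [← ENNReal.ofReal_add (hV0 _) (abs_nonneg _)]
      exact ENNReal.ofReal_le_ofReal (by linarith [le_abs_self (V y - V (x, a))])
    · rw [markMean_add D.δ 1 measurable_const, markMean_const]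
      exact add_le_add (mul_le_of_le_one_right zero_le (markMean_one_le_one hδ 1)) le_rfl
  -- The lower bound also pays for the discount up to `T 1`, which accounts for the term `V (x, a) *
  -- (D.δ * ε)`.
  have hdown : ENNReal.ofReal (V (x, a)) ≤ markMean D.δ P 1 (fun z => ENNReal.ofReal (V z)) +
      markMean D.δ P 1 W + ENNReal.ofReal (V (x, a) * (D.δ * ε)) := by
    have h3 := mul_le_mul_right (hc.one_le_markMean hδ hdyn hlam0 hν hε hP hlaw.initial)
      (ENNReal.ofReal (V (x, a)))
    rw [mul_one, mul_add, ← markMean_const, ← ENNReal.ofReal_mul (hV0 _)] at h3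
    refine h3.trans (add_le_add ?_ le_rfl)
    rw [← markMean_add D.δ 1 hmV]
    refine markMean_mono D.δ P 1 fun y => ?_
    rw [← ENNReal.ofReal_add (hV0 _) (abs_nonneg _)]
    exact ENNReal.ofReal_le_ofReal (by linarith [neg_abs_le (V y - V (x, a))])
  have hJ : D.J x a' ν = (∑' n, c n).toReal := J_eq hδ hdyn hf
  have hJ0 : 0 ≤ D.J x a' ν := hJ ▸ ENNReal.toReal_nonneg
  have htop : ∑' n, c n ≠ ∞ := tsum_along_ne_top hδ hf 0
  have hJe : ∑' n, c n = ENNReal.ofReal (D.J x a' ν) := by rw [hJ, ENNReal.ofReal_toReal htop]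
  have hL := measureReal_nonneg (μ := D.lam0) (s := Set.univ)
  have q1 : 0 ≤ F * ε := by positivity
  have q2 : 0 ≤ η + κ * ε + (ε * D.lam0.real Set.univ + M) * (2 * ‖V‖) * ε := by positivity
  have q3 : 0 ≤ D.lam0.real Set.univ * e * (1 / D.δ) := by positivity
  have q4 : 0 ≤ V (x, a) * (D.δ * ε) := mul_nonneg (hV0 _) (by positivity)
  have r1 : ENNReal.ofReal (D.J x a' ν) ≤ ENNReal.ofReal (F * ε + (V (x, a) +
      (η + κ * ε + (ε * D.lam0.real Set.univ + M) * (2 * ‖V‖) * ε) +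
      D.lam0.real Set.univ * e * (1 / D.δ))) := by
    rw [ENNReal.ofReal_add q1 (add_nonneg (add_nonneg (hV0 _) q2) q3),
      ENNReal.ofReal_add (add_nonneg (hV0 _) q2) q3, ENNReal.ofReal_add (hV0 _) q2, ← hJe, hsplit]
    exact add_le_add hc0 (h2.trans (add_le_add (hup.trans (add_le_add le_rfl hW)) le_rfl))
  have r2 : ENNReal.ofReal (V (x, a)) ≤ ENNReal.ofReal (D.J x a' ν +
      D.lam0.real Set.univ * e * (1 / D.δ) +
      (η + κ * ε + (ε * D.lam0.real Set.univ + M) * (2 * ‖V‖) * ε) + V (x, a) * (D.δ * ε)) := by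
    rw [ENNReal.ofReal_add (add_nonneg (add_nonneg hJ0 q3) q2) q4,
      ENNReal.ofReal_add (add_nonneg hJ0 q3) q2, ENNReal.ofReal_add hJ0 q3, ← hJe, hsplit]
    refine hdown.trans (add_le_add (add_le_add (h1.trans ?_) hW) le_rfl)
    exact add_le_add le_add_self le_rfl
  rw [ENNReal.ofReal_le_ofReal_iff (by linarith [hV0 (x, a)])] at r1
  rw [ENNReal.ofReal_le_ofReal_iff (by linarith)] at r2
  rw [abs_le]
  constructor <;> linarith

open Classical in
/-- Up to the first jump, the control is concentrated near the action `a`; then it acts on the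
state so as to realize the operator `nonlocal` at `V`, up to an error `ε`. -/
noncomputable def steered (D : PDMPData E A) (V : E × A → ℝ) (C θ : ℝ) (a : A) (ε : ℝ)
    (ω : JumpPath E A) (t : ℝ≥0) (b : A) : ℝ :=
  if (t : ℝ≥0∞) ≤ ω.T 1 then
    if b ∈ Metric.closedBall a ε then 1 / (ε * D.lam0.real (Metric.closedBall a ε)) else ε
  else ε + (ω.stateLeft D.flow t).elim 0 fun z => if V (z.1, b) < V z then C * (1 - θ) else C * θ

theorem concentrated_steered (D : PDMPData E A) (V : E × A → ℝ) (C θ : ℝ) (a : A) (ε : ℝ) :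
    D.Concentrated (D.steered V C θ a ε) a ε := fun ω t ht b => by
  rw [steered, if_pos ht]
  exact ⟨fun hb => if_pos hb, fun hb => (if_neg hb).le⟩

/-- The summand `ε` keeps the control positive also where the feedback rate vanishes, in particular
for `θ ∈ {0, 1}` and after the cemetery is reached. -/
theorem steered_mem_controls (hdyn : D.DynamicsHyp) (hlam0 : D.ActionMeasureHyp)
    (V : (E × A) →ᵇ ℝ) {C θ : ℝ} (hC : 0 ≤ C) (hθ : θ ∈ Set.Icc (0 : ℝ) 1) (a : A) {ε : ℝ}
    (hε : 0 < ε) : D.steered V C θ a ε ∈ controls E A := by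
  have hB := hlam0.closedBall_pos a hε
  have hu : 0 < 1 / (ε * D.lam0.real (Metric.closedBall a ε)) := by positivity
  have h1 : 0 ≤ C * (1 - θ) := mul_nonneg hC (by linarith [hθ.2])
  have h2 : 0 ≤ C * θ := mul_nonneg hC hθ.1
  have h3 : C * (1 - θ) ≤ C := mul_le_of_le_one_right hC (by linarith [hθ.1])
  have h4 : C * θ ≤ C := mul_le_of_le_one_right hC hθ.2
  have helim : ∀ (y : Option (E × A)) (b : A),
      0 ≤ (y.elim 0 fun z => if V (z.1, b) < V z then C * (1 - θ) else C * θ) ∧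
      (y.elim 0 fun z => if V (z.1, b) < V z then C * (1 - θ) else C * θ) ≤ C := fun y b => by
    cases y with
    | none => exact ⟨le_rfl, hC⟩
    | some z =>
      simp only [Option.elim_some]
      split_ifs
      exacts [⟨h1, h3⟩, ⟨h2, h4⟩]
  refine ⟨fun ω t b => ?_, ⟨1 / (ε * D.lam0.real (Metric.closedBall a ε)) + ε + C,
    fun ω t b => ?_⟩, ?_⟩
  · unfold steered
    split_ifs
    exacts [hu, hε, by linarith [(helim (ω.stateLeft D.flow t) b).1]]
  · unfold steered
    split_ifs
    exacts [by linarith, by linarith, by linarith [(helim (ω.stateLeft D.flow t) b).2]]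
  · have hT := measurableSet_predictable_T_lt (E := E) (A := A) 1
    have hs := hdyn.measurable_stateLeft
    have hel : Measurable fun q : A × Option (E × A) =>
        (q.2.elim (0 : ℝ) fun z => if V (z.1, q.1) < V z then C * (1 - θ) else C * θ) := by
      refine measurable_prod_option measurable_const (Measurable.ite ?_ measurable_const
        measurable_const)
      exact measurableSet_lt (by fun_prop) (by fun_prop)
    let _ := predictableSigma E A
    refine Measurable.ite ?_ (Measurable.ite ?_ measurable_const measurable_const)
      (measurable_const.add (hel.comp (measurable_snd.prodMk (hs.comp measurable_fst))))
    · have : {q : (ℝ≥0 × JumpPath E A) × A | (q.1.1 : ℝ≥0∞) ≤ q.1.2.T 1} =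
          Prod.fst ⁻¹' {p : ℝ≥0 × JumpPath E A | p.2.T 1 < p.1}ᶜ := by
        ext q
        simp
      rw [this]
      exact measurable_fst hT.compl
    · exact measurable_snd Metric.isClosed_closedBall.measurableSet

/-- After the first jump the feedback rate times the increment of `V` is exactly `tilt`, so only the
summand `ε` contributes. -/
theorem abs_steered_sub_tilt_le (V : (E × A) →ᵇ ℝ) {C θ : ℝ} (a : A) {ε : ℝ} (hε : 0 < ε)
    {n : ℕ} (hn : 1 ≤ n) {p : ℝ≥0 × JumpPath E A} (hp : p ∈ stochInterval E A n) {z : E × A}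
    (hz : p.2.stateLeft D.flow p.1 = some z) (b : A) :
    |D.steered V C θ a ε p.2 p.1 b * (V (z.1, b) - V z) - tilt C θ (V (z.1, b) - V z)| ≤
      ε * (2 * ‖V‖) := by
  have hlt : ¬ (p.1 : ℝ≥0∞) ≤ p.2.T 1 := not_le.2 ((p.2.T_mono hn).trans_lt hp.1)
  have heq : D.steered V C θ a ε p.2 p.1 b * (V (z.1, b) - V z) -
      tilt C θ (V (z.1, b) - V z) = ε * (V (z.1, b) - V z) := by
    rw [steered, if_neg hlt, hz, Option.elim_some, tilt]
    split_ifs with h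
    · rw [min_eq_left (by linarith), max_eq_right (by linarith)]
      ring
    · rw [min_eq_right (by linarith), max_eq_left (by linarith)]
      ring
  rw [heq, abs_mul, abs_of_pos hε, two_mul]
  refine mul_le_mul_of_nonneg_left ((abs_sub _ _).trans ?_) hε.le
  exact add_le_add (V.norm_coe_le_norm _) (V.norm_coe_le_norm _)

theorem tendsto_J_steered {x : E} {a a' : A} {V g : (E × A) →ᵇ ℝ} {C K θ : ℝ} (hδ : 0 < D.δ)
    (hdyn : D.DynamicsHyp) (hlam0 : D.ActionMeasureHyp) (hf : D.CostHyp) (hC : 0 ≤ C)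
    (hK0 : 0 ≤ K) (hK : ∀ z, C * D.lam0.real Set.univ + D.rate z ≤ K)
    (hθ : θ ∈ Set.Icc (0 : ℝ) 1) (hV0 : ∀ y, 0 ≤ V y)
    (hg : ∀ z, g z = D.f z + D.nonlocal C K θ V z)
    (hV : ∀ z, V z = D.discounted (D.δ + K) g z) :
    Tendsto (fun ε => D.J x a' (D.steered V C θ a ε)) (𝓝[>] 0) (𝓝 (V (x, a))) := by
  have := hlam0.finite
  obtain ⟨F, hF⟩ := hf.bounded
  obtain ⟨M, hM⟩ := hdyn.rate_bounded
  obtain ⟨L, hL0, hL⟩ := hdyn.dist_flow_self_le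
  refine Metric.tendsto_nhds.2 fun η hη => ?_
  obtain ⟨ρ₀, hρ₀, hVρ⟩ := Metric.continuousAt_iff.1 (V.continuous.continuousAt (x := (x, a)))
    (η / 2) (by positivity)
  -- Up to time `ρ` the flow moves by at most `L ρ`, and the new action is within `ρ` of `a`; with
  -- `(L + 2) ρ = ρ₀` both stay strictly below `ρ₀`.
  have hρ : 0 < ρ₀ / (L + 2) := by positivity
  set ρ := ρ₀ / (L + 2) with hρdef
  have hρe : ρ * (L + 2) = ρ₀ := by rw [hρdef]; field_simp
  -- For times beyond `ρ` continuity gives nothing, but there `κ s` already exceeds the trivial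
  -- bound `2 ‖V‖`.
  set κ := 2 * ‖V‖ / ρ with hκdef
  have hκ0 : 0 ≤ κ := by positivity
  have hbound : ∀ ε ∈ Set.Ioc 0 ρ, |D.J x a' (D.steered V C θ a ε) - V (x, a)| ≤
      max F 0 * ε + (η / 2 + κ * ε + (ε * D.lam0.real Set.univ + max M 0) * (2 * ‖V‖) * ε) +
      D.lam0.real Set.univ * (ε * (2 * ‖V‖)) * (1 / D.δ) + V (x, a) * (D.δ * ε) := by
    intro ε hε
    refine (D.concentrated_steered V C θ a ε).abs_J_sub_le hδ hdyn hlam0 hf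
      (steered_mem_controls hdyn hlam0 V hC hθ a hε.1) hε.1 hC hK0 hK hθ hV0 hg hV
      (mul_nonneg hε.1.le (by positivity))
      (fun n hn p hp z hz b => abs_steered_sub_tilt_le V a hε.1 hn hp hz b) (by positivity) hκ0
      (le_max_right _ _) (fun z => (hF z).trans (le_max_left _ _)) (le_max_right _ _)
      (fun z => (hM z).trans (le_max_left _ _)) fun s b hb => ?_
    by_cases hs : (s : ℝ) ≤ ρ
    · have h1 : dist (D.flow s x a') x ≤ L * s := by
        have := hL x a' s 0 s.coe_nonneg le_rfl
        rwa [hdyn.flow_zero, Real.dist_eq, sub_zero, abs_of_nonneg s.coe_nonneg] at this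
      have h2 : dist (D.flow s x a', b) (x, a) < ρ₀ := by
        rw [Prod.dist_eq]
        refine max_lt ?_ ?_
        · have := mul_le_mul_of_nonneg_left hs hL0
          change dist (D.flow s x a') x < ρ₀
          nlinarith
        · have := Metric.mem_closedBall.1 hb
          change dist b a < ρ₀
          nlinarith [hε.2]
      have h3 := hVρ h2
      rw [Real.dist_eq] at h3
      have := mul_nonneg hκ0 s.coe_nonneg
      linarith
    · have h1 : 2 * ‖V‖ ≤ κ * s := by
        rw [hκdef, div_mul_eq_mul_div, le_div_iff₀ hρ]
        exact mul_le_mul_of_nonneg_left (not_le.1 hs).le (by positivity)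
      have h2 := (abs_sub (V (D.flow s x a', b)) (V (x, a))).trans
        (add_le_add (V.norm_coe_le_norm (D.flow s x a', b)) (V.norm_coe_le_norm (x, a)))
      linarith
  have hlim : Tendsto (fun ε => max F 0 * ε +
      (η / 2 + κ * ε + (ε * D.lam0.real Set.univ + max M 0) * (2 * ‖V‖) * ε) +
      D.lam0.real Set.univ * (ε * (2 * ‖V‖)) * (1 / D.δ) + V (x, a) * (D.δ * ε))
      (𝓝[>] 0) (𝓝 (η / 2)) := by
    have hc : Continuous fun ε : ℝ => max F 0 * ε +
      (η / 2 + κ * ε + (ε * D.lam0.real Set.univ + max M 0) * (2 * ‖V‖) * ε) +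
      D.lam0.real Set.univ * (ε * (2 * ‖V‖)) * (1 / D.δ) + V (x, a) * (D.δ * ε) := by fun_prop
    have := (hc.tendsto 0).mono_left (nhdsWithin_le_nhds (s := Set.Ioi 0))
    simpa using this
  filter_upwards [hlim.eventually (gt_mem_nhds (by linarith : η / 2 < η)),
    Ioc_mem_nhdsGT hρ] with ε h1 h2
  exact (hbound ε h2).trans_lt h1

/-! ### The dual value does not depend on the action -/

/-- The cost of `ν` at `(x, a)` lies between the fixed points for `θ = 0` and `θ = 1`, so some
intermediate `θ` attains it, and the control steered by that fixed point reproduces it in the limit.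
-/
theorem exists_steering (hδ : 0 < D.δ) (hdyn : D.DynamicsHyp) (hlam0 : D.ActionMeasureHyp)
    (hf : D.CostHyp) (x : E) (a a' : A) {ν : JumpPath E A → ℝ≥0 → A → ℝ}
    (hν : ν ∈ controls E A) :
    ∃ νε : ℝ → JumpPath E A → ℝ≥0 → A → ℝ, (∀ ε, 0 < ε → νε ε ∈ controls E A) ∧
      (∀ ε, D.Concentrated (νε ε) a ε) ∧
      Tendsto (fun ε => D.J x a' (νε ε)) (𝓝[>] 0) (𝓝 (D.J x a ν)) := by
  obtain ⟨C, hC⟩ := hν.2.1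
  obtain ⟨M, hM⟩ := hdyn.rate_bounded
  have hC0 : 0 ≤ max C 0 := le_max_right _ _
  have hνC : ∀ ω s b, ν ω s b ≤ max C 0 := fun ω s b => (hC ω s b).trans (le_max_left _ _)
  have hK0 : 0 ≤ max C 0 * D.lam0.real Set.univ + max M 0 := by positivity
  have hK : ∀ z, max C 0 * D.lam0.real Set.univ + D.rate z ≤
      max C 0 * D.lam0.real Set.univ + max M 0 := fun z => by
    gcongr
    exact (hM z).trans (le_max_left _ _)
  obtain ⟨W, hWc, hW⟩ := exists_fixedPoint hδ hdyn hlam0 hf hC0 hK0 hK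
  have hcont : Continuous fun θ => W θ (x, a) :=
    (BoundedContinuousFunction.lipschitz_eval_const (x, a)).continuous.comp hWc
  obtain ⟨θ, hθ⟩ : ∃ θ, W θ (x, a) = D.J x a ν := by
    obtain ⟨h0, g0, hg0, hV0⟩ := hW 0
    obtain ⟨h1, g1, hg1, hV1⟩ := hW 1
    exact intermediate_value_univ 0 1 hcont
      ⟨le_J hδ hdyn hlam0 hf hν hνC hC0 hK0 hK h0 hg0 hV0 x a,
        J_le hδ hdyn hlam0 hf hν hνC hC0 hK0 hK h1 hg1 hV1 x a⟩
  obtain ⟨h0, g, hg, hV⟩ := hW θ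
  refine ⟨D.steered (W θ) (max C 0) θ a,
    fun ε hε => steered_mem_controls hdyn hlam0 (W θ) hC0 θ.2 a hε,
    fun ε => D.concentrated_steered _ _ _ a ε, ?_⟩
  rw [← hθ]
  exact tendsto_J_steered hδ hdyn hlam0 hf hC0 hK0 hK θ.2 h0 hg hV

theorem J_nonneg (hf : D.CostHyp) (x : E) (a : A) (ν : JumpPath E A → ℝ≥0 → A → ℝ) :
    0 ≤ D.J x a ν :=
  integral_nonneg fun ω => integral_nonneg fun t => mul_nonneg (Real.exp_pos _).le (by
    cases ω.state D.flow t.toNNReal with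
    | none => exact le_rfl
    | some z => exact hf.nonneg z)

theorem one_mem_controls : (fun _ _ _ => 1 : JumpPath E A → ℝ≥0 → A → ℝ) ∈ controls E A :=
  ⟨fun _ _ _ => zero_lt_one, ⟨1, fun _ _ _ => le_rfl⟩, measurable_const⟩

/-- Every cost attainable from `a` is a limit of costs attainable from `a'`. -/
theorem Vstar_le (hδ : 0 < D.δ) (hdyn : D.DynamicsHyp) (hlam0 : D.ActionMeasureHyp)
    (hf : D.CostHyp) (x : E) (a a' : A) : D.Vstar x a' ≤ D.Vstar x a := by
  have : Nonempty (controls E A) := ⟨⟨_, one_mem_controls⟩⟩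
  refine le_ciInf fun ν => ?_
  obtain ⟨νε, h1, -, h3⟩ := exists_steering hδ hdyn hlam0 hf x a a' ν.2
  refine ge_of_tendsto h3 ?_
  filter_upwards [self_mem_nhdsWithin] with ε hε
  exact ciInf_le (f := fun ν : controls E A => D.J x a' ν)
    ⟨0, Set.forall_mem_range.2 fun ν => J_nonneg hf x a' ν⟩ ⟨νε ε, h1 ε hε⟩

end PDMPData

/-! ### The main result -/

theorem proposition5p5 {d : ℕ} {E : Set (EuclideanSpace ℝ (Fin d))} (hE : IsOpen E)
    {A : Type*} [MetricSpace A] [SecondCountableTopology A] [MeasurableSpace A] [BorelSpace A]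
    [StandardBorelSpace A] (D : PDMPData E A) (hδ : 0 < D.δ)
    (hdyn : D.DynamicsHyp) (hlam0 : D.ActionMeasureHyp) (hf : D.CostHyp) (x : E) :
    -- the laws, hence the costs, are well defined
    (∀ a : A, ∀ ν ∈ JumpPath.controls E A, ∃! P, D.IsDualLaw x a ν P) ∧
    -- the approximation
    (∀ a a' : A, ∀ ν ∈ JumpPath.controls E A,
      ∃ νε : ℝ → JumpPath E A → ℝ≥0 → A → ℝ,
        (∀ ε, 0 < ε → νε ε ∈ JumpPath.controls E A) ∧
        (∃ r : ℝ → ℝ, (∀ ε, 0 < ε → 0 < r ε) ∧ Tendsto r (𝓝[>] 0) (𝓝 0) ∧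
          ∀ ε, 0 < ε → ∀ (ω : JumpPath E A) (t : ℝ≥0), (t : ℝ≥0∞) ≤ ω.T 1 → ∀ b : A,
            (b ∈ Metric.closedBall a (r ε) →
              νε ε ω t b = 1 / (ε * D.lam0.real (Metric.closedBall a (r ε)))) ∧
            (b ∉ Metric.closedBall a (r ε) → νε ε ω t b ≤ ε)) ∧
        Tendsto (fun ε => D.J x a' (νε ε)) (𝓝[>] 0) (𝓝 (D.J x a ν))) ∧
    -- the dual value does not depend on the action
    (∀ a a' : A, D.Vstar x a = D.Vstar x a') := by
  refine ⟨fun a ν hν => PDMPData.existsUnique_isDualLaw hdyn hlam0 hν x a, fun a a' ν hν => ?_,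
    fun a a' => le_antisymm (PDMPData.Vstar_le hδ hdyn hlam0 hf x a' a)
      (PDMPData.Vstar_le hδ hdyn hlam0 hf x a a')⟩
  obtain ⟨νε, h1, h2, h3⟩ := PDMPData.exists_steering hδ hdyn hlam0 hf x a a' hν
  -- The radius is taken to be `r(ε) = ε`.
  exact ⟨νε, h1, ⟨fun ε => ε, fun ε hε => hε, tendsto_nhdsWithin_of_tendsto_nhds tendsto_id,
    fun ε _ => h2 ε⟩, h3⟩
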